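/- **Setting.** Let $\mathrm R$ be a finite (not necessarily crystallographic) root system with basis $B$, positive roots $\mathrm R^+$ and coroots $\alpha^\vee$, let $F\subseteq\mathbb R$ be a subfield containing all $\langle\beta,\alpha^\vee\rangle$ ($\alpha,\beta\in \mathrm R$), and let $\Lambda$ be a totally ordered abelian group that is an ordered $F$-vector space (multiplication by non-negative elements of $F$ is monotone). Put $\mathbb A=\mathrm{span}_F(\mathrm R)\otimes_F\Lambda$, with the induced reflections $r_\alpha$, the evaluations $\langle\cdot,\alpha^\vee\rangle:\mathbb A\to\Lambda$, the action of the finite Weyl group $\overline W$ of $\mathrm R$, and the $\Lambda$-valued metric $d(u,v)=\sum_{\alpha\in \mathrm R^+}|\langle v-u,\alpha^\vee\rangle|$. Let $T\neq 0$ be a $\overline W$-stable subgroup of $\mathbb A$, acting by translations, and let $\overline WT=\overline W\ltimes T$; the full affine Weyl group is $W=\overline W\ltimes\mathbb A$. * A hyperplane is a set $\{v:\langle v,\alpha^\vee\rangle=c\}$ with $\alpha\in\mathrm R$, $c\in\Lambda$; the sets $\{\langle v,\alpha^\vee\rangle\ge c\}$ and $\{\langle v,\alpha^\vee\rangle\le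 c\}$ are its half-apartments. It and its half-apartments are *special* if it is the fixed point set of some $v\mapsto r_\alpha(v)+t$ with $t\in T$, $r_\alpha(t)=-t$. A point is special if for every root $\alpha$ it lies on a special hyperplane parallel to $\{\langle v,\alpha^\vee\rangle=0\}$. A subset of $\mathbb A$ is *convex* if it is an intersection of finitely many special half-apartments (it is then closed). * Weyl chambers are the images under $W$ of $\mathcal C=\{v:\langle v,\alpha^\vee\rangle\ge0\ \forall\alpha\in \mathrm R^+\}$. Weyl simplices are the images $w(\mathcal C_J)$ of the faces $\mathcal C_J=\{v\in\mathcal C:\langle v,\alpha^\vee\rangle=0\ \forall\alpha\in J\}$, $J\subseteq B$, $w\in W$; such a simplex is based at $w(0)$. A *generalized affine building* modelled on $(\mathrm R,\Lambda,T)$ is a set $X$ with a set $\mathcal A$ (an atlas) of injective maps (charts) $f:\mathbb A\to X$, whose images are called apartments, such that, with Weyl chambers, Weyl simplices, half-apartments, special points etc. of $X$ being the images of those of $\mathbb A$ under charts: * (A1) $f\circ w\in\mathcal A$ for $f\in\mathcal A$, $w\in\overline WT$. * (A2) If $f,g\in\mathcal A$ and $f(\mathbb A)\cap g(\mathbb A)\ne\emptyset$,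 then $Y=f^{-1}(g(\mathbb A))$ is convex and $f|_Y=(g\circ w)|_Y$ for some $w\in\overline WT$. * (A3) Any two points of $X$ lie in a common apartment. (The distance $d_{\mathcal A}(x,y)$ is then defined as the distance of the preimages of $x,y$ under a chart whose image contains both.) * (A4) Any two Weyl chambers of $X$ contain Weyl chambers of $X$ whose union lies in one apartment. * (A5) For every apartment $A$ and $x\in A$ there is a retraction $r:X\to A$ that does not increase $d_{\mathcal A}$ and satisfies $r^{-1}(x)=\{x\}$. * (A6) If three apartments pairwise intersect in half-apartments, then all three have a common point. It is *thick* with respect to $\overline WT$ if for every special hyperplane $H$ of $X$ there are two apartments containing $H$ whose intersection is a half-apartment bounded by $H$, and whenever two apartments meet in a half-apartment, its bounding hyperplane is special. For $x\in X$, two Weyl simplices $S,S'$ of $X$ based at $x$ *share the same germ* if $S\cap S'$ is a $d_{\mathcal A}$-neighbourhood of $x$ in both $S$ and $S'$. Let $\Delta_xS$ be the equivalence class (germ) of $S$, and $\Delta_xX$ the set of germs of all Weyl simplices based at $x$ (including $\{x\}$, the empty simplex). Put $\Delta_xS_1\le\Delta_xS_2$ if the two germs have $x$-based representatives $S_1',S_2'$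 in a common apartment with $S_1'$ a face of $S_2'$. For an apartment $A\ni x$ let $\Delta_xA$ be the set of germs of the Weyl simplices based at $x$ and contained in $A$. **Theorem.** Let $(X,\mathcal A)$ be a generalized affine building modelled on $(\mathrm R,\Lambda,T)$ and let $x\in X$. 1. The relation $\le$ is a partial order on $\Delta_xX$, and with it $\Delta_xX$ is a (simplicial) spherical building of type $\mathrm R$ with apartments the sets $\Delta_xA$, $A\ni x$. That is: $\Delta_xX$ is a simplicial complex and the union of its subcomplexes $\Delta_xA$; each $\Delta_xA$ is isomorphic to the Coxeter complex of the finite group $\overline W$ with the simple reflections as generators; any two simplices lie in a common $\Delta_xA$; and if $\Delta_xA$ and $\Delta_xA'$ both contain the simplices $a$ and $b$, there is an isomorphism $\Delta_xA\to\Delta_xA'$ fixing all faces of $a$ and of $b$. 2. If $x$ is special and $X$ is thick with respect to $\overline WT$, then $\Delta_xX$ is thick: every panel is contained in at least three chambers. 3. $\Delta_xX$ is independent of the atlas: if $\mathcal A'$ is another atlas on the set $X$ making it a generalized affine building modelled on $(\mathrm R,\Lambda,T)$ with $d_{\mathcal A'}=d_{\mathcal A}$, then $\mathcal A$ and $\mathcal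 A'$ determine the same germs at $x$ (a germ being identified with the class of all subsets of $X$ that agree with a representative on some ball around $x$), the same relation $\le$ and the same apartments $\Delta_xA$. -/

import Mathlib

open scoped TensorProduct

noncomputable section

/-! ## Simplicial complexes, Coxeter complexes, spherical buildings -/

/-- A simplicial complex, described by the poset of its simplices (the empty simplex included):
any two simplices have a greatest lower bound, and the simplices below a given one form the poset
of subsets of a finite set. -/
def IsSimplicialPoset (D : Type*) [PartialOrder D] : Prop :=
  Nonempty D ∧ (∀ a b : D, ∃ c, IsGLB {a, b} c) ∧
    ∀ a : D, ∃ n : ℕ, Nonempty (Set.Iic a ≃o Set (Fin n))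

/-- The Coxeter complex of a group `W` with generators `s k`: the standard cosets
`w ⟨s k | k ∈ J⟩`, ordered by reverse inclusion. -/
abbrev CoxeterComplex {W κ : Type*} [Group W] (s : κ → W) : Type _ :=
  {C : (Set W)ᵒᵈ // ∃ (w : W) (J : Set κ),
    OrderDual.ofDual C = (fun v => w * v) '' (Subgroup.closure (s '' J) : Set W)}

/-- The simplicial complex `D` is a spherical building of type `(W, s)` with system of apartments
`apts`. -/
structure IsSphericalBuilding {W κ : Type*} [Group W] (s : κ → W)
    (D : Type*) [PartialOrder D] (apts : Set (Set D)) : Prop where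
  finite_group : Finite W
  simplicial : IsSimplicialPoset D
  /-- `D` is the union of its apartments. -/
  cover : ⋃₀ apts = Set.univ
  /-- Apartments are subcomplexes. -/
  subcomplex : ∀ E ∈ apts, IsLowerSet E
  /-- Apartments are Coxeter complexes of type `(W, s)`. -/
  coxeter : ∀ E ∈ apts, Nonempty (E ≃o CoxeterComplex s)
  /-- Any two simplices lie in a common apartment. -/
  exists_apartment : ∀ a b : D, ∃ E ∈ apts, a ∈ E ∧ b ∈ E
  /-- If two apartments both contain the simplices `a` and `b`, there is an isomorphism between
  them which fixes `a` and `b` pointwise, that is, fixes all faces of `a` and of `b`. -/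
  exists_iso : ∀ E ∈ apts, ∀ E' ∈ apts, ∀ a b : D, a ∈ E → a ∈ E' → b ∈ E → b ∈ E' →
    ∃ φ : E ≃o E', ∀ c : E, ((c : D) ≤ a ∨ (c : D) ≤ b) → ((φ c : E') : D) = c

/-- Thickness: every panel (codimension one face of a chamber) lies in at least three chambers. -/
def IsThickComplex (D : Type*) [PartialOrder D] : Prop :=
  ∀ p : D, (∃ c, IsMax c ∧ p ⋖ c) → 3 ≤ {c : D | IsMax c ∧ p ≤ c}.encard

namespace GenAffine

/-! ## The model space -/

section Model

variable {F : Subfield ℝ} {ι M N Λ : Type*} [AddCommGroup M] [Module F M]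
  [AddCommGroup N] [Module F N] [AddCommGroup Λ] [LinearOrder Λ] [Module F Λ]

/-- `i` indexes a positive root with respect to the simple roots indexed by `B`: a linear
combination of simple roots with non-negative coefficients in `F`. -/
def IsPos (P : RootPairing ι F M N) (B : Set ι) (i : ι) : Prop :=
  P.root i ∈ PointedCone.hull F (P.root '' B)

/-- A basis of a (not necessarily crystallographic) root system: linearly independent roots such
that each root is a linear combination of them with all coefficients `≥ 0` or all `≤ 0`. -/
structure IsBasis (P : RootPairing ι F M N) (B : Set ι) : Prop where
  linearIndepOn : LinearIndepOn F P.root B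
  pos_or_neg : ∀ i, IsPos P B i ∨ -P.root i ∈ PointedCone.hull F (P.root '' B)

/-- The spherical Weyl group, generated by the reflections of `span_F R`. -/
def weylGroup (P : RootPairing ι F M N) : Subgroup (M ≃ₗ[F] M) :=
  Subgroup.closure (Set.range P.reflection)

/-- The simple reflections. -/
def simpleReflection (P : RootPairing ι F M N) (B : Set ι) (b : B) : weylGroup P :=
  ⟨P.reflection b, Subgroup.subset_closure ⟨b, rfl⟩⟩

variable (F M Λ) in
/-- The model space `span_F R ⊗ Λ`; `M` is the `F`-span of the roots. -/
abbrev ModelSpace : Type _ := M ⊗[F] Λ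

/-- The action of linear automorphisms of `M` on the model space. -/
def act (w : M ≃ₗ[F] M) : ModelSpace F M Λ ≃ₗ[F] ModelSpace F M Λ :=
  LinearEquiv.rTensor Λ w

/-- The evaluation `x ↦ ⟨x, αᵢ^∨⟩ ∈ Λ` of a coroot on the model space. -/
def coev (P : RootPairing ι F M N) (i : ι) : ModelSpace F M Λ →ₗ[F] Λ :=
  (TensorProduct.lid F Λ).toLinearMap ∘ₗ LinearMap.rTensor Λ (P.coroot' i)

/-- The affine Weyl group with translation part `T`, as a set of maps `v ↦ w v + t`.
The full affine Weyl group is the case `T = ⊤`. -/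
def affineWeyl (P : RootPairing ι F M N) (T : AddSubgroup (ModelSpace F M Λ)) :
    Set (ModelSpace F M Λ → ModelSpace F M Λ) :=
  {g | ∃ w ∈ weylGroup P, ∃ t ∈ T, g = fun v => act w v + t}

/-- The hyperplane `⟨x, αᵢ^∨⟩ = c`. -/
def hyperplane (P : RootPairing ι F M N) (i : ι) (c : Λ) : Set (ModelSpace F M Λ) :=
  {v | coev P i v = c}

/-- The half-apartment `⟨x, αᵢ^∨⟩ ≥ c`. (The other one determined by the same hyperplane is
obtained from the root `-αᵢ` and `-c`.) -/
def halfApartment (P : RootPairing ι F M N) (i : ι) (c : Λ) : Set (ModelSpace F M Λ) :=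
  {v | c ≤ coev P i v}

/-- A hyperplane is special with respect to `T` if it is the fixed point set of an affine
reflection `t ∘ r_α`, `t ∈ T`, `r_α t = -t`. -/
def IsSpecialHyperplane (P : RootPairing ι F M N) (T : AddSubgroup (ModelSpace F M Λ))
    (H : Set (ModelSpace F M Λ)) : Prop :=
  ∃ i, ∃ t ∈ T, act (P.reflection i) t = -t ∧ H = {v | act (P.reflection i) v + t = v}

/-- A point of the model space is special if for each root it lies on a special hyperplane
parallel to the hyperplane of that root. -/
def IsSpecialPoint (P : RootPairing ι F M N) (T : AddSubgroup (ModelSpace F M Λ))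
    (v : ModelSpace F M Λ) : Prop :=
  ∀ i, ∃ c, IsSpecialHyperplane P T (hyperplane P i c) ∧ v ∈ hyperplane P i c

/-- Convex subsets (with respect to the affine Weyl group with translation part `T`):
intersections of finitely many special half-apartments. They are automatically closed. -/
def IsWTConvex (P : RootPairing ι F M N) (T : AddSubgroup (ModelSpace F M Λ))
    (Y : Set (ModelSpace F M Λ)) : Prop :=
  ∃ s : Finset (ι × Λ), (∀ p ∈ s, IsSpecialHyperplane P T (hyperplane P p.1 p.2)) ∧
    Y = ⋂ p ∈ s, halfApartment P p.1 p.2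

/-- The fundamental Weyl chamber. -/
def fundChamber (P : RootPairing ι F M N) (B : Set ι) : Set (ModelSpace F M Λ) :=
  {v | ∀ i, IsPos P B i → 0 ≤ coev P i v}

/-- The face of the fundamental Weyl chamber on which the simple coroots in `J ⊆ B` vanish. -/
def fundFace (P : RootPairing ι F M N) (B J : Set ι) : Set (ModelSpace F M Λ) :=
  {v ∈ fundChamber P B | ∀ j ∈ J, coev P j v = 0}

open Classical in
/-- The `Λ`-valued distance `∑_{α > 0} |⟨v - u, α^∨⟩|` on the model space. -/
def modelDist [Fintype ι] (P : RootPairing ι F M N) (B : Set ι) (u v : ModelSpace F M Λ) : Λ :=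
  ∑ i with IsPos P B i, |coev P i (v - u)|

end Model

/-! ## Generalized affine buildings

`A` is a set of charts `ModelSpace → X`. -/

section Building

variable {F : Subfield ℝ} {ι M N Λ X : Type*} [Fintype ι] [AddCommGroup M] [Module F M]
  [AddCommGroup N] [Module F N] [AddCommGroup Λ] [LinearOrder Λ] [Module F Λ]

open Classical in
/-- The distance of two points of `X`: the distance of their preimages under some chart whose
image contains both. (Independent of the chart when (A1), (A2) and (A3) below hold.) -/
def chartDist (P : RootPairing ι F M N) (B : Set ι) (A : Set (ModelSpace F M Λ → X))
    (x y : X) : Λ :=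
  if h : ∃ p : ModelSpace F M Λ × ModelSpace F M Λ, ∃ f ∈ A, f p.1 = x ∧ f p.2 = y then
    modelDist P B h.choose.1 h.choose.2
  else 0

/-- `S` is a Weyl chamber of `X`: the image under a chart of an image of the fundamental Weyl
chamber under the full affine Weyl group. -/
def IsWeylChamber (P : RootPairing ι F M N) (B : Set ι) (A : Set (ModelSpace F M Λ → X))
    (S : Set X) : Prop :=
  ∃ f ∈ A, ∃ g ∈ affineWeyl P ⊤, S = f '' (g '' fundChamber P B)

/-- `Y` is a half-apartment of `X`. -/
def IsHalfApartment (P : RootPairing ι F M N) (A : Set (ModelSpace F M Λ → X))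
    (Y : Set X) : Prop :=
  ∃ f ∈ A, ∃ i c, Y = f '' halfApartment P i c

/-- `(X, A)` is a generalized affine building modelled on the model space with affine Weyl group
of translation part `T`. -/
structure IsAffineBuilding (P : RootPairing ι F M N) (B : Set ι)
    (T : AddSubgroup (ModelSpace F M Λ)) (A : Set (ModelSpace F M Λ → X)) : Prop where
  injective : ∀ f ∈ A, Function.Injective f
  a1 : ∀ f ∈ A, ∀ w ∈ affineWeyl P T, f ∘ w ∈ A
  a2 : ∀ f ∈ A, ∀ g ∈ A, (Set.range f ∩ Set.range g).Nonempty →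
    IsWTConvex P T (f ⁻¹' Set.range g) ∧
      ∃ w ∈ affineWeyl P T, Set.EqOn f (g ∘ w) (f ⁻¹' Set.range g)
  a3 : ∀ x y : X, ∃ f ∈ A, x ∈ Set.range f ∧ y ∈ Set.range f
  a4 : ∀ S₁ S₂ : Set X, IsWeylChamber P B A S₁ → IsWeylChamber P B A S₂ →
    ∃ S₁' S₂' : Set X, IsWeylChamber P B A S₁' ∧ IsWeylChamber P B A S₂' ∧
      S₁' ⊆ S₁ ∧ S₂' ⊆ S₂ ∧ ∃ f ∈ A, S₁' ∪ S₂' ⊆ Set.range f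
  a5 : ∀ f ∈ A, ∀ x ∈ Set.range f, ∃ r : X → X,
    (∀ y, r y ∈ Set.range f) ∧ (∀ y ∈ Set.range f, r y = y) ∧
      (∀ y z, chartDist P B A (r y) (r z) ≤ chartDist P B A y z) ∧ r ⁻¹' {x} = {x}
  a6 : ∀ f ∈ A, ∀ g ∈ A, ∀ h ∈ A,
    IsHalfApartment P A (Set.range f ∩ Set.range g) →
    IsHalfApartment P A (Set.range g ∩ Set.range h) →
    IsHalfApartment P A (Set.range f ∩ Set.range h) →
    (Set.range f ∩ Set.range g ∩ Set.range h).Nonempty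

/-- `x` is a special vertex of `X`. -/
def IsSpecialVertex (P : RootPairing ι F M N) (T : AddSubgroup (ModelSpace F M Λ))
    (A : Set (ModelSpace F M Λ → X)) (x : X) : Prop :=
  ∃ f ∈ A, ∃ v, IsSpecialPoint P T v ∧ f v = x

/-- `X` is thick with respect to the affine Weyl group of translation part `T`: at each special
hyperplane two apartments branch, and no two apartments branch at a non-special one. -/
structure IsThick (P : RootPairing ι F M N) (T : AddSubgroup (ModelSpace F M Λ))
    (A : Set (ModelSpace F M Λ → X)) : Prop where
  branch : ∀ k ∈ A, ∀ H, IsSpecialHyperplane P T H →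
    ∃ f ∈ A, ∃ g ∈ A, k '' H ⊆ Set.range f ∧ k '' H ⊆ Set.range g ∧
      ∃ i c, f '' hyperplane P i c = k '' H ∧
        Set.range f ∩ Set.range g = f '' halfApartment P i c
  not_branch : ∀ f ∈ A, ∀ g ∈ A, ∀ i c,
    Set.range f ∩ Set.range g = f '' halfApartment P i c →
      IsSpecialHyperplane P T (hyperplane P i c)

/-! ## Germs of Weyl simplices and the residue at a point -/

/-- `S` is a Weyl simplex of `X` based at `x`. The point itself (`J = B`) and the Weyl chambers
based at `x` (`J = ∅`) are included. -/
def IsWeylSimplexAt (P : RootPairing ι F M N) (B : Set ι) (A : Set (ModelSpace F M Λ → X))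
    (x : X) (S : Set X) : Prop :=
  ∃ f ∈ A, ∃ g ∈ affineWeyl P ⊤, ∃ J ⊆ B, f (g 0) = x ∧ S = f '' (g '' fundFace P B J)

/-- `S₁` and `S₂` are Weyl simplices based at `x`, contained in a common apartment, and `S₁` is a
face of `S₂`. -/
def IsFaceAt (P : RootPairing ι F M N) (B : Set ι) (A : Set (ModelSpace F M Λ → X))
    (x : X) (S₁ S₂ : Set X) : Prop :=
  ∃ f ∈ A, ∃ g ∈ affineWeyl P ⊤, ∃ J₁ ⊆ B, ∃ J₂ ⊆ J₁, f (g 0) = x ∧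
    S₁ = f '' (g '' fundFace P B J₁) ∧ S₂ = f '' (g '' fundFace P B J₂)

/-- The ball of radius `ε` around `x`. -/
def ball (P : RootPairing ι F M N) (B : Set ι) (A : Set (ModelSpace F M Λ → X))
    (x : X) (ε : Λ) : Set X :=
  {y | chartDist P B A x y < ε}

/-- The sets `S` and `S'` share the same germ at `x`: `S ∩ S'` is a neighbourhood of `x` in `S`
and in `S'`. -/
def SameGerm (P : RootPairing ι F M N) (B : Set ι) (A : Set (ModelSpace F M Λ → X))
    (x : X) (S S' : Set X) : Prop :=
  ∃ ε : Λ, 0 < ε ∧ S ∩ ball P B A x ε ⊆ S ∩ S' ∧ S' ∩ ball P B A x ε ⊆ S ∩ S'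

/-- The germ of `S` at `x`: its class under `SameGerm`. The class is taken among all subsets of
`X`, not only among Weyl simplices at `x`; two Weyl simplices based at `x` have the same germ in
this sense if and only if they share the same germ, and germs with respect to different atlases
can be compared directly. -/
def germ (P : RootPairing ι F M N) (B : Set ι) (A : Set (ModelSpace F M Λ → X))
    (x : X) (S : Set X) : Set (Set X) :=
  {S' | SameGerm P B A x S S'}

/-- The set `Δ_x X` of germs at `x` of the Weyl simplices based at `x`. -/
def residue (P : RootPairing ι F M N) (B : Set ι) (A : Set (ModelSpace F M Λ → X))
    (x : X) : Set (Set (Set X)) :=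
  {μ | ∃ S, IsWeylSimplexAt P B A x S ∧ μ = germ P B A x S}

/-- Inclusion of germs: there are `x`-based Weyl simplices representing the germs, in a common
apartment, the first one being a face of the second one. -/
def germLE (P : RootPairing ι F M N) (B : Set ι) (A : Set (ModelSpace F M Λ → X))
    (x : X) (μ ν : Set (Set X)) : Prop :=
  ∃ S₁ S₂, IsFaceAt P B A x S₁ S₂ ∧ germ P B A x S₁ = μ ∧ germ P B A x S₂ = ν

/-- The apartments of `Δ_x X`: for each chart `f` whose image contains `x`, the set of germs of
the Weyl simplices based at `x` that are contained in the image of `f`. -/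
def residueApartments (P : RootPairing ι F M N) (B : Set ι) (A : Set (ModelSpace F M Λ → X))
    (x : X) : Set (Set (residue P B A x)) :=
  {E | ∃ f ∈ A, x ∈ Set.range f ∧
    E = {μ | ∃ S, IsWeylSimplexAt P B A x S ∧ S ⊆ Set.range f ∧ (μ : Set (Set X)) =
      germ P B A x S}}

/-- Sharing the same germ is an equivalence relation. -/
theorem sameGerm_equivalence [Nontrivial Λ] [IsOrderedAddMonoid Λ] (P : RootPairing ι F M N)
    (B : Set ι) (A : Set (ModelSpace F M Λ → X)) (x : X) :
    Equivalence (SameGerm P B A x) where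
  refl S := by
    obtain ⟨ε, hε⟩ := exists_zero_lt (α := Λ)
    exact ⟨ε, hε, fun y hy => ⟨hy.1, hy.1⟩, fun y hy => ⟨hy.1, hy.1⟩⟩
  symm := by
    rintro S S' ⟨ε, hε, h1, h2⟩
    exact ⟨ε, hε, fun y hy => (h2 hy).symm, fun y hy => (h1 hy).symm⟩
  trans := by
    rintro S S' S'' ⟨ε, hε, h1, h2⟩ ⟨δ, hδ, h3, h4⟩
    refine ⟨min ε δ, lt_min hε hδ, fun y hy => ⟨hy.1, ?_⟩, fun y hy => ⟨?_, hy.1⟩⟩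
    · have hy' : y ∈ S' := (h1 ⟨hy.1, lt_of_lt_of_le hy.2 (min_le_left _ _)⟩).2
      exact (h3 ⟨hy', lt_of_lt_of_le hy.2 (min_le_right _ _)⟩).2
    · have hy' : y ∈ S' := (h4 ⟨hy.1, lt_of_lt_of_le hy.2 (min_le_right _ _)⟩).1
      exact (h2 ⟨hy', lt_of_lt_of_le hy.2 (min_le_left _ _)⟩).1

end Building

end GenAffine

end

/-! Everything rests on one fact: two germs of Weyl simplices at `x` lie in a common apartment.
Granting it, a germ in a chart is encoded by a pair (w, J), inclusion of germs is the same as local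
inclusion of representatives (`germLE_iff`), and `simplexAt_subset` shows that this inclusion is the
order of the cosets of standard parabolic subgroups, because the stabilizer of a point of the
fundamental chamber is generated by the simple reflections fixing it (`IsBasis.act_eq_of_mem`).
Simpliciality, the Coxeter complexes and the isomorphisms between apartments follow from this and
from the changes of charts in (A2).

The common apartment is found by going to infinity. Charts modulo sharing a subsector are the
chambers at infinity; (A4) gives any two of them a Weyl-group-valued distance. (A5) gives the
triangle inequality in `X`. Adjacent chambers at infinity have panels at bounded distance, and a
vector of a Weyl orbit is determined by its distances to the points of the fundamental chamber, so
the Weyl distance changes by at most a simple reflection across a panel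
(`IsBasis.eq_or_eq_mul_of_nrm_le`, `isWeylDist`). From this alone, distances grow along reduced
galleries (`IsWeylDist.mul_of_lt`). Given a chamber at infinity on a panel of an apartment but
outside that apartment, there are two further apartments through it, containing complementary halves
of the given one at infinity. The three meet pairwise in half-apartments, and the common point from
(A6) forces the two halves to cover the apartment (`exists_exchange`). Induction on the Weyl
distance covers any apartment by finitely many apartments through a prescribed chamber at infinity
(`exists_finite_cover`). A regular point close enough to `x` lies in a member of the cover that also
contains `x`, and convexity then supplies a full sector on one side and a germ on the other
(`exists_common_germ`).

For thickness, the wall through a panel at a special vertex is special, so two apartments branch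
along it; the chambers of the second on the panel cannot all belong to the first
(`not_mem_of_inter_eq`).

For independence of the atlas, the finite covers also show that apartments contain all metric
segments between their points (`mem_range_of_dist_add`). Hence an apartment of one atlas shares a
box at `x` with an apartment of the other. The metric determines the coordinatewise order on a box,
and the order determines its faces (`IsBoxIso.exists_face`), so the germs agree up to relabelling
the types of faces. Linearity of the coordinate change between the two atlases is never needed. -/

set_option linter.unusedSectionVars false
noncomputable section

namespace GenAffine

open scoped Classical

/-! ## Word length in a group -/

section WordLength

variable {W κ : Type*} [Group W] {s : κ → W}

/-- The word length of `w` with respect to the family `s`. -/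
def wlen (s : κ → W) (w : W) : ℕ :=
  sInf {n | ∃ l : List κ, l.length = n ∧ (l.map s).prod = w}

theorem wlen_prod_le (l : List κ) : wlen s (l.map s).prod ≤ l.length :=
  Nat.sInf_le ⟨l, rfl, rfl⟩

theorem exists_word (hs : ∀ w, ∃ l : List κ, (l.map s).prod = w) (w : W) :
    ∃ l : List κ, l.length = wlen s w ∧ (l.map s).prod = w := by
  obtain ⟨l, hl⟩ := hs w
  exact Nat.sInf_mem (s := {n | ∃ l : List κ, l.length = n ∧ (l.map s).prod = w})
    ⟨l.length, l, rfl, hl⟩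

theorem exists_wlen_mul_lt (hs : ∀ w, ∃ l : List κ, (l.map s).prod = w)
    (h2 : ∀ k, s k * s k = 1) {w : W} (h : w ≠ 1) : ∃ k, wlen s (w * s k) < wlen s w := by
  obtain ⟨l, hl, hw⟩ := exists_word hs w
  rcases List.eq_nil_or_concat l with rfl | ⟨l', k, rfl⟩
  · simp at hw; exact absurd hw.symm h
  · refine ⟨k, ?_⟩
    have : w * s k = (l'.map s).prod := by
      rw [← hw]; simp [mul_assoc, h2]
    rw [this, ← hl]
    have := wlen_prod_le (s := s) l'
    simp; omega

end WordLength

/-! ## Root systems with a basis -/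

section RootSystem

variable {F : Subfield ℝ} {ι M N : Type*} [Fintype ι] [AddCommGroup M] [Module F M]
  [AddCommGroup N] [Module F N] {P : RootPairing ι F M N} [P.IsRootSystem] {B : Set ι}

theorem root_mem_span_of_mem_hull {m : M} (h : m ∈ PointedCone.hull F (P.root '' B)) :
    m ∈ Submodule.span F (P.root '' B) := by
  induction h using Submodule.span_induction with
  | mem x hx => exact Submodule.subset_span hx
  | zero => exact zero_mem _
  | add x y _ _ h1 h2 => exact add_mem h1 h2
  | smul a x _ h => exact Submodule.smul_mem _ (a : F) h

theorem IsBasis.top_le_span (hB : IsBasis P B) :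
    ⊤ ≤ Submodule.span F (Set.range fun b : B => P.root b) := by
  rw [← RootPairing.IsRootSystem.span_root_eq_top (P := P), Submodule.span_le]
  rintro _ ⟨i, rfl⟩
  have e : (Set.range fun b : B => P.root b) = P.root '' B := by
    ext; simp
  rw [e]
  rcases hB.pos_or_neg i with h | h
  · exact root_mem_span_of_mem_hull h
  · have := neg_mem (root_mem_span_of_mem_hull h)
    rwa [neg_neg] at this

/-- The simple roots as a basis of the space they span. -/
def IsBasis.basis (hB : IsBasis P B) : Module.Basis B F M :=
  Module.Basis.mk (v := fun b : B => P.root b) hB.linearIndepOn hB.top_le_span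

theorem IsBasis.basis_apply (hB : IsBasis P B) (b : B) : hB.basis b = P.root b :=
  Module.Basis.mk_apply (v := fun b : B => P.root b) hB.linearIndepOn hB.top_le_span b

/-- The coefficients of a root with respect to the simple roots. -/
def IsBasis.coef (hB : IsBasis P B) (i : ι) (b : B) : F := hB.basis.repr (P.root i) b

theorem IsBasis.sum_coef (hB : IsBasis P B) (i : ι) :
    ∑ b, hB.coef i b • P.root b = P.root i := by
  rw [← hB.basis.sum_repr (P.root i)]
  simp [IsBasis.coef, hB.basis_apply]

theorem IsBasis.coef_self (hB : IsBasis P B) (b b' : B) :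
    hB.coef b b' = if b = b' then 1 else 0 := by
  rw [IsBasis.coef, ← hB.basis_apply, Module.Basis.repr_self, Finsupp.single_apply]

theorem IsBasis.mem_hull_iff (hB : IsBasis P B) (m : M) :
    m ∈ PointedCone.hull F (P.root '' B) ↔ ∀ b, 0 ≤ hB.basis.repr m b := by
  constructor
  · intro h
    induction h using Submodule.span_induction with
    | mem x hx =>
      obtain ⟨i, hi, rfl⟩ := hx
      intro b
      rw [← hB.basis_apply ⟨i, hi⟩, Module.Basis.repr_self, Finsupp.single_apply]
      split_ifs <;> simp
    | zero => simp
    | add x y _ _ h1 h2 => intro b; simpa using add_nonneg (h1 b) (h2 b)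
    | smul a x _ h =>
      intro b
      have : a • x = (a : F) • x := rfl
      rw [this, map_smul]
      exact mul_nonneg a.2 (h b)
  · intro h
    rw [← hB.basis.sum_repr m]
    refine Submodule.sum_mem _ fun b _ => ?_
    have : hB.basis.repr m b • hB.basis b =
      (⟨hB.basis.repr m b, h b⟩ : {c : F // 0 ≤ c}) • hB.basis b := rfl
    rw [this]
    exact Submodule.smul_mem _ _ (Submodule.subset_span ⟨b, b.2, (hB.basis_apply b).symm⟩)

theorem IsBasis.isPos_iff (hB : IsBasis P B) (i : ι) : IsPos P B i ↔ ∀ b, 0 ≤ hB.coef i b :=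
  hB.mem_hull_iff _

theorem IsBasis.pos_or_neg' (hB : IsBasis P B) (i : ι) :
    (∀ b, 0 ≤ hB.coef i b) ∨ ∀ b, hB.coef i b ≤ 0 := by
  rcases hB.pos_or_neg i with h | h
  · exact Or.inl ((hB.isPos_iff i).1 h)
  · refine Or.inr fun b => ?_
    have := (hB.mem_hull_iff _).1 h b
    simpa [IsBasis.coef] using this

theorem IsBasis.exists_coef_ne_zero (hB : IsBasis P B) (i : ι) : ∃ b, hB.coef i b ≠ 0 := by
  by_contra! h
  have := hB.sum_coef i
  simp [h] at this
  exact P.ne_zero i this.symm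

theorem IsBasis.isPos_of_coef_pos (hB : IsBasis P B) {i : ι} {b : B} (h : 0 < hB.coef i b) :
    IsPos P B i := by
  rcases hB.pos_or_neg' i with h' | h'
  · exact (hB.isPos_iff i).2 h'
  · exact absurd (h' b) (not_le.2 h)

theorem IsBasis.isPos_simple (hB : IsBasis P B) (b : B) : IsPos P B b :=
  hB.isPos_of_coef_pos (b := b) (by simp [hB.coef_self])

/-- The index of the negative of a root. -/
def nidx (P : RootPairing ι F M N) (i : ι) : ι := P.reflectionPerm i i

theorem root_nidx (i : ι) : P.root (nidx P i) = -P.root i := by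
  simp [nidx]

theorem coroot'_nidx (i : ι) (m : M) : P.coroot' (nidx P i) m = -P.coroot' i m := by
  rw [nidx, ← P.coroot'_reflection, P.reflection_apply, map_sub, map_smul]
  simp; ring

theorem nidx_nidx (i : ι) : nidx P (nidx P i) = i := by
  apply P.root.injective; simp [root_nidx]

theorem IsBasis.coef_nidx (hB : IsBasis P B) (i : ι) (b : B) :
    hB.coef (nidx P i) b = -hB.coef i b := by
  simp [IsBasis.coef, root_nidx]

theorem IsBasis.isPos_nidx_iff (hB : IsBasis P B) (i : ι) :
    IsPos P B (nidx P i) ↔ ¬IsPos P B i := by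
  constructor
  · intro h h'
    obtain ⟨b, hb⟩ := hB.exists_coef_ne_zero i
    have h1 := (hB.isPos_iff _).1 h b
    have h2 := (hB.isPos_iff _).1 h' b
    rw [hB.coef_nidx] at h1
    exact hb (le_antisymm (by linarith) h2)
  · intro h
    rw [hB.isPos_iff] at h ⊢
    intro b
    rw [hB.coef_nidx]
    have := (hB.pos_or_neg' i).resolve_left h b
    linarith

theorem rootForm_root_pos (i : ι) : 0 < P.RootForm (P.root i) (P.root i) :=
  P.rootForm_pos_of_ne_zero (Submodule.subset_span ⟨i, rfl⟩) (P.ne_zero i)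

/-- The canonical form identifies each coroot with a positive multiple of its root. Signs of
coefficients therefore pass from roots to coroots, although no integrality is available. -/
theorem coroot'_eq_rootForm (i : ι) (m : M) :
    P.coroot' i m = 2 / P.RootForm (P.root i) (P.root i) * P.RootForm (P.root i) m := by
  have h := P.rootForm_self_smul_coroot i
  have h1 := congrArg (P.toLinearMap m) h
  rw [map_smul, map_nsmul, P.toLinearMap_apply_apply_Polarization] at h1
  have h2 := (rootForm_root_pos (P := P) i).ne'
  have h3 : P.toLinearMap m (P.coroot i) = P.coroot' i m := rfl
  rw [h3] at h1
  field_simp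
  simpa [mul_comm] using h1

/-- The coefficients of a coroot with respect to the simple coroots. -/
def IsBasis.kcoef (hB : IsBasis P B) (i : ι) (b : B) : F :=
  hB.coef i b * (P.RootForm (P.root b) (P.root b) / P.RootForm (P.root i) (P.root i))

theorem IsBasis.coroot'_eq_sum (hB : IsBasis P B) (i : ι) (m : M) :
    P.coroot' i m = ∑ b, hB.kcoef i b * P.coroot' b m := by
  have h0 : P.RootForm (P.root i) m = ∑ b, hB.coef i b * P.RootForm (P.root b) m := by
    conv_lhs => rw [← hB.sum_coef i]
    rw [map_sum, LinearMap.sum_apply]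
    exact Finset.sum_congr rfl fun b _ => by rw [map_smul]; rfl
  rw [coroot'_eq_rootForm, h0, Finset.mul_sum]
  refine Finset.sum_congr rfl fun b _ => ?_
  rw [IsBasis.kcoef, coroot'_eq_rootForm (b : ι)]
  have h1 := (rootForm_root_pos (P := P) i).ne'
  have h2 := (rootForm_root_pos (P := P) b).ne'
  field_simp

theorem IsBasis.kcoef_nonneg (hB : IsBasis P B) {i : ι} (h : IsPos P B i) (b : B) :
    0 ≤ hB.kcoef i b :=
  mul_nonneg ((hB.isPos_iff i).1 h b)
    (div_nonneg (rootForm_root_pos _).le (rootForm_root_pos _).le)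

theorem IsBasis.kcoef_pos (hB : IsBasis P B) {i : ι} {b : B} (h : 0 < hB.coef i b) :
    0 < hB.kcoef i b :=
  mul_pos h (div_pos (rootForm_root_pos _) (rootForm_root_pos _))

/-- The root `i` is a multiple of the simple root `b`. -/
def IsBasis.Mult (hB : IsBasis P B) (b : B) (i : ι) : Prop := ∀ b', b' ≠ b → hB.coef i b' = 0

theorem IsBasis.Mult.root_eq {hB : IsBasis P B} {b : B} {i : ι} (h : hB.Mult b i) :
    P.root i = hB.coef i b • P.root b := by
  rw [← hB.sum_coef i]
  refine (Finset.sum_eq_single b (fun b' _ hb => ?_) (by simp)).trans ?_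
  · rw [h b' hb, zero_smul]
  · rfl

theorem IsBasis.Mult.coef_ne_zero {hB : IsBasis P B} {b : B} {i : ι} (h : hB.Mult b i) :
    hB.coef i b ≠ 0 := by
  intro h0
  have := h.root_eq
  rw [h0, zero_smul] at this
  exact P.ne_zero i this

theorem IsBasis.Mult.coroot'_eq {hB : IsBasis P B} {b : B} {i : ι} (h : hB.Mult b i) (m : M) :
    P.coroot' i m = hB.kcoef i b * P.coroot' b m := by
  rw [hB.coroot'_eq_sum]
  refine Finset.sum_eq_single b (fun b' _ hb => ?_) (by simp)
  rw [IsBasis.kcoef, h b' hb]; simp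

/-- The system need not be reduced, so several positive roots may be proportional to one simple
root. The condition that a root pairs to 2 with its own coroot makes the two scaling factors cancel.
-/
theorem IsBasis.Mult.reflection_eq {hB : IsBasis P B} {b : B} {i : ι} (h : hB.Mult b i) :
    P.reflection i = P.reflection b := by
  ext m
  rw [P.reflection_apply, P.reflection_apply, h.coroot'_eq]
  have h2 : P.coroot' i (P.root i) = 2 := P.root_coroot_two i
  rw [h.coroot'_eq, h.root_eq, map_smul, P.root_coroot'_eq_pairing, P.pairing_same,
    smul_eq_mul] at h2
  rw [h.root_eq, smul_smul]
  have : hB.kcoef i b * P.coroot' b m * hB.coef i b = P.coroot' b m := by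
    linear_combination (P.coroot' b m / 2) * h2
  rw [this]

theorem IsBasis.mult_self (hB : IsBasis P B) (b : B) : hB.Mult b b := fun b' h => by
  rw [hB.coef_self, if_neg h.symm]

theorem IsBasis.coef_reflectionPerm (hB : IsBasis P B) {b b' : B} (h : b' ≠ b) (i : ι) :
    hB.coef (P.reflectionPerm b i) b' = hB.coef i b' := by
  simp [IsBasis.coef, P.reflection_apply, ← hB.basis_apply b, h.symm]

/-- Reflecting in `b` alters only the `b`-coefficient; another positive coefficient survives and
fixes the sign of the whole root. -/
theorem IsBasis.isPos_reflectionPerm (hB : IsBasis P B) {b : B} {i : ι} (h : IsPos P B i)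
    (hm : ¬hB.Mult b i) : IsPos P B (P.reflectionPerm b i) := by
  obtain ⟨b', hb, hc⟩ : ∃ b', b' ≠ b ∧ hB.coef i b' ≠ 0 := by
    simpa [IsBasis.Mult] using hm
  apply hB.isPos_of_coef_pos (b := b')
  rw [hB.coef_reflectionPerm hb]
  exact lt_of_le_of_ne ((hB.isPos_iff i).1 h b') hc.symm

theorem IsBasis.mult_reflectionPerm_iff (hB : IsBasis P B) {b : B} {i : ι} :
    hB.Mult b (P.reflectionPerm b i) ↔ hB.Mult b i :=
  forall₂_congr fun _ h => by rw [hB.coef_reflectionPerm h]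

theorem IsBasis.Mult.reflectionPerm_eq {hB : IsBasis P B} {b : B} {i : ι} (h : hB.Mult b i) :
    P.reflectionPerm b i = nidx P i := by
  apply P.root.injective
  rw [P.root_reflectionPerm, root_nidx, ← h.reflection_eq, P.reflection_apply_self]

/-! ### The Weyl group -/

theorem exists_perm_of_mem_weylGroup {w : M ≃ₗ[F] M} (hw : w ∈ weylGroup P) :
    ∃ σ : Equiv.Perm ι, ∀ i, w (P.root i) = P.root (σ i) ∧
      ∀ m, P.coroot' (σ i) (w m) = P.coroot' i m := by
  induction hw using Subgroup.closure_induction with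
  | mem x hx =>
    obtain ⟨j, rfl⟩ := hx
    exact ⟨P.reflectionPerm j, fun i => ⟨(P.root_reflectionPerm j i).symm, fun m => by
      rw [P.coroot'_reflection, P.reflectionPerm_self]⟩⟩
  | one => exact ⟨1, fun i => ⟨rfl, fun m => rfl⟩⟩
  | mul x y _ _ hx hy =>
    obtain ⟨σ, hσ⟩ := hx
    obtain ⟨τ, hτ⟩ := hy
    exact ⟨σ * τ, fun i => ⟨by simp [(hτ i).1, (hσ _).1], fun m => by
      simp [(hτ i).2, (hσ _).2]⟩⟩
  | inv x _ hx =>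
    obtain ⟨σ, hσ⟩ := hx
    refine ⟨σ⁻¹, fun i => ⟨?_, fun m => ?_⟩⟩
    · apply x.injective
      rw [(hσ _).1]
      simp [LinearEquiv.coe_inv]
    · rw [← (hσ _).2]
      simp [LinearEquiv.coe_inv]

/-- The permutation of the roots induced by an element of the Weyl group. -/
def wperm (w : weylGroup P) : Equiv.Perm ι := (exists_perm_of_mem_weylGroup w.2).choose

theorem root_wperm (w : weylGroup P) (i : ι) : P.root (wperm w i) = w.1 (P.root i) :=
  ((exists_perm_of_mem_weylGroup w.2).choose_spec i).1.symm

theorem coroot'_wperm (w : weylGroup P) (i : ι) (m : M) :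
    P.coroot' (wperm w i) (w.1 m) = P.coroot' i m :=
  ((exists_perm_of_mem_weylGroup w.2).choose_spec i).2 m

theorem wperm_mul (w w' : weylGroup P) (i : ι) : wperm (w * w') i = wperm w (wperm w' i) :=
  P.root.injective (by simp [root_wperm])

theorem wperm_one (i : ι) : wperm (1 : weylGroup P) i = i :=
  P.root.injective (by simp [root_wperm])

theorem wperm_inv_apply (w : weylGroup P) (i : ι) : wperm w⁻¹ (wperm w i) = i := by
  rw [← wperm_mul, inv_mul_cancel, wperm_one]

theorem wperm_apply_inv (w : weylGroup P) (i : ι) : wperm w (wperm w⁻¹ i) = i := by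
  rw [← wperm_mul, mul_inv_cancel, wperm_one]

theorem wperm_nidx (w : weylGroup P) (i : ι) : wperm w (nidx P i) = nidx P (wperm w i) :=
  P.root.injective (by simp [root_wperm, root_nidx])

theorem wperm_injective : Function.Injective (wperm : weylGroup P → Equiv.Perm ι) := by
  intro w w' h
  apply Subtype.ext
  apply LinearEquiv.toLinearMap_injective
  apply LinearMap.ext_on_range (v := P.root) RootPairing.IsRootSystem.span_root_eq_top
  intro i
  have := congrArg P.root (DFunLike.congr_fun h i)
  simpa [root_wperm] using this

theorem finite_weylGroup : Finite (weylGroup P) := Finite.of_injective _ wperm_injective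

/-- The reflection of the root `i` as an element of the Weyl group. -/
def sref (P : RootPairing ι F M N) (i : ι) : weylGroup P :=
  ⟨P.reflection i, Subgroup.subset_closure ⟨i, rfl⟩⟩

theorem wperm_sref (i j : ι) : wperm (sref P i) j = P.reflectionPerm i j :=
  P.root.injective (by simp [root_wperm, sref])

theorem sref_mul_self (i : ι) : sref P i * sref P i = 1 := by
  apply Subtype.ext
  ext m
  simp [sref]

theorem sref_inv (i : ι) : (sref P i)⁻¹ = sref P i :=
  inv_eq_of_mul_eq_one_left (sref_mul_self i)

theorem conj_sref (w : weylGroup P) (i : ι) : w * sref P i * w⁻¹ = sref P (wperm w i) := by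
  apply Subtype.ext
  ext m
  have h : P.coroot' i (w.1⁻¹ m) = P.coroot' (wperm w i) m := by
    rw [← coroot'_wperm w]; simp
  have h1 : (w * sref P i * w⁻¹).1 m = w.1 (P.reflection i (w.1⁻¹ m)) := rfl
  have h2 : w.1 (w.1⁻¹ m) = m := by simp
  rw [h1, P.reflection_apply, map_sub, map_smul, h, h2, sref, P.reflection_apply, root_wperm]

theorem IsBasis.Mult.sref_eq {hB : IsBasis P B} {b : B} {i : ι} (h : hB.Mult b i) :
    sref P i = sref P b := Subtype.ext h.reflection_eq

theorem simpleReflection_eq (b : B) : simpleReflection P B b = sref P b := rfl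

theorem wperm_simpleReflection (b : B) (j : ι) :
    wperm (simpleReflection P B b) j = P.reflectionPerm b j := wperm_sref _ _

theorem simpleReflection_mul_self (b : B) :
    simpleReflection P B b * simpleReflection P B b = 1 := sref_mul_self _

theorem simpleReflection_inv (b : B) : (simpleReflection P B b)⁻¹ = simpleReflection P B b :=
  sref_inv _

/-- The height of a root. -/
def IsBasis.height (hB : IsBasis P B) (i : ι) : F := ∑ b, hB.coef i b

theorem IsBasis.exists_coroot'_pos (hB : IsBasis P B) {i : ι} (h : IsPos P B i) :
    ∃ b : B, 0 < P.coroot' b (P.root i) := by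
  by_contra! hc
  have h1 : P.coroot' i (P.root i) = 2 := P.root_coroot_two i
  rw [hB.coroot'_eq_sum] at h1
  have : ∑ b, hB.kcoef i b * P.coroot' b (P.root i) ≤ 0 :=
    Finset.sum_nonpos fun b _ => mul_nonpos_of_nonneg_of_nonpos (hB.kcoef_nonneg h b) (hc b)
  rw [h1] at this
  norm_num at this

theorem IsBasis.height_reflectionPerm (hB : IsBasis P B) (i : ι) (b : B) :
    hB.height (P.reflectionPerm b i) = hB.height i - P.coroot' b (P.root i) := by
  have : ∀ b' : B, hB.coef (P.reflectionPerm b i) b' =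
      hB.coef i b' - P.coroot' b (P.root i) * if b = b' then 1 else 0 := by
    intro b'
    rw [← hB.coef_self]
    simp [IsBasis.coef, P.reflection_apply]
  simp [IsBasis.height, this, Finset.sum_sub_distrib]

/-- In the orbit of a positive root under the group generated by simple reflections, take a positive
root of least height. Some simple coroot is positive on it, and reflecting there would lower the
height, so it is a multiple of that simple root. Conjugating back gives the claim. -/
theorem IsBasis.sref_mem_closure (hB : IsBasis P B) (i : ι) :
    sref P i ∈ Subgroup.closure (Set.range (simpleReflection P B)) := by
  set G := Subgroup.closure (Set.range (simpleReflection P B)) with hG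
  have hsim : ∀ b : B, sref P b ∈ G := fun b => Subgroup.subset_closure ⟨b, rfl⟩
  have hpos : ∀ i, IsPos P B i → sref P i ∈ G := by
    intro i hi
    obtain ⟨j, ⟨⟨w, hw, rfl⟩, hj⟩, hmin⟩ := Set.exists_min_image
      {j | (∃ w ∈ G, j = wperm w i) ∧ IsPos P B j} hB.height (Set.toFinite _)
      ⟨i, ⟨1, one_mem _, (wperm_one i).symm⟩, hi⟩
    obtain ⟨b, hb⟩ := hB.exists_coroot'_pos hj
    have hm : hB.Mult b (wperm w i) := by
      by_contra hm
      have h1 := hB.isPos_reflectionPerm hj hm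
      have h2 := hmin (P.reflectionPerm b (wperm w i))
        ⟨⟨sref P b * w, mul_mem (hsim b) hw, by rw [wperm_mul, wperm_sref]⟩, h1⟩
      rw [hB.height_reflectionPerm] at h2
      linarith
    have h3 := hm.sref_eq
    rw [← conj_sref] at h3
    have : sref P i = w⁻¹ * sref P b * w := by rw [← h3]; group
    rw [this]
    exact mul_mem (mul_mem (inv_mem hw) (hsim b)) hw
  by_cases h : IsPos P B i
  · exact hpos i h
  · have h1 := hpos _ ((hB.isPos_nidx_iff i).2 h)
    have : sref P (nidx P i) = sref P i := by
      apply Subtype.ext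
      ext m
      simp only [sref]
      rw [P.reflection_apply, P.reflection_apply, root_nidx, coroot'_nidx, neg_smul_neg]
    rwa [this] at h1

theorem IsBasis.closure_simpleReflection (hB : IsBasis P B) :
    Subgroup.closure (Set.range (simpleReflection P B)) = ⊤ := by
  have h : ∀ w (hw : w ∈ weylGroup P), (⟨w, hw⟩ : weylGroup P) ∈
      Subgroup.closure (Set.range (simpleReflection P B)) := by
    intro w hw
    induction hw using Subgroup.closure_induction with
    | mem x hx => obtain ⟨i, rfl⟩ := hx; exact hB.sref_mem_closure i
    | one => exact one_mem _
    | mul x y hx hy h1 h2 => exact mul_mem h1 h2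
    | inv x hx h1 => exact inv_mem h1
  rw [eq_top_iff]
  rintro ⟨w, hw⟩ -
  exact h w hw

theorem exists_list_of_mem_closure {J : Set B} {w : weylGroup P}
    (hw : w ∈ Subgroup.closure (simpleReflection P B '' J)) :
    ∃ l : List B, (∀ b ∈ l, b ∈ J) ∧ (l.map (simpleReflection P B)).prod = w := by
  induction hw using Subgroup.closure_induction with
  | mem x hx => obtain ⟨b, hb, rfl⟩ := hx; exact ⟨[b], by simpa using hb, by simp⟩
  | one => exact ⟨[], by simp, by simp⟩
  | mul x y _ _ h1 h2 =>
    obtain ⟨l1, h1, rfl⟩ := h1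
    obtain ⟨l2, h2, rfl⟩ := h2
    refine ⟨l1 ++ l2, fun b hb => ?_, by simp⟩
    rcases List.mem_append.1 hb with h | h
    exacts [h1 b h, h2 b h]
  | inv x _ h1 =>
    obtain ⟨l1, h1, rfl⟩ := h1
    refine ⟨l1.reverse, by simpa using h1, ?_⟩
    rw [List.prod_inv_reverse]
    congr 1
    simp [List.map_reverse, Function.comp_def, simpleReflection_inv]

theorem IsBasis.exists_list (hB : IsBasis P B) (w : weylGroup P) :
    ∃ l : List B, (l.map (simpleReflection P B)).prod = w := by
  have : w ∈ Subgroup.closure (simpleReflection P B '' Set.univ) := by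
    rw [Set.image_univ, hB.closure_simpleReflection]; trivial
  obtain ⟨l, -, h⟩ := exists_list_of_mem_closure this
  exact ⟨l, h⟩

/-- Apply the letters of the word to the simple root `b` from the right. At the letter where the
root turns negative it is a multiple of that letter's simple root, and conjugation lets the letter
be deleted against the reflection in `b`. -/
theorem IsBasis.exchange (hB : IsBasis P B) (b : B) (l : List B)
    (h : ¬IsPos P B (wperm (l.map (simpleReflection P B)).prod b)) :
    ∃ l' : List B, l'.length + 1 = l.length ∧
      (l'.map (simpleReflection P B)).prod =
        (l.map (simpleReflection P B)).prod * simpleReflection P B b := by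
  induction l with
  | nil => exact absurd (hB.isPos_simple b) (by simpa [wperm_one] using h)
  | cons a l ih =>
    by_cases hp : IsPos P B (wperm (l.map (simpleReflection P B)).prod b)
    · refine ⟨l, by simp, ?_⟩
      rw [List.map_cons, List.prod_cons, wperm_mul, wperm_simpleReflection] at h
      have hm : hB.Mult a (wperm (l.map (simpleReflection P B)).prod b) := by
        by_contra hm
        exact h (hB.isPos_reflectionPerm hp hm)
      have h3 := hm.sref_eq
      rw [← conj_sref] at h3
      rw [List.map_cons, List.prod_cons, simpleReflection_eq, simpleReflection_eq b, ← h3]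
      simp [mul_assoc, sref_mul_self]
    · obtain ⟨l', h1, h2⟩ := ih hp
      exact ⟨a :: l', by simpa using h1, by simp [h2, mul_assoc]⟩

theorem IsBasis.wlen_mul_lt (hB : IsBasis P B) {w : weylGroup P} {b : B}
    (h : ¬IsPos P B (wperm w b)) :
    wlen (simpleReflection P B) (w * simpleReflection P B b) < wlen (simpleReflection P B) w := by
  obtain ⟨l, hl, hw⟩ := exists_word hB.exists_list w
  rw [← hw] at h
  obtain ⟨l', h1, h2⟩ := hB.exchange b l h
  rw [← hl, ← hw, ← h2]
  have := wlen_prod_le (s := simpleReflection P B) l'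
  omega

theorem IsBasis.lt_wlen_mul (hB : IsBasis P B) {w : weylGroup P} {b : B}
    (h : IsPos P B (wperm w b)) :
    wlen (simpleReflection P B) w < wlen (simpleReflection P B) (w * simpleReflection P B b) := by
  have h1 : ¬IsPos P B (wperm (w * simpleReflection P B b) b) := by
    rw [wperm_mul, wperm_simpleReflection]
    have : P.reflectionPerm b b = nidx P b := rfl
    rw [this, wperm_nidx, hB.isPos_nidx_iff]
    simpa using h
  have := hB.wlen_mul_lt h1
  rwa [mul_assoc, simpleReflection_mul_self, mul_one] at this

theorem IsBasis.not_isPos_of_wlen_lt (hB : IsBasis P B) {w : weylGroup P} {b : B}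
    (h : wlen (simpleReflection P B) (w * simpleReflection P B b) < wlen (simpleReflection P B) w) :
    ¬IsPos P B (wperm w b) := fun h' => (hB.lt_wlen_mul h').not_gt h

end RootSystem

/-! ### The longest element, and vectors dual to the simple coroots -/

section LongestElement

variable {F : Subfield ℝ} {ι M N : Type*} [Fintype ι] [AddCommGroup M] [Module F M]
  [AddCommGroup N] [Module F N] {P : RootPairing ι F M N} [P.IsRootSystem] {B : Set ι}

theorem IsBasis.coef_wperm (hB : IsBasis P B) (w : weylGroup P) (i : ι) (b : B) :
    hB.coef (wperm w i) b = ∑ b' : B, hB.coef i b' * hB.coef (wperm w b') b := by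
  have h : P.root (wperm w i) = ∑ b' : B, hB.coef i b' • P.root (wperm w b') := by
    rw [root_wperm, ← hB.sum_coef i, map_sum]
    exact Finset.sum_congr rfl fun b' _ => by rw [map_smul, root_wperm]
  rw [IsBasis.coef, h, map_sum, Finsupp.finsetSum_apply]
  exact Finset.sum_congr rfl fun b' _ => by rw [map_smul]; rfl

theorem IsBasis.isPos_wperm_of_simple (hB : IsBasis P B) {w : weylGroup P}
    (h : ∀ b : B, IsPos P B (wperm w b)) {i : ι} (hi : IsPos P B i) : IsPos P B (wperm w i) := by
  rw [hB.isPos_iff]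
  intro b
  rw [hB.coef_wperm]
  exact Finset.sum_nonneg fun b' _ =>
    mul_nonneg ((hB.isPos_iff i).1 hi b') ((hB.isPos_iff _).1 (h b') b)

/-- The longest element of the Weyl group. -/
theorem IsBasis.exists_longest (hB : IsBasis P B) :
    ∃ w : weylGroup P, ∀ i, IsPos P B (wperm w i) ↔ ¬IsPos P B i := by
  have := finite_weylGroup (P := P)
  -- An element of maximal length sends every simple root to a negative one, since otherwise
  -- multiplying by that reflection would lengthen it.
  obtain ⟨w, hw⟩ := Finite.exists_max (wlen (simpleReflection P B))
  have h1 : ∀ b : B, ¬IsPos P B (wperm w b) := fun b h =>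
    (hw (w * simpleReflection P B b)).not_gt (hB.lt_wlen_mul h)
  have h2 : ∀ i, IsPos P B i → ¬IsPos P B (wperm w i) := by
    intro i hi
    rw [← hB.isPos_nidx_iff, hB.isPos_iff]
    intro b
    rw [hB.coef_nidx, hB.coef_wperm, neg_nonneg]
    refine Finset.sum_nonpos fun b' _ =>
      mul_nonpos_of_nonneg_of_nonpos ((hB.isPos_iff i).1 hi b') ?_
    exact (hB.pos_or_neg' _).resolve_left (fun h => h1 b' ((hB.isPos_iff _).2 h)) b
  refine ⟨w, fun i => ⟨fun h h' => h2 i h' h, fun h => ?_⟩⟩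
  have := h2 _ ((hB.isPos_nidx_iff i).2 h)
  rwa [wperm_nidx, hB.isPos_nidx_iff, not_not] at this

theorem isPos_wperm_inv_iff {w : weylGroup P}
    (hw : ∀ i, IsPos P B (wperm w i) ↔ ¬IsPos P B i) (i : ι) :
    IsPos P B (wperm w⁻¹ i) ↔ ¬IsPos P B i := by
  have := hw (wperm w⁻¹ i)
  rw [wperm_apply_inv] at this
  tauto

theorem sref_nidx (i : ι) : sref P (nidx P i) = sref P i := by
  apply Subtype.ext
  ext m
  simp only [sref]
  rw [P.reflection_apply, P.reflection_apply, root_nidx, coroot'_nidx, neg_smul_neg]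

/-- Conjugation by the longest element permutes the simple reflections. -/
theorem IsBasis.exists_conj_longest (hB : IsBasis P B) {w : weylGroup P}
    (hw : ∀ i, IsPos P B (wperm w i) ↔ ¬IsPos P B i) (b : B) :
    ∃ b' : B, w⁻¹ * simpleReflection P B b * w = simpleReflection P B b' := by
  set i := nidx P (wperm w⁻¹ b) with hi
  have hipos : IsPos P B i := by
    rw [hi, hB.isPos_nidx_iff, isPos_wperm_inv_iff hw, not_not]
    exact hB.isPos_simple b
  have hconj : w⁻¹ * simpleReflection P B b * w = sref P i := by
    rw [hi, sref_nidx, ← conj_sref, inv_inv]; rfl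
  rw [hconj]
  by_contra! hne
  have hnm : ∀ b' : B, ¬hB.Mult b' i := fun b' h => hne b' h.sref_eq
  -- If `i` were a multiple of no simple root, the conjugate of the reflection in `b` would keep
  -- every simple root positive: `w` makes it negative, reflecting in `b` keeps the sign, and `w⁻¹`
  -- makes it positive again. But the reflection in `i` negates `i`.
  have key : ∀ b' : B, IsPos P B (wperm (sref P i) b') := by
    intro b'
    rw [← hconj, wperm_mul, wperm_mul, isPos_wperm_inv_iff hw, wperm_simpleReflection]
    set j := nidx P (wperm w b') with hj
    have hjpos : IsPos P B j := by
      rw [hj, hB.isPos_nidx_iff, hw, not_not]; exact hB.isPos_simple b'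
    have hjm : ¬hB.Mult b j := by
      intro hm
      apply hnm b'
      have h1 := hm.root_eq
      have h2 : P.root b' = hB.coef j b • P.root i := by
        have h3 : wperm w⁻¹ (nidx P j) = b' := by rw [hj, nidx_nidx, wperm_inv_apply]
        rw [← h3, root_wperm, root_nidx, h1, hi, root_nidx, root_wperm]
        simp
      have hc := hm.coef_ne_zero
      intro b'' hb
      have h4 : hB.coef b' b'' = hB.coef j b * hB.coef i b'' := by
        rw [IsBasis.coef, h2, map_smul]; rfl
      rw [hB.coef_self, if_neg hb.symm] at h4
      exact (mul_eq_zero.1 h4.symm).resolve_left hc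
    have h5 := hB.isPos_reflectionPerm hjpos hjm
    have h6 : P.reflectionPerm b j = nidx P (P.reflectionPerm b (wperm w b')) := by
      rw [hj, ← wperm_sref, wperm_nidx, wperm_sref]
    rw [h6, hB.isPos_nidx_iff] at h5
    exact h5
  have h7 := hB.isPos_wperm_of_simple key hipos
  rw [wperm_sref] at h7
  exact (hB.isPos_nidx_iff i).1 h7 hipos

/-! ### Dual vectors -/

/-- Simple coroots separate points, and there are as many of them as the dimension. -/
theorem IsBasis.exists_coroot'_eq (hB : IsBasis P B) (c : B → F) :
    ∃ m : M, ∀ b : B, P.coroot' b m = c b := by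
  let f : M →ₗ[F] (B → F) := LinearMap.pi fun b : B => P.coroot' b
  have hf : Function.Injective f := by
    rw [injective_iff_map_eq_zero]
    intro m hm
    rw [P.eq_zero_iff_forall_coroot'_eq_zero]
    intro i
    rw [hB.coroot'_eq_sum]
    refine Finset.sum_eq_zero fun b _ => ?_
    have : P.coroot' b m = 0 := congrFun hm b
    rw [this, mul_zero]
  have := Module.Finite.of_basis hB.basis
  have hd : Module.finrank F M = Module.finrank F (B → F) := by
    rw [Module.finrank_eq_card_basis hB.basis, Module.finrank_fintype_fun_eq_card]
  obtain ⟨m, hm⟩ := (LinearMap.injective_iff_surjective_of_finrank_eq_finrank hd).1 hf c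
  exact ⟨m, fun b => congrFun hm b⟩

/-- The vectors dual to the simple coroots. -/
def IsBasis.dualVec (hB : IsBasis P B) (b : B) : M :=
  (hB.exists_coroot'_eq (Pi.single b 1)).choose

theorem IsBasis.coroot'_dualVec (hB : IsBasis P B) (b b' : B) :
    P.coroot' b' (hB.dualVec b) = if b' = b then 1 else 0 := by
  rw [IsBasis.dualVec, (hB.exists_coroot'_eq (Pi.single b 1)).choose_spec b', Pi.single_apply]

theorem IsBasis.sum_dualVec (hB : IsBasis P B) (m : M) :
    ∑ b : B, P.coroot' b m • hB.dualVec b = m := by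
  rw [← sub_eq_zero, P.eq_zero_iff_forall_coroot'_eq_zero]
  intro i
  rw [hB.coroot'_eq_sum]
  refine Finset.sum_eq_zero fun b _ => ?_
  simp only [map_sub, map_sum, map_smul, hB.coroot'_dualVec, smul_eq_mul, mul_ite, mul_one,
    mul_zero, Finset.sum_ite_eq, Finset.mem_univ, if_true, sub_self]

end LongestElement

/-! ## Ordered vector spaces over subfields of the reals -/

section Order

variable {F : Subfield ℝ} {Λ : Type*} [AddCommGroup Λ] [LinearOrder Λ] [IsOrderedAddMonoid Λ]
  [Module F Λ] [PosSMulMono F Λ]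

theorem smul_pos_of_pos {c : F} {l : Λ} (hc : 0 < c) (hl : 0 < l) : 0 < c • l :=
  lt_of_le_of_ne (smul_nonneg hc.le hl.le) (smul_ne_zero hc.ne' hl.ne').symm

theorem smul_neg_of_neg {c : F} {l : Λ} (hc : 0 < c) (hl : l < 0) : c • l < 0 := by
  have := smul_pos_of_pos hc (neg_pos.2 hl)
  rwa [smul_neg, neg_pos] at this

theorem smul_le_smul_of_nonneg {c c' : F} {l : Λ} (h : c ≤ c') (hl : 0 ≤ l) : c • l ≤ c' • l := by
  rcases hl.eq_or_lt with rfl | hl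
  · simp
  rw [← sub_nonneg, ← sub_smul]
  exact smul_nonneg (sub_nonneg.2 h) hl.le

theorem exists_pos_lt (F : Subfield ℝ) [Module F Λ] [PosSMulMono F Λ] {l : Λ} (h : 0 < l) : ∃ m, 0 < m ∧ m < l := by
  refine ⟨(2⁻¹ : F) • l, smul_pos_of_pos (by norm_num) h, ?_⟩
  have h1 : l = (2⁻¹ : F) • l + (2⁻¹ : F) • l := by
    rw [← add_smul]; norm_num
  nth_rw 2 [h1]
  exact lt_add_of_pos_left _ (smul_pos_of_pos (by norm_num) h)

theorem exists_pos_forall_le [Nontrivial Λ] {α : Type*} (s : Finset α) (f : α → Λ)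
    (hf : ∀ i ∈ s, 0 < f i) : ∃ e : Λ, 0 < e ∧ ∀ i ∈ s, e ≤ f i := by
  induction s using Finset.induction_on with
  | empty =>
    obtain ⟨e, he⟩ := exists_zero_lt (α := Λ)
    exact ⟨e, he, by simp⟩
  | insert a s _ ih =>
    obtain ⟨e, he, h⟩ := ih fun i hi => hf i (Finset.mem_insert_of_mem hi)
    refine ⟨min e (f a), lt_min he (hf a (Finset.mem_insert_self _ _)), fun i hi => ?_⟩
    rcases Finset.mem_insert.1 hi with rfl | hi
    · exact min_le_right _ _
    · exact (min_le_left _ _).trans (h i hi)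

/-- A bounded additive error is absorbed by scaling: were `c' < c`, take `l` with `(c - c') • l`
equal to `|K| + e`. -/
theorem eq_of_forall_smul_le [Nontrivial Λ] {a a' : F} {K : Λ}
    (h : ∀ l : Λ, 0 < l → a • l ≤ a' • l + K ∧ a' • l ≤ a • l + K) : a = a' := by
  obtain ⟨e, he⟩ := exists_zero_lt (α := Λ)
  have key : ∀ c c' : F, (∀ l : Λ, 0 < l → c • l ≤ c' • l + K) → c ≤ c' := by
    intro c c' h
    by_contra! hc
    have hl : 0 < |K| + e := add_pos_of_nonneg_of_pos (abs_nonneg _) he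
    have h1 := h ((c - c')⁻¹ • (|K| + e)) (smul_pos_of_pos (inv_pos.2 (sub_pos.2 hc)) hl)
    rw [← sub_le_iff_le_add', ← sub_smul, smul_smul, mul_inv_cancel₀ (sub_pos.2 hc).ne',
      one_smul] at h1
    have h2 := le_abs_self K
    exact absurd (h1.trans h2) (not_le.2 (lt_add_of_pos_right _ he))
  exact le_antisymm (key _ _ fun l hl => (h l hl).1) (key _ _ fun l hl => (h l hl).2)

end Order

/-! ## The model space -/

section Model

variable {F : Subfield ℝ} {ι M N Λ : Type*} [Fintype ι] [AddCommGroup M] [Module F M]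
  [AddCommGroup N] [Module F N] {P : RootPairing ι F M N} [P.IsRootSystem] {B : Set ι}
  [AddCommGroup Λ] [LinearOrder Λ] [IsOrderedAddMonoid Λ] [Module F Λ] [PosSMulMono F Λ]

theorem coev_tmul (i : ι) (m : M) (l : Λ) : coev P i (m ⊗ₜ[F] l) = P.coroot' i m • l := by
  simp [coev]

theorem act_tmul (w : M ≃ₗ[F] M) (m : M) (l : Λ) : act w (m ⊗ₜ[F] l) = w m ⊗ₜ[F] l := by
  simp [act]

theorem act_mul (w w' : M ≃ₗ[F] M) (v : ModelSpace F M Λ) : act (w * w') v = act w (act w' v) := by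
  induction v using TensorProduct.induction_on with
  | zero => simp
  | tmul m l => simp [act_tmul]
  | add x y hx hy => simp [hx, hy]

theorem act_one (v : ModelSpace F M Λ) : act (1 : M ≃ₗ[F] M) v = v := by
  induction v using TensorProduct.induction_on with
  | zero => simp
  | tmul m l => simp [act_tmul]
  | add x y hx hy => simp [hx, hy]

theorem act_act_inv (w : weylGroup P) (v : ModelSpace F M Λ) : act w.1 (act w⁻¹.1 v) = v := by
  rw [← act_mul, ← Subgroup.coe_mul, mul_inv_cancel, Subgroup.coe_one, act_one]

theorem act_inv_act (w : weylGroup P) (v : ModelSpace F M Λ) : act w⁻¹.1 (act w.1 v) = v := by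
  rw [← act_mul, ← Subgroup.coe_mul, inv_mul_cancel, Subgroup.coe_one, act_one]

theorem coev_act (w : weylGroup P) (i : ι) (v : ModelSpace F M Λ) :
    coev P (wperm w i) (act w.1 v) = coev P i v := by
  induction v using TensorProduct.induction_on with
  | zero => simp
  | tmul m l => rw [act_tmul, coev_tmul, coev_tmul, coroot'_wperm]
  | add x y hx hy => simp [hx, hy]

theorem coev_act' (w : weylGroup P) (i : ι) (v : ModelSpace F M Λ) :
    coev P i (act w.1 v) = coev P (wperm w⁻¹ i) v := by
  have := coev_act w (wperm w⁻¹ i) v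
  rwa [wperm_apply_inv] at this

theorem coev_nidx (i : ι) (v : ModelSpace F M Λ) : coev P (nidx P i) v = -coev P i v := by
  induction v using TensorProduct.induction_on with
  | zero => simp
  | tmul m l => rw [coev_tmul, coev_tmul, coroot'_nidx, neg_smul]
  | add x y hx hy => simp [hx, hy]; abel

theorem act_reflection (i : ι) (v : ModelSpace F M Λ) :
    act (P.reflection i) v = v - P.root i ⊗ₜ[F] coev P i v := by
  induction v using TensorProduct.induction_on with
  | zero => simp
  | tmul m l => rw [act_tmul, coev_tmul, P.reflection_apply, TensorProduct.sub_tmul,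
      TensorProduct.smul_tmul]
  | add x y hx hy => rw [map_add, hx, hy, map_add, TensorProduct.tmul_add]; abel

theorem act_reflection_of_eq_zero {i : ι} {v : ModelSpace F M Λ} (h : coev P i v = 0) :
    act (P.reflection i) v = v := by
  rw [act_reflection, h, TensorProduct.tmul_zero, sub_zero]

theorem coev_reflection (i j : ι) (v : ModelSpace F M Λ) :
    coev P j (act (P.reflection i) v) = coev P (P.reflectionPerm i j) v := by
  have := coev_act' (sref P i) j v
  rwa [sref_inv, wperm_sref] at this

theorem IsBasis.coev_eq_sum (hB : IsBasis P B) (i : ι) (v : ModelSpace F M Λ) :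
    coev P i v = ∑ b : B, hB.kcoef i b • coev P b v := by
  induction v using TensorProduct.induction_on with
  | zero => simp
  | tmul m l => simp only [coev_tmul]; rw [hB.coroot'_eq_sum, Finset.sum_smul]; simp [mul_smul]
  | add x y hx hy => simp [hx, hy, Finset.sum_add_distrib]

theorem IsBasis.Mult.coev_eq {hB : IsBasis P B} {b : B} {i : ι} (h : hB.Mult b i)
    (v : ModelSpace F M Λ) : coev P i v = hB.kcoef i b • coev P b v := by
  rw [hB.coev_eq_sum]
  refine Finset.sum_eq_single b (fun b' _ hb => ?_) (by simp)
  rw [IsBasis.kcoef, h b' hb]; simp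

theorem IsBasis.Mult.kcoef_pos {hB : IsBasis P B} {b : B} {i : ι} (h : hB.Mult b i)
    (hi : IsPos P B i) : 0 < hB.kcoef i b :=
  hB.kcoef_pos (lt_of_le_of_ne ((hB.isPos_iff i).1 hi b) h.coef_ne_zero.symm)

theorem IsBasis.sum_dualVec_tmul (hB : IsBasis P B) (v : ModelSpace F M Λ) :
    ∑ b : B, hB.dualVec b ⊗ₜ[F] coev P b v = v := by
  induction v using TensorProduct.induction_on with
  | zero => simp
  | tmul m l =>
    simp only [coev_tmul, ← TensorProduct.smul_tmul]
    rw [← TensorProduct.sum_tmul, hB.sum_dualVec]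
  | add x y hx hy =>
    simp only [map_add, TensorProduct.tmul_add, Finset.sum_add_distrib, hx, hy]

theorem IsBasis.ext_coev (hB : IsBasis P B) {v v' : ModelSpace F M Λ}
    (h : ∀ b : B, coev P b v = coev P b v') : v = v' := by
  rw [← hB.sum_dualVec_tmul v, ← hB.sum_dualVec_tmul v']
  simp [h]

theorem IsBasis.exists_coev_eq (hB : IsBasis P B) (l : B → Λ) :
    ∃ v : ModelSpace F M Λ, ∀ b : B, coev P b v = l b := by
  refine ⟨∑ b : B, hB.dualVec b ⊗ₜ[F] l b, fun b => ?_⟩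
  simp [map_sum, coev_tmul, hB.coroot'_dualVec]

theorem IsBasis.coev_le_of_simple (hB : IsBasis P B) {u v : ModelSpace F M Λ}
    (h : ∀ b : B, coev P b u ≤ coev P b v) {i : ι} (hi : IsPos P B i) :
    coev P i u ≤ coev P i v := by
  rw [hB.coev_eq_sum, hB.coev_eq_sum i v]
  exact Finset.sum_le_sum fun b _ => smul_le_smul_of_nonneg_left (h b) (hB.kcoef_nonneg hi b)

theorem IsBasis.mem_fundChamber_iff (hB : IsBasis P B) {v : ModelSpace F M Λ} :
    v ∈ fundChamber P B ↔ ∀ b : B, 0 ≤ coev P b v := by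
  refine ⟨fun h b => h b (hB.isPos_simple b), fun h i hi => ?_⟩
  have := hB.coev_le_of_simple (u := 0) (v := v) (by simpa using h) hi
  simpa using this

theorem IsBasis.coev_pos_of_simple (hB : IsBasis P B) {v : ModelSpace F M Λ}
    (h : ∀ b : B, 0 < coev P b v) {i : ι} (hi : IsPos P B i) : 0 < coev P i v := by
  obtain ⟨b, hb⟩ := hB.exists_coef_ne_zero i
  rw [hB.coev_eq_sum]
  refine Finset.sum_pos' (fun b _ => smul_nonneg (hB.kcoef_nonneg hi b) (h b).le)
    ⟨b, Finset.mem_univ _, smul_pos_of_pos (hB.kcoef_pos ?_) (h b)⟩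
  exact lt_of_le_of_ne ((hB.isPos_iff i).1 hi b) hb.symm

theorem zero_mem_fundChamber : (0 : ModelSpace F M Λ) ∈ fundChamber P B := fun i _ => by simp

theorem add_mem_fundChamber {u v : ModelSpace F M Λ} (hu : u ∈ fundChamber P B)
    (hv : v ∈ fundChamber P B) : u + v ∈ fundChamber P B := fun i hi => by
  rw [map_add]; exact add_nonneg (hu i hi) (hv i hi)

/-- Every vector is conjugate to one in the fundamental chamber. -/
theorem IsBasis.exists_act_mem (hB : IsBasis P B) (v : ModelSpace F M Λ) :
    ∃ w : weylGroup P, act w.1 v ∈ fundChamber P B := by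
  induction hn : (Finset.univ.filter fun i => IsPos P B i ∧ coev P i v < 0).card using
    Nat.strong_induction_on generalizing v with
  | _ n ih =>
  by_cases hv : v ∈ fundChamber P B
  · exact ⟨1, by rwa [Subgroup.coe_one, act_one]⟩
  rw [hB.mem_fundChamber_iff] at hv
  push Not at hv
  obtain ⟨b, hb⟩ := hv
  have hmem : (b : ι) ∈ Finset.univ.filter fun i => IsPos P B i ∧ coev P i v < 0 := by
    simp [hb, hB.isPos_simple b]
  have hlt : (Finset.univ.filter fun i =>
      IsPos P B i ∧ coev P i (act (P.reflection b) v) < 0).card < n := by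
    -- The reflection in `b` injects the roots still violated into those violated before, and misses
    -- `b` itself.
    rw [← hn, ← Finset.card_erase_add_one hmem, Nat.lt_succ_iff]
    refine Finset.card_le_card_of_injOn (P.reflectionPerm b) (fun i hi => ?_)
      (P.reflectionPerm b).injective.injOn
    simp only [Finset.coe_filter, Finset.mem_univ, true_and, Set.mem_ofPred_eq] at hi
    rw [coev_reflection] at hi
    have hm : ¬hB.Mult b i := fun hm => by
      rw [hm.reflectionPerm_eq, coev_nidx, hm.coev_eq] at hi
      have := smul_neg_of_neg (hm.kcoef_pos hi.1) hb
      exact absurd hi.2 (not_lt.2 (neg_nonneg.2 this.le))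
    simp only [Finset.coe_erase, Finset.coe_filter, Finset.mem_univ, true_and, Set.mem_sdiff,
      Set.mem_ofPred_eq, Set.mem_singleton_iff]
    refine ⟨⟨hB.isPos_reflectionPerm hi.1 hm, hi.2⟩, fun h => hm ?_⟩
    rw [← hB.mult_reflectionPerm_iff, h]
    exact hB.mult_self b
  obtain ⟨w, hw⟩ := ih _ hlt _ rfl
  refine ⟨w * sref P b, ?_⟩
  rw [Subgroup.coe_mul, act_mul]
  exact hw

/-- The fundamental chamber is a strict fundamental domain, and stabilizers of its points are
generated by simple reflections. -/
theorem IsBasis.act_eq_of_mem (hB : IsBasis P B) {v : ModelSpace F M Λ} (hv : v ∈ fundChamber P B)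
    (w : weylGroup P) (hw : act w.1 v ∈ fundChamber P B) :
    act w.1 v = v ∧ w ∈ Subgroup.closure
      (simpleReflection P B '' {b | coev P (b : ι) v = 0}) := by
  induction hn : wlen (simpleReflection P B) w using Nat.strong_induction_on generalizing w with
  | _ n ih =>
  by_cases h1 : w = 1
  · subst h1
    exact ⟨by rw [Subgroup.coe_one, act_one], one_mem _⟩
  obtain ⟨b, hb⟩ := exists_wlen_mul_lt hB.exists_list simpleReflection_mul_self h1
  have h2 := hB.not_isPos_of_wlen_lt hb
  -- The image of `b` under `w` is negative while `v` and its image are dominant, so this value has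
  -- both signs.
  have h3 : coev P b v = 0 := by
    refine le_antisymm ?_ (hv b (hB.isPos_simple b))
    have := hw _ ((hB.isPos_nidx_iff _).2 h2)
    rwa [coev_nidx, coev_act, neg_nonneg] at this
  have h4 : act (w * simpleReflection P B b).1 v = act w.1 v := by
    rw [Subgroup.coe_mul, act_mul]
    congr 1
    exact act_reflection_of_eq_zero h3
  obtain ⟨h5, h6⟩ := ih _ (hn ▸ hb) (w * simpleReflection P B b) (by rwa [h4]) rfl
  refine ⟨h4 ▸ h5, ?_⟩
  have h7 : w = (w * simpleReflection P B b) * simpleReflection P B b := by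
    rw [mul_assoc, simpleReflection_mul_self, mul_one]
  rw [h7]
  exact mul_mem h6 (Subgroup.subset_closure ⟨b, h3, rfl⟩)

theorem IsBasis.act_injective (hB : IsBasis P B) {v : ModelSpace F M Λ}
    (hv : ∀ b : B, 0 < coev P b v) {w w' : weylGroup P} (h : act w.1 v = act w'.1 v) : w = w' := by
  have hC : v ∈ fundChamber P B := hB.mem_fundChamber_iff.2 fun b => (hv b).le
  have h1 : act (w⁻¹ * w').1 v = v := by
    rw [Subgroup.coe_mul, act_mul, ← h, act_inv_act]
  obtain ⟨-, h2⟩ := hB.act_eq_of_mem hC (w⁻¹ * w') (by rwa [h1])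
  have h3 : {b : B | coev P (b : ι) v = 0} = ∅ := by
    ext b; simpa using (hv b).ne'
  rw [h3, Set.image_empty, Subgroup.closure_empty, Subgroup.mem_bot] at h2
  exact (inv_mul_eq_one.1 h2)

theorem IsBasis.exists_regular [Nontrivial Λ] (hB : IsBasis P B) :
    ∃ v : ModelSpace F M Λ, ∀ b : B, 0 < coev P b v := by
  obtain ⟨e, he⟩ := exists_zero_lt (α := Λ)
  obtain ⟨v, hv⟩ := hB.exists_coev_eq (fun _ : B => e)
  exact ⟨v, fun b => by rw [hv]; exact he⟩

/-! ### The norm -/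

/-- The `Λ`-valued norm `∑_{α > 0} |⟨v, α^∨⟩|`. -/
def nrm (P : RootPairing ι F M N) (B : Set ι) (v : ModelSpace F M Λ) : Λ :=
  ∑ i with IsPos P B i, |coev P i v|

theorem modelDist_eq (u v : ModelSpace F M Λ) : modelDist P B u v = nrm P B (v - u) := rfl

/-- The sum over all roots is visibly Weyl-invariant because roots are permuted; this transfers
invariance to the sum over positive roots. -/
theorem IsBasis.sum_abs_coev (hB : IsBasis P B) (v : ModelSpace F M Λ) :
    ∑ i, |coev P i v| = nrm P B v + nrm P B v := by
  rw [← Finset.sum_filter_add_sum_filter_not Finset.univ (IsPos P B)]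
  congr 1
  refine Finset.sum_bij' (fun i _ => nidx P i) (fun i _ => nidx P i) ?_ ?_ ?_ ?_ ?_
  · intro i hi
    simp only [Finset.mem_filter, Finset.mem_univ, true_and] at hi ⊢
    rwa [hB.isPos_nidx_iff]
  · intro i hi
    simp only [Finset.mem_filter, Finset.mem_univ, true_and] at hi ⊢
    rwa [hB.isPos_nidx_iff, not_not]
  · intro i _; exact nidx_nidx i
  · intro i _; exact nidx_nidx i
  · intro i _; rw [coev_nidx, abs_neg]

theorem IsBasis.nrm_act (hB : IsBasis P B) (w : weylGroup P) (v : ModelSpace F M Λ) :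
    nrm P B (act w.1 v) = nrm P B v := by
  have h : ∑ i, |coev P i (act w.1 v)| = ∑ i, |coev P i v| := by
    simp only [coev_act']
    exact Equiv.sum_comp (wperm w⁻¹) fun i => |coev P i v|
  rw [hB.sum_abs_coev, hB.sum_abs_coev] at h
  rcases lt_trichotomy (nrm P B (act w.1 v)) (nrm P B v) with h' | h' | h'
  · exact absurd h (add_lt_add h' h').ne
  · exact h'
  · exact absurd h (add_lt_add h' h').ne'

theorem nrm_add_le (u v : ModelSpace F M Λ) : nrm P B (u + v) ≤ nrm P B u + nrm P B v := by
  rw [nrm, nrm, nrm, ← Finset.sum_add_distrib]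
  exact Finset.sum_le_sum fun i _ => by rw [map_add]; exact abs_add_le _ _

theorem nrm_neg (v : ModelSpace F M Λ) : nrm P B (-v) = nrm P B v := by simp [nrm]

theorem nrm_zero : nrm P B (0 : ModelSpace F M Λ) = 0 := by simp [nrm]

theorem nrm_nonneg (v : ModelSpace F M Λ) : 0 ≤ nrm P B v :=
  Finset.sum_nonneg fun _ _ => abs_nonneg _

theorem nrm_sub_comm (u v : ModelSpace F M Λ) : nrm P B (u - v) = nrm P B (v - u) := by
  rw [← nrm_neg, neg_sub]

theorem IsBasis.abs_coev_le_nrm (hB : IsBasis P B) (i : ι) (v : ModelSpace F M Λ) :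
    |coev P i v| ≤ nrm P B v := by
  have key : ∀ i, IsPos P B i → |coev P i v| ≤ nrm P B v := fun i hi =>
    Finset.single_le_sum (f := fun i => |coev P i v|) (fun _ _ => abs_nonneg _)
      (by simp [hi])
  by_cases hi : IsPos P B i
  · exact key i hi
  · have := key _ ((hB.isPos_nidx_iff i).2 hi)
    rwa [coev_nidx, abs_neg] at this

theorem IsBasis.nrm_eq_zero_iff (hB : IsBasis P B) {v : ModelSpace F M Λ} :
    nrm P B v = 0 ↔ v = 0 := by
  refine ⟨fun h => hB.ext_coev fun b => ?_, fun h => by rw [h, nrm_zero]⟩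
  have := hB.abs_coev_le_nrm b v
  rw [h] at this
  simpa using abs_nonpos_iff.1 this

/-- Equality in a sum of triangle inequalities is equality in each summand. Metric betweenness thus
becomes a sign condition on every coroot. -/
theorem IsBasis.abs_coev_add_of_nrm (hB : IsBasis P B) {u v : ModelSpace F M Λ}
    (h : nrm P B (u + v) = nrm P B u + nrm P B v) (i : ι) :
    |coev P i (u + v)| = |coev P i u| + |coev P i v| := by
  have key : ∀ i, IsPos P B i → |coev P i (u + v)| = |coev P i u| + |coev P i v| := by
    have h1 : ∀ i ∈ Finset.univ.filter (IsPos P B),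
        |coev P i (u + v)| ≤ |coev P i u| + |coev P i v| := fun i _ => by
      rw [map_add]; exact abs_add_le _ _
    rw [nrm, nrm, nrm, ← Finset.sum_add_distrib] at h
    intro i hi
    exact (Finset.sum_eq_sum_iff_of_le h1).1 h i (by simp [hi])
  by_cases hi : IsPos P B i
  · exact key i hi
  · have := key _ ((hB.isPos_nidx_iff i).2 hi)
    simpa only [coev_nidx, abs_neg] using this

theorem nrm_add_of_mem {u v : ModelSpace F M Λ} (hu : u ∈ fundChamber P B)
    (hv : v ∈ fundChamber P B) : nrm P B (u + v) = nrm P B u + nrm P B v := by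
  rw [nrm, nrm, nrm, ← Finset.sum_add_distrib]
  refine Finset.sum_congr rfl fun i hi => ?_
  simp only [Finset.mem_filter, Finset.mem_univ, true_and] at hi
  rw [map_add, abs_of_nonneg (add_nonneg (hu i hi) (hv i hi)), abs_of_nonneg (hu i hi),
    abs_of_nonneg (hv i hi)]

/-! ### Scaling -/

/-- The map `M ⊗ F → M ⊗ Λ` induced by `1 ↦ l`. -/
def scale (l : Λ) : ModelSpace F M F →ₗ[F] ModelSpace F M Λ :=
  LinearMap.lTensor M (LinearMap.toSpanSingleton F Λ l)

theorem coev_scale (l : Λ) (i : ι) (v : ModelSpace F M F) :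
    coev P i (scale l v) = coev P i v • l := by
  induction v using TensorProduct.induction_on with
  | zero => simp
  | tmul m c => simp [scale, coev_tmul, mul_smul, smul_comm c]
  | add x y hx hy => simp [hx, hy, add_smul]

theorem act_scale (l : Λ) (w : M ≃ₗ[F] M) (v : ModelSpace F M F) :
    act w (scale l v) = scale l (act w v) := by
  induction v using TensorProduct.induction_on with
  | zero => simp
  | tmul m c => simp [scale, act_tmul]
  | add x y hx hy => simp [hx, hy]

theorem nrm_scale {l : Λ} (hl : 0 < l) (v : ModelSpace F M F) :
    nrm P B (scale l v) = nrm P B v • l := by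
  rw [nrm, nrm, Finset.sum_smul]
  exact Finset.sum_congr rfl fun i _ => by rw [coev_scale, abs_smul, abs_of_pos hl]

/-! ### Vectors of an orbit are determined by their distances to the fundamental chamber -/

theorem exists_pos_forall_mul_lt {α : Type*} (s : Finset α) (f g : α → F)
    (hf : ∀ i ∈ s, 0 < f i) : ∃ e : F, 0 < e ∧ ∀ i ∈ s, e * |g i| < f i := by
  obtain ⟨e, he, h⟩ := exists_pos_forall_le s (fun i => f i / (|g i| + 1))
    fun i hi => div_pos (hf i hi) (by positivity)
  refine ⟨e, he, fun i hi => ?_⟩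
  have := h i hi
  rw [le_div_iff₀ (by positivity)] at this
  nlinarith

/-- A small perturbation leaves each kernel in turn without destroying the strict inequalities
already achieved. -/
theorem IsBasis.exists_generic (hB : IsBasis P B) (s : Finset (ModelSpace F M F →ₗ[F] F)) :
    ∃ v : ModelSpace F M F, (∀ b : B, 0 < coev P b v) ∧ ∀ f ∈ s, f ≠ 0 → f v ≠ 0 := by
  induction s using Finset.induction_on with
  | empty =>
    obtain ⟨v, hv⟩ := hB.exists_regular (Λ := F)
    exact ⟨v, hv, by simp⟩
  | insert f s _ ih =>
    obtain ⟨v, hv, h⟩ := ih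
    by_cases hf : f ≠ 0 → f v ≠ 0
    · refine ⟨v, hv, fun g hg => ?_⟩
      rcases Finset.mem_insert.1 hg with rfl | hg
      exacts [hf, h g hg]
    push Not at hf
    obtain ⟨hf0, hfv⟩ := hf
    obtain ⟨m, hm⟩ : ∃ m, f m ≠ 0 := by
      by_contra! h0
      exact hf0 (LinearMap.ext h0)
    obtain ⟨e, he, h1⟩ := exists_pos_forall_mul_lt (Finset.univ : Finset B)
      (fun b => coev P b v) (fun b => coev P b m) fun b _ => hv b
    obtain ⟨e', he', h2⟩ := exists_pos_forall_mul_lt (s.filter (· ≠ 0))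
      (fun g => |g v|) (fun g => g m) fun g hg =>
        abs_pos.2 (h g (Finset.mem_filter.1 hg).1 (Finset.mem_filter.1 hg).2)
    have hmin : 0 < min e e' := lt_min he he'
    refine ⟨v + min e e' • m, fun b => ?_, fun g hg hg0 => ?_⟩
    · have h3 := h1 b (Finset.mem_univ _)
      have h4 : min e e' * |coev P b m| ≤ e * |coev P b m| :=
        mul_le_mul_of_nonneg_right (min_le_left _ _) (abs_nonneg _)
      have h5 := neg_abs_le (min e e' * coev P b m)
      rw [abs_mul, abs_of_pos hmin] at h5
      rw [map_add, map_smul, smul_eq_mul]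
      linarith
    · rcases Finset.mem_insert.1 hg with rfl | hg
      · rw [map_add, hfv, zero_add, map_smul, smul_eq_mul]
        exact mul_ne_zero hmin.ne' hm
      · have h3 := h2 g (Finset.mem_filter.2 ⟨hg, hg0⟩)
        have h4 : min e e' * |g m| ≤ e' * |g m| :=
          mul_le_mul_of_nonneg_right (min_le_right _ _) (abs_nonneg _)
        intro h0
        rw [map_add, map_smul, smul_eq_mul, add_eq_zero_iff_eq_neg] at h0
        rw [h0, abs_neg, abs_mul, abs_of_pos hmin] at h3
        linarith

theorem abs_add_abs_sub_eq {x y : F} (h : |y| ≤ |x|) : |x + y| + |x - y| = 2 * |x| := by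
  rcases abs_cases x with ⟨h1, h1'⟩ | ⟨h1, h1'⟩ <;> rw [h1] at h ⊢ <;>
  · have := abs_le.1 h
    rcases abs_cases (x + y) with ⟨h3, h3'⟩ | ⟨h3, h3'⟩ <;>
    rcases abs_cases (x - y) with ⟨h4, h4'⟩ | ⟨h4, h4'⟩ <;> linarith

theorem two_mul_abs_le (x y : F) : 2 * |x| ≤ |x + y| + |x - y| := by
  have := abs_add_le (x + y) (x - y)
  have h2 : x + y + (x - y) = 2 * x := by ring
  rw [h2, abs_mul, abs_two] at this
  exact this

/-- Along the ray through `η`, the distance to `u` is piecewise linear, with convex kinks where a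
wall through `u` is crossed. A kink at `η` must also occur for `u'`, so `η` lies on a wall through
`u'`. -/
theorem IsBasis.exists_coev_eq_of_nrm (hB : IsBasis P B) {u u' η : ModelSpace F M F}
    (h : ∀ y ∈ fundChamber P B, nrm P B (y - u) = nrm P B (y - u'))
    (hη : ∀ b : B, 0 < coev P b η) (hu : ∃ i, IsPos P B i ∧ coev P i η = coev P i u) :
    ∃ i, IsPos P B i ∧ coev P i η = coev P i u' := by
  by_contra! hne
  have hreg : ∀ i, IsPos P B i → 0 < coev P i η := fun i hi => hB.coev_pos_of_simple hη hi
  obtain ⟨e, he, h1⟩ := exists_pos_forall_mul_lt (Finset.univ.filter (IsPos P B))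
    (fun i => |coev P i (η - u')|) (fun i => coev P i η) fun i hi => by
      have := hne i (Finset.mem_filter.1 hi).2
      rw [map_sub]
      exact abs_pos.2 (sub_ne_zero.2 this)
  have hη' : ∀ c : F, 0 ≤ c → c • η ∈ fundChamber P B := fun c hc i hi => by
    rw [map_smul]; exact mul_nonneg hc (hreg i hi).le
  wlog he1 : e ≤ 1 generalizing e
  · refine this 1 one_pos (fun i hi => ?_) le_rfl
    refine lt_of_le_of_lt (mul_le_mul_of_nonneg_right (not_le.1 he1).le (abs_nonneg _)) (h1 i hi)
  -- The second difference along the ray: each summand is non-negative, it vanishes when `e` is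
  -- small enough to cross no wall, and it is positive at a kink.
  have hsum : ∀ z : ModelSpace F M F, nrm P B ((1 + e) • η - z) + nrm P B ((1 - e) • η - z) -
      2 * nrm P B (η - z) = ∑ i with IsPos P B i,
        (|coev P i (η - z) + e * coev P i η| + |coev P i (η - z) - e * coev P i η| -
          2 * |coev P i (η - z)|) := by
    intro z
    rw [nrm, nrm, nrm, Finset.sum_sub_distrib, Finset.sum_add_distrib, Finset.mul_sum]
    congr 2 <;> refine Finset.sum_congr rfl fun i _ => congrArg _ ?_ <;>
      simp only [map_sub, map_smul, smul_eq_mul] <;> ring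
  have e1 := hsum u
  have e2 := hsum u'
  rw [h _ (hη' _ (by linarith)), h _ (hη' _ (by linarith)),
    h η (by simpa using hη' 1 zero_le_one), e2] at e1
  have z2 : ∑ i with IsPos P B i,
      (|coev P i (η - u') + e * coev P i η| + |coev P i (η - u') - e * coev P i η| -
          2 * |coev P i (η - u')|) = 0 := by
    refine Finset.sum_eq_zero fun i hi => ?_
    rw [abs_add_abs_sub_eq, sub_self]
    rw [abs_mul, abs_of_pos he]
    exact (h1 i hi).le
  rw [z2] at e1
  obtain ⟨i, hi, hiu⟩ := hu
  have hnn : ∀ i ∈ Finset.univ.filter (IsPos P B),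
      0 ≤ (|coev P i (η - u) + e * coev P i η| + |coev P i (η - u) - e * coev P i η| -
          2 * |coev P i (η - u)|) := fun i _ => sub_nonneg.2 (two_mul_abs_le _ _)
  have := (Finset.sum_eq_zero_iff_of_nonneg hnn).1 e1.symm i (by simp [hi])
  have h5 := mul_pos he (hreg i hi)
  rw [map_sub, ← hiu, sub_self, zero_add, zero_sub, abs_neg, abs_zero, mul_zero, sub_zero,
    abs_of_pos h5] at this
  linarith

/-- Put a generic `η` on the wall of `i` through `u`; it then lies on some wall of `j` through `u'`.
Genericity makes the two equations proportional as functionals, and evaluating at `u'` gives the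
equality. -/
theorem IsBasis.coev_eq_of_nrm (hB : IsBasis P B) {u u' : ModelSpace F M F}
    (h : ∀ y ∈ fundChamber P B, nrm P B (y - u) = nrm P B (y - u')) {i : ι} (hi : IsPos P B i)
    (hiu : 0 < coev P i u) : coev P i u' = coev P i u := by
  obtain ⟨η, hη, hgen⟩ := hB.exists_generic (Finset.univ.image fun j =>
    coev P i u • coev P j - coev P j u' • coev P i)
  have hiη := hB.coev_pos_of_simple hη hi
  have ht : 0 < coev P i u / coev P i η := div_pos hiu hiη
  obtain ⟨j, hj, hju⟩ := hB.exists_coev_eq_of_nrm (η := (coev P i u / coev P i η) • η) h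
    (fun b => by rw [map_smul]; exact mul_pos ht (hη b))
    ⟨i, hi, by rw [map_smul, smul_eq_mul, div_mul_cancel₀ _ hiη.ne']⟩
  have hjpos : 0 < coev P j u' := by
    rw [← hju, map_smul]; exact mul_pos ht (hB.coev_pos_of_simple hη hj)
  have hz : coev P i u • coev P j - coev P j u' • coev P i =
      (0 : ModelSpace F M F →ₗ[F] F) := by
    by_contra hne
    refine hgen _ (Finset.mem_image_of_mem _ (Finset.mem_univ j)) hne ?_
    simp only [LinearMap.sub_apply, LinearMap.smul_apply, smul_eq_mul]
    rw [← hju, map_smul, smul_eq_mul]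
    field_simp
    ring
  have := LinearMap.congr_fun hz u'
  simp only [LinearMap.sub_apply, LinearMap.smul_apply, smul_eq_mul, LinearMap.zero_apply] at this
  have h2 : coev P j u' * (coev P i u - coev P i u') = 0 := by linear_combination this
  exact (sub_eq_zero.1 ((mul_eq_zero.1 h2).resolve_left hjpos.ne')).symm

/-- Reflecting both vectors in a simple root positive on `u` lowers the number of positive roots
that are positive on `u`. When none remain, both vectors are antidominant and in one orbit, hence
equal. -/
theorem IsBasis.eq_of_coev_eq_of_pos (hB : IsBasis P B) {u u' : ModelSpace F M Λ}
    (h : ∀ i, IsPos P B i → 0 < coev P i u → coev P i u' = coev P i u)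
    (h' : ∀ i, IsPos P B i → 0 < coev P i u' → coev P i u = coev P i u')
    (hw : ∃ w : weylGroup P, act w.1 u = u') : u = u' := by
  induction hn : (Finset.univ.filter fun i => IsPos P B i ∧ 0 < coev P i u).card using
    Nat.strong_induction_on generalizing u u' with
  | _ n ih =>
  by_cases hu : ∀ b : B, coev P b u ≤ 0
  · have h1 : -u ∈ fundChamber P B := hB.mem_fundChamber_iff.2 fun b => by
      rw [map_neg]; exact neg_nonneg.2 (hu b)
    have h2 : -u' ∈ fundChamber P B := fun i hi => by
      rw [map_neg, neg_nonneg]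
      by_contra! hc
      have h3 := h' i hi hc
      have h4 := h1 i hi
      rw [map_neg, h3] at h4
      exact absurd hc (not_lt.2 (neg_nonneg.1 h4))
    obtain ⟨w, hw⟩ := hw
    have := (hB.act_eq_of_mem h1 w (by rwa [map_neg, hw])).1
    rw [map_neg, hw] at this
    exact (neg_injective this).symm
  push Not at hu
  obtain ⟨b, hb⟩ := hu
  have hb' := h b (hB.isPos_simple b) hb
  have hmem : (b : ι) ∈ Finset.univ.filter fun i => IsPos P B i ∧ 0 < coev P i u := by
    simp [hb, hB.isPos_simple b]
  have hnm : ∀ z : ModelSpace F M Λ, 0 < coev P b z → ∀ i, IsPos P B i →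
      0 < coev P i (act (P.reflection b) z) → ¬hB.Mult b i := fun z hz i hi hiz hm => by
    rw [coev_reflection, hm.reflectionPerm_eq, coev_nidx, hm.coev_eq] at hiz
    have := smul_pos_of_pos (hm.kcoef_pos hi) hz
    exact absurd hiz (not_lt.2 (neg_nonpos.2 this.le))
  have hlt : (Finset.univ.filter fun i =>
      IsPos P B i ∧ 0 < coev P i (act (P.reflection b) u)).card < n := by
    rw [← hn, ← Finset.card_erase_add_one hmem, Nat.lt_succ_iff]
    refine Finset.card_le_card_of_injOn (P.reflectionPerm b) (fun i hi => ?_)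
      (P.reflectionPerm b).injective.injOn
    simp only [Finset.coe_filter, Finset.mem_univ, true_and, Set.mem_ofPred_eq] at hi
    have hm := hnm u hb i hi.1 hi.2
    rw [coev_reflection] at hi
    simp only [Finset.coe_erase, Finset.coe_filter, Finset.mem_univ, true_and, Set.mem_sdiff,
      Set.mem_ofPred_eq, Set.mem_singleton_iff]
    refine ⟨⟨hB.isPos_reflectionPerm hi.1 hm, hi.2⟩, fun h => hm ?_⟩
    rw [← hB.mult_reflectionPerm_iff, h]
    exact hB.mult_self b
  have key := ih _ hlt (u := act (P.reflection b) u) (u' := act (P.reflection b) u') ?_ ?_ ?_ rfl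
  · have := congrArg (act (P.reflection b)) key
    have e := fun z : ModelSpace F M Λ => act_act_inv (sref P b) z
    rw [sref_inv] at e
    rwa [show act (P.reflection b) (act (P.reflection b) u) = u from e u,
      show act (P.reflection b) (act (P.reflection b) u') = u' from e u'] at this
  · intro i hi hiu
    have hm := hnm u hb i hi hiu
    rw [coev_reflection] at hiu ⊢
    rw [coev_reflection]
    exact h _ (hB.isPos_reflectionPerm hi hm) hiu
  · intro i hi hiu
    have hm := hnm u' (hb' ▸ hb) i hi hiu
    rw [coev_reflection] at hiu ⊢
    rw [coev_reflection]
    exact h' _ (hB.isPos_reflectionPerm hi hm) hiu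
  · obtain ⟨w, rfl⟩ := hw
    refine ⟨sref P b * w * sref P b, ?_⟩
    have e := act_inv_act (sref P b) u
    rw [sref_inv] at e
    rw [Subgroup.coe_mul, act_mul, Subgroup.coe_mul, act_mul]
    exact congrArg _ (congrArg _ e)

theorem IsBasis.eq_of_nrm_sub_eq (hB : IsBasis P B) {u u' : ModelSpace F M F}
    (h : ∀ y ∈ fundChamber P B, nrm P B (y - u) = nrm P B (y - u'))
    (hw : ∃ w : weylGroup P, act w.1 u = u') : u = u' :=
  hB.eq_of_coev_eq_of_pos (fun _ hi hiu => hB.coev_eq_of_nrm h hi hiu)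
    (fun _ hi hiu => hB.coev_eq_of_nrm (fun y hy => (h y hy).symm) hi hiu) hw

/-- Two elements of the Weyl group which map the panel of type `b` of the fundamental chamber to
panels of bounded difference in distance from the points of the chamber agree up to the simple
reflection of type `b`. -/
theorem IsBasis.eq_or_eq_mul_of_nrm_le [Nontrivial Λ] (hB : IsBasis P B) (b : B)
    (w w' : weylGroup P) (K : Λ)
    (h : ∀ v ∈ fundChamber P B, coev P b v = 0 → ∀ y ∈ fundChamber P B,
      nrm P B (y - act w.1 v) ≤ nrm P B (y - act w'.1 v) + K ∧
      nrm P B (y - act w'.1 v) ≤ nrm P B (y - act w.1 v) + K) :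
    w' = w ∨ w' = w * simpleReflection P B b := by
  -- A vector whose only vanishing simple coroot is `b`: its stabilizer consists of 1 and the
  -- reflection in `b`.
  obtain ⟨ν, hν⟩ := hB.exists_coev_eq (Λ := F) (fun b' : B => if b' = b then 0 else 1)
  have hνC : ν ∈ fundChamber P B := hB.mem_fundChamber_iff.2 fun b' => by
    rw [hν]; split_ifs <;> simp
  have hscale : ∀ (l : Λ), 0 < l → ∀ z ∈ (fundChamber P B : Set (ModelSpace F M F)),
      scale l z ∈ (fundChamber P B : Set (ModelSpace F M Λ)) := fun l hl z hz i hi => by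
    rw [coev_scale]; exact smul_nonneg (hz i hi) hl.le
  have h1 : act w.1 ν = act w'.1 ν := by
    -- Inserting multiples by every positive `l` makes the constant error `K` irrelevant, so the
    -- distances agree exactly over `F`.
    refine hB.eq_of_nrm_sub_eq (fun η hη => ?_) ⟨w' * w⁻¹, ?_⟩
    · refine eq_of_forall_smul_le (K := K) fun l hl => ?_
      have := h (scale l ν) (hscale l hl ν hνC) (by rw [coev_scale, hν]; simp)
        (scale l η) (hscale l hl η hη)
      rwa [act_scale, act_scale, ← map_sub, ← map_sub, nrm_scale hl, nrm_scale hl] at this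
    · rw [Subgroup.coe_mul, act_mul, act_inv_act]
  have h2 : act (w⁻¹ * w').1 ν = ν := by rw [Subgroup.coe_mul, act_mul, ← h1, act_inv_act]
  obtain ⟨-, h3⟩ := hB.act_eq_of_mem hνC (w⁻¹ * w') (by rwa [h2])
  have h4 : {b' : B | coev P (b' : ι) ν = 0} = {b} := by
    ext b'; simp [hν]
  rw [h4, Set.image_singleton, Subgroup.mem_closure_singleton] at h3
  obtain ⟨n, hn⟩ := h3
  have h5 : simpleReflection P B b ^ 2 = 1 := by rw [pow_two, simpleReflection_mul_self]
  rcases Int.even_or_odd' n with ⟨k, rfl | rfl⟩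
  · left
    rw [zpow_mul, zpow_ofNat, h5, one_zpow] at hn
    exact (inv_mul_eq_one.1 hn.symm).symm
  · right
    rw [zpow_add, zpow_mul, zpow_ofNat, h5, one_zpow, one_mul, zpow_one] at hn
    rw [hn, mul_inv_cancel_left]

end Model

/-! ## Weyl distances -/

section WeylDistance

variable {W κ C : Type*} [Group W] {s : κ → W} {δ : C → C → W}

/-- A `W`-valued distance on a set of chambers in which any two chambers lie in an isometric copy
of `W`, and which changes by at most `s k` when a chamber is replaced by a `k`-adjacent one. -/
structure IsWeylDist (s : κ → W) (δ : C → C → W) : Prop where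
  words : ∀ w, ∃ l : List κ, (l.map s).prod = w
  sq : ∀ k, s k * s k = 1
  eq_one_iff : ∀ c d, δ c d = 1 ↔ c = d
  chart : ∀ c d, ∃ φ : W → C, φ 1 = c ∧ (∃ w, φ w = d) ∧ ∀ u v, δ (φ u) (φ v) = u⁻¹ * v
  adj : ∀ e d d' k, δ d d' = s k → δ e d' = δ e d ∨ δ e d' = δ e d * s k

theorem IsWeylDist.inv (h : IsWeylDist s δ) (c d : C) : δ d c = (δ c d)⁻¹ := by
  obtain ⟨φ, rfl, ⟨w, rfl⟩, hφ⟩ := h.chart c d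
  rw [hφ, hφ]; simp

/-- Distances along a gallery: the distance changes by a subword of the type of the gallery. -/
theorem IsWeylDist.exists_subword (h : IsWeylDist s δ) (e : C) (l : List κ) (c d : C)
    (φ : W → C) (hφ : ∀ u v, δ (φ u) (φ v) = u⁻¹ * v) (u : W) (hc : φ u = c)
    (hd : φ (u * (l.map s).prod) = d) :
    ∃ l' : List κ, l'.length ≤ l.length ∧ δ e d = δ e c * (l'.map s).prod := by
  induction l generalizing u c with
  | nil => exact ⟨[], by simp, by simp [← hd, ← hc]⟩
  | cons k l ih =>
    obtain ⟨l', h1, h2⟩ := ih (φ (u * s k)) (u * s k) rfl (by simpa [mul_assoc] using hd)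
    have h3 : δ c (φ (u * s k)) = s k := by rw [← hc, hφ]; simp
    rcases h.adj e c _ k h3 with h4 | h4
    · exact ⟨l', by simp; omega, by rw [h2, h4]⟩
    · exact ⟨k :: l', by simpa using h1, by rw [h2, h4]; simp [mul_assoc]⟩

theorem IsWeylDist.adj_trans (h : IsWeylDist s δ) {c d e : C} {k : κ} (h1 : δ c d = s k)
    (h2 : δ d e = s k) (hne : c ≠ e) : δ c e = s k := by
  rcases h.adj c d e k h2 with h3 | h3
  · rw [h3, h1]
  · rw [h1, h.sq] at h3
    exact absurd ((h.eq_one_iff c e).1 h3) hne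

theorem IsWeylDist.eq_or_adj_trans (h : IsWeylDist s δ) {c d e : C} {k : κ}
    (h1 : c = d ∨ δ c d = s k) (h2 : d = e ∨ δ d e = s k) : c = e ∨ δ c e = s k := by
  rcases h1 with rfl | h1
  · exact h2
  rcases h2 with rfl | h2
  · exact Or.inr h1
  · by_cases hne : c = e
    · exact Or.inl hne
    · exact Or.inr (h.adj_trans h1 h2 hne)

/-- A gallery of reduced type ending in a chamber of an isometric copy of `W` remains there;
hence the distance increases along galleries of reduced type. -/
theorem IsWeylDist.mul_of_lt (h : IsWeylDist s δ) {c d d' : C} {k : κ} (hd : δ d d' = s k)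
    (hlt : wlen s (δ c d) < wlen s (δ c d * s k)) : δ c d' = δ c d * s k := by
  refine (h.adj c d d' k hd).resolve_left fun hw => ?_
  obtain ⟨φ, hφ1, ⟨w, hφw⟩, hφ⟩ := h.chart c d
  obtain ⟨ψ, hψ1, ⟨w', hψw⟩, hψ⟩ := h.chart c d'
  have e1 : δ c d = w := by rw [← hφ1, ← hφw, hφ]; simp
  have e2 : δ c d' = w' := by rw [← hψ1, ← hψw, hψ]; simp
  rw [e1] at hw hlt
  rw [e2] at hw
  subst hw
  -- Under the assumption to be refuted, `d` and `d'` are both at distance `w'` from `c`; `d''` is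
  -- the neighbour of `d` inside the first copy, at distance `w' * s k`.
  set d'' := φ (w' * s k) with hd''
  have hdd : δ d d'' = s k := by rw [← hφw, hd'', hφ]; simp
  have hsk : s k ≠ 1 := by
    rintro h1
    rw [h1, mul_one] at hlt
    exact lt_irrefl _ hlt
  have hne : d' ≠ d'' := by
    intro h1
    rw [h1, hd'', ← hφ1, hφ] at e2
    simp at e2
    exact hsk e2
  have hdd' : δ d' d'' = s k := by
    refine h.adj_trans (d := d) ?_ hdd hne
    rw [h.inv, hd]
    exact inv_eq_of_mul_eq_one_left (h.sq k)
  obtain ⟨l, hl, hlw⟩ := exists_word h.words w'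
  -- The two copies agree along each prefix of a reduced word of `w'`. At a first disagreement,
  -- measure from the chamber of the first copy along the tail in the second copy, then step to
  -- `d''`. The disagreeing letter cancels, leaving for `w' * s k` a word no longer than that of
  -- `w'`, against `hlt`.
  have hred : ∀ l1 l2, l = l1 ++ l2 → φ (l1.map s).prod = ψ (l1.map s).prod := by
    intro l1
    induction l1 using List.reverseRecOn with
    | nil => intro l2 _; simp [hφ1, hψ1]
    | append_singleton l1 j ih =>
      intro l2 hl2
      have ih' := ih (j :: l2) (by rw [hl2]; simp)
      by_contra hne'
      set u := (l1.map s).prod with hu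
      have hus : ((l1 ++ [j]).map s).prod = u * s j := by simp [hu]
      rw [hus] at hne'
      have h3 : δ (φ (u * s j)) (ψ (u * s j)) = s j := by
        refine h.adj_trans (d := φ u) ?_ ?_ hne'
        · rw [hφ]; simp [inv_eq_of_mul_eq_one_left (h.sq j)]
        · rw [ih', hψ]; simp
      obtain ⟨l', hl', he'⟩ := h.exists_subword (φ (u * s j)) l2 (ψ (u * s j)) d' ψ hψ
        (u * s j) rfl (by rw [← hψw, ← hlw, hl2]; simp [hu, mul_assoc])
      rw [h3] at he'
      have hfin : ∃ l'' : List κ, l''.length ≤ l2.length + 1 ∧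
          δ (φ (u * s j)) d'' = s j * (l''.map s).prod := by
        rcases h.adj (φ (u * s j)) d' d'' k hdd' with h5 | h5
        · exact ⟨l', by omega, by rw [h5, he']⟩
        · exact ⟨l' ++ [k], by simp; omega, by rw [h5, he']; simp [mul_assoc]⟩
      obtain ⟨l'', hl'', he''⟩ := hfin
      rw [hd'', hφ] at he''
      have h6 : w' * s k = u * (l''.map s).prod := by
        have : w' * s k = (u * s j) * ((u * s j)⁻¹ * (w' * s k)) := by group
        rw [this, he'', mul_assoc, ← mul_assoc (s j), h.sq, one_mul]
      have h7 := wlen_prod_le (s := s) (l1 ++ l'')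
      rw [List.map_append, List.prod_append, ← hu, ← h6] at h7
      have h8 : l.length = l1.length + 1 + l2.length := by rw [hl2]; simp; omega
      simp at h7
      omega
  have h9 := hred l [] (by simp)
  rw [hlw, hφw, hψw] at h9
  rw [h9, (h.eq_one_iff d' d').2 rfl] at hd
  exact hsk hd.symm

/-- Chambers of a panel which are nearest to a given chamber coincide. -/
theorem IsWeylDist.eq_of_adj (h : IsWeylDist s δ) {c d d' : C} {k : κ}
    (hd : δ d d' = s k) (hlt : wlen s (δ c d) < wlen s (δ c d * s k)) (he : δ c d = δ c d') :
    False := by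
  have h1 := h.mul_of_lt hd hlt
  rw [← he] at h1
  rw [← h1] at hlt
  exact lt_irrefl _ hlt

end WeylDistance

/-! ### Sectors and convex sets in the model space -/

section Sectors

variable {F : Subfield ℝ} {ι M N Λ : Type*} [Fintype ι] [AddCommGroup M] [Module F M]
  [AddCommGroup N] [Module F N] {P : RootPairing ι F M N} [P.IsRootSystem] {B : Set ι}
  [AddCommGroup Λ] [LinearOrder Λ] [IsOrderedAddMonoid Λ] [Module F Λ] [PosSMulMono F Λ]

theorem IsBasis.exists_large (hB : IsBasis P B) (K : Λ) :
    ∃ v ∈ (fundChamber P B : Set (ModelSpace F M Λ)), ∀ i, IsPos P B i → K ≤ coev P i v := by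
  obtain ⟨ρ, hρ⟩ := hB.exists_regular (Λ := F)
  obtain ⟨e, he, h⟩ := exists_pos_forall_le (Finset.univ.filter (IsPos P B))
    (fun i => coev P i ρ) fun i hi => hB.coev_pos_of_simple hρ (Finset.mem_filter.1 hi).2
  have key : ∀ i, IsPos P B i → |K| ≤ coev P i (scale (e⁻¹ • |K|) ρ) := fun i hi => by
    rw [coev_scale, smul_smul]
    have h1 : 1 ≤ coev P i ρ * e⁻¹ := by
      rw [← div_eq_mul_inv, le_div_iff₀ he, one_mul]; exact h i (by simp [hi])
    simpa using smul_le_smul_of_nonneg h1 (abs_nonneg K)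
  exact ⟨scale (e⁻¹ • |K|) ρ, fun i hi => (abs_nonneg K).trans (key i hi),
    fun i hi => (le_abs_self K).trans (key i hi)⟩

theorem IsBasis.exists_add_mem (hB : IsBasis P B) (u : ModelSpace F M Λ) :
    ∃ a ∈ (fundChamber P B : Set (ModelSpace F M Λ)), a + u ∈ fundChamber P B := by
  obtain ⟨a, ha, h⟩ := hB.exists_large (nrm P B u)
  refine ⟨a, ha, fun i hi => ?_⟩
  rw [map_add]
  have h1 := h i hi
  exact neg_le_iff_add_nonneg.1 ((neg_le_abs _).trans ((hB.abs_coev_le_nrm i u).trans h1))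

theorem IsBasis.eq_one_of_isPos (hB : IsBasis P B) {w : weylGroup P}
    (h : ∀ i, IsPos P B i → IsPos P B (wperm w i)) : w = 1 := by
  by_contra hw
  obtain ⟨b, hb⟩ := exists_wlen_mul_lt hB.exists_list simpleReflection_mul_self hw
  exact hB.not_isPos_of_wlen_lt hb (h b (hB.isPos_simple b))

/-- A sector inside the fundamental chamber is parallel to it: a positive root made negative by
`w⁻¹` would be unbounded below on the sector. -/
theorem IsBasis.eq_one_of_act_add_mem [Nontrivial Λ] (hB : IsBasis P B) {w : weylGroup P}
    {c : ModelSpace F M Λ} (h : ∀ v ∈ fundChamber P B, act w.1 v + c ∈ fundChamber P B) :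
    w = 1 := by
  rw [← inv_eq_one]
  refine hB.eq_one_of_isPos fun i hi => ?_
  by_contra hn
  obtain ⟨e, he⟩ := exists_zero_lt (α := Λ)
  obtain ⟨v, hv, hl⟩ := hB.exists_large (coev P i c + e)
  have h1 := h v hv i hi
  have h2 := hl _ ((hB.isPos_nidx_iff _).2 hn)
  rw [coev_nidx] at h2
  rw [map_add, coev_act'] at h1
  have h3 := add_le_add h1 h2
  have h4 : coev P (wperm w⁻¹ i) v + coev P i c + -coev P (wperm w⁻¹ i) v = coev P i c := by abel
  rw [h4, zero_add] at h3
  exact absurd h3 (not_le.2 (lt_add_of_pos_right _ he))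

theorem IsBasis.eq_of_act_add_eq [Nontrivial Λ] (hB : IsBasis P B) {w w' : weylGroup P}
    {c c' : ModelSpace F M Λ}
    (h : ∀ v ∈ fundChamber P B, act w.1 v + c = act w'.1 v + c') : w = w' ∧ c = c' := by
  have hc : c = c' := by simpa using h 0 zero_mem_fundChamber
  obtain ⟨v, hv⟩ := hB.exists_regular (Λ := Λ)
  refine ⟨hB.act_injective hv ?_, hc⟩
  have := h v (hB.mem_fundChamber_iff.2 fun b => (hv b).le)
  rw [hc] at this
  exact add_right_cancel this

/-- Convex sets are given by lower bounds on coroots, so it suffices to have, for each root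
separately, a point of the set with a smaller value. -/
theorem IsWTConvex.mem_of_le {T : AddSubgroup (ModelSpace F M Λ)} {Y : Set (ModelSpace F M Λ)}
    (hY : IsWTConvex P T Y) {z : ModelSpace F M Λ}
    (h : ∀ i, ∃ y ∈ Y, coev P i y ≤ coev P i z) : z ∈ Y := by
  obtain ⟨s, -, rfl⟩ := hY
  simp only [Set.mem_iInter]
  intro p hp
  obtain ⟨y, hy, hyz⟩ := h p.1
  simp only [Set.mem_iInter] at hy
  exact le_trans (hy p hp) hyz

/-- A convex set which contains a point and a sector contains the parallel sector based at the
point. -/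
theorem IsWTConvex.add_mem {T : AddSubgroup (ModelSpace F M Λ)} {Y : Set (ModelSpace F M Λ)}
    (hY : IsWTConvex P T Y) (hB : IsBasis P B) {p t : ModelSpace F M Λ} (hp : p ∈ Y)
    (ht : ∀ v ∈ fundChamber P B, t + v ∈ Y) {v : ModelSpace F M Λ} (hv : v ∈ fundChamber P B) :
    p + v ∈ Y := by
  refine hY.mem_of_le fun i => ?_
  by_cases hi : IsPos P B i
  · exact ⟨p, hp, by rw [map_add]; exact le_add_of_nonneg_right (hv i hi)⟩
  · obtain ⟨a, ha, hl⟩ := hB.exists_large (coev P i (t - (p + v)))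
    refine ⟨t + a, ht a ha, ?_⟩
    have := hl _ ((hB.isPos_nidx_iff i).2 hi)
    rw [coev_nidx, map_sub] at this
    rw [map_add]
    have h3 := sub_le_iff_le_add.1 this
    have := add_le_add_left h3 (coev P i a)
    have h4 : -coev P i a + coev P i (p + v) + coev P i a = coev P i (p + v) := by abel
    rwa [h4] at this

end Sectors

/-! ### Changes of charts and the metric on the building -/

section Building

variable {F : Subfield ℝ} {ι M N Λ X : Type*} [Fintype ι] [AddCommGroup M] [Module F M]
  [AddCommGroup N] [Module F N] {P : RootPairing ι F M N} [P.IsRootSystem] {B : Set ι}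
  [AddCommGroup Λ] [LinearOrder Λ] [IsOrderedAddMonoid Λ] [Module F Λ] [PosSMulMono F Λ]
  {T : AddSubgroup (ModelSpace F M Λ)} {A : Set (ModelSpace F M Λ → X)}

namespace IsAffineBuilding

theorem comp_act_mem (hA : IsAffineBuilding P B T A) {f : ModelSpace F M Λ → X} (hf : f ∈ A)
    (w : weylGroup P) : f ∘ act w.1 ∈ A :=
  hA.a1 f hf _ ⟨w.1, w.2, 0, zero_mem _, by ext; simp⟩

/-- The change of charts. -/
theorem exists_transition (hA : IsAffineBuilding P B T A) {f g : ModelSpace F M Λ → X}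
    (hf : f ∈ A) (hg : g ∈ A) (h : (Set.range f ∩ Set.range g).Nonempty) :
    ∃ w : weylGroup P, ∃ t, ∀ v, f v ∈ Set.range g → f v = g (act w.1 v + t) := by
  obtain ⟨-, k, ⟨w, hw, t, -, rfl⟩, hk⟩ := hA.a2 f hf g hg h
  exact ⟨⟨w, hw⟩, t, fun v hv => hk hv⟩

theorem convex (hA : IsAffineBuilding P B T A) {f g : ModelSpace F M Λ → X}
    (hf : f ∈ A) (hg : g ∈ A) {v : ModelSpace F M Λ} (h : f v ∈ Set.range g) :
    IsWTConvex P T (f ⁻¹' Set.range g) :=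
  (hA.a2 f hf g hg ⟨f v, ⟨v, rfl⟩, h⟩).1

/-- Changes of charts are compositions of Weyl group elements and translations, which preserve the
norm, so the choice in `chartDist` is harmless. -/
theorem chartDist_eq (hA : IsAffineBuilding P B T A) (hB : IsBasis P B)
    {f : ModelSpace F M Λ → X} (hf : f ∈ A) (p q : ModelSpace F M Λ) :
    chartDist P B A (f p) (f q) = nrm P B (q - p) := by
  have h : ∃ z : ModelSpace F M Λ × ModelSpace F M Λ, ∃ g ∈ A, g z.1 = f p ∧ g z.2 = f q :=
    ⟨(p, q), f, hf, rfl, rfl⟩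
  rw [chartDist, dif_pos h, modelDist_eq]
  obtain ⟨g, hg, h1, h2⟩ := h.choose_spec
  set z := h.choose
  obtain ⟨w, t, hw⟩ := hA.exists_transition hf hg ⟨f p, ⟨p, rfl⟩, ⟨_, h1⟩⟩
  have e1 := hA.injective g hg (h1.trans (hw p ⟨_, h1⟩))
  have e2 := hA.injective g hg (h2.trans (hw q ⟨_, h2⟩))
  rw [e1, e2, add_sub_add_right_eq_sub, ← map_sub, hB.nrm_act]

theorem chartDist_comm (hA : IsAffineBuilding P B T A) (hB : IsBasis P B) (x y : X) :
    chartDist P B A x y = chartDist P B A y x := by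
  obtain ⟨f, hf, ⟨p, rfl⟩, ⟨q, rfl⟩⟩ := hA.a3 x y
  rw [hA.chartDist_eq hB hf, hA.chartDist_eq hB hf, nrm_sub_comm]

/-- Retract the middle point by (A5) onto an apartment containing the other two; there the
inequality is that of the norm. -/
theorem chartDist_triangle (hA : IsAffineBuilding P B T A) (hB : IsBasis P B) (x y z : X) :
    chartDist P B A x z ≤ chartDist P B A x y + chartDist P B A y z := by
  obtain ⟨f, hf, ⟨p, rfl⟩, ⟨q, rfl⟩⟩ := hA.a3 x z
  obtain ⟨r, h1, h2, h3, -⟩ := hA.a5 f hf (f p) ⟨p, rfl⟩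
  obtain ⟨m, hm⟩ := h1 y
  have e1 := h3 (f p) y
  have e2 := h3 y (f q)
  rw [h2 _ ⟨p, rfl⟩, ← hm, hA.chartDist_eq hB hf] at e1
  rw [h2 _ ⟨q, rfl⟩, ← hm, hA.chartDist_eq hB hf] at e2
  rw [hA.chartDist_eq hB hf]
  refine le_trans ?_ (add_le_add e1 e2)
  have : q - p = m - p + (q - m) := by abel
  rw [this]
  exact nrm_add_le _ _

end IsAffineBuilding

/-! ### Chambers at infinity -/

/-- The images of the fundamental chamber under the charts `f` and `g` contain a common sector. -/
def Asym (P : RootPairing ι F M N) (B : Set ι) (f g : ModelSpace F M Λ → X) : Prop :=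
  ∃ t τ, ∀ v ∈ fundChamber P B, f (t + v) = g (t + τ + v)

theorem Asym.refl (f : ModelSpace F M Λ → X) : Asym P B f f := ⟨0, 0, fun v _ => by simp⟩

theorem Asym.symm {f g : ModelSpace F M Λ → X} (h : Asym P B f g) : Asym P B g f := by
  obtain ⟨t, τ, h⟩ := h
  exact ⟨t + τ, -τ, fun v hv => by rw [← h v hv]; congr 1; abel⟩

theorem Asym.trans (hB : IsBasis P B) {f g h : ModelSpace F M Λ → X} (h1 : Asym P B f g)
    (h2 : Asym P B g h) : Asym P B f h := by
  obtain ⟨t, τ, h1⟩ := h1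
  obtain ⟨s, σ, h2⟩ := h2
  obtain ⟨a, ha, ha'⟩ := hB.exists_add_mem (t + τ - s)
  refine ⟨t + a, τ + σ, fun v hv => ?_⟩
  have e1 := h1 (a + v) (add_mem_fundChamber ha hv)
  have e2 := h2 (a + (t + τ - s) + v) (add_mem_fundChamber ha' hv)
  rw [← add_assoc] at e1
  have e3 : t + τ + (a + v) = s + (a + (t + τ - s) + v) := by abel
  rw [e1, e3, e2]
  congr 1; abel

namespace IsAffineBuilding

theorem asym_bounded (hA : IsAffineBuilding P B T A) (hB : IsBasis P B)
    {f g : ModelSpace F M Λ → X} (hf : f ∈ A) (hg : g ∈ A) (h : Asym P B f g) :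
    ∃ K, ∀ v ∈ fundChamber P B, chartDist P B A (f v) (g v) ≤ K := by
  obtain ⟨t, τ, h⟩ := h
  refine ⟨nrm P B t + nrm P B (t + τ), fun v hv => ?_⟩
  refine (hA.chartDist_triangle hB _ (f (t + v)) _).trans (add_le_add ?_ ?_)
  · rw [hA.chartDist_eq hB hf, add_sub_cancel_right]
  · rw [h v hv, hA.chartDist_eq hB hg, ← nrm_neg]
    exact le_of_eq (congrArg _ (by abel))

/-- On the shared sector the change of charts is a translation, and a sector contains regular
vectors, so the linear part is trivial wherever the charts overlap. -/
theorem asym_transition [Nontrivial Λ] (hA : IsAffineBuilding P B T A) (hB : IsBasis P B)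
    {f g : ModelSpace F M Λ → X} (hf : f ∈ A) (hg : g ∈ A) (h : Asym P B f g) :
    ∃ κ, ∀ v, f v ∈ Set.range g → f v = g (v + κ) := by
  obtain ⟨t, τ, h⟩ := h
  have h0 := h 0 zero_mem_fundChamber
  obtain ⟨w, κ, hw⟩ := hA.exists_transition hf hg ⟨f (t + 0), ⟨_, rfl⟩, ⟨_, h0.symm⟩⟩
  have key := hB.eq_of_act_add_eq (w := w) (w' := 1) (c := act w.1 t + κ) (c' := t + τ)
    fun v hv => by
      have e1 := (hw (t + v) ⟨_, (h v hv).symm⟩).symm.trans (h v hv)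
      have e2 := hA.injective g hg e1
      rw [map_add] at e2
      rw [Subgroup.coe_one, act_one, add_comm v, ← e2]
      abel
  refine ⟨κ, fun v hv => ?_⟩
  rw [hw v hv, key.1, Subgroup.coe_one, act_one]

/-- The smaller chambers supplied by (A4) may be parametrized by unrelated charts; being contained
in the given sector, they are nevertheless parallel to it and define the same chamber at infinity.
-/
theorem asym_of_subsector [Nontrivial Λ] (hA : IsAffineBuilding P B T A) (hB : IsBasis P B)
    {f h : ModelSpace F M Λ → X} (hf : f ∈ A) (hh : h ∈ A) {S : Set X}
    (hS : IsWeylChamber P B A S) (hSf : S ⊆ f '' fundChamber P B) (hSh : S ⊆ Set.range h) :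
    ∃ w : weylGroup P, Asym P B f (h ∘ act w.1) := by
  obtain ⟨f1, hf1, -, ⟨w1, hw1, t1, -, rfl⟩, rfl⟩ := hS
  have hmem : ∀ v ∈ fundChamber P B, f1 (act w1 v + t1) ∈
      f1 '' ((fun v => act w1 v + t1) '' fundChamber P B) := fun v hv => ⟨_, ⟨v, hv, rfl⟩, rfl⟩
  have h0 : f1 (act w1 0 + t1) ∈ f '' fundChamber P B := hSf (hmem 0 zero_mem_fundChamber)
  obtain ⟨a, α, ha⟩ := hA.exists_transition hf1 hf ⟨_, ⟨_, rfl⟩, Set.image_subset_range _ _ h0⟩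
  have key : ∀ v ∈ fundChamber P B, act (a * ⟨w1, hw1⟩).1 v + (act a.1 t1 + α) ∈
      fundChamber P B ∧ f (act (a * ⟨w1, hw1⟩).1 v + (act a.1 t1 + α)) = f1 (act w1 v + t1) := by
    intro v hv
    obtain ⟨u, hu, hu'⟩ := hSf (hmem v hv)
    have e1 := ha _ (Set.image_subset_range _ _ (hSf (hmem v hv)))
    have e2 : act a.1 (act w1 v + t1) + α = act (a * ⟨w1, hw1⟩).1 v + (act a.1 t1 + α) := by
      rw [Subgroup.coe_mul, act_mul, map_add]; abel
    rw [e2] at e1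
    refine ⟨?_, e1.symm⟩
    rw [← hA.injective f hf (hu'.trans e1)]
    exact hu
  have h1 := hB.eq_one_of_act_add_mem fun v hv => (key v hv).1
  rw [h1] at key
  simp only [Subgroup.coe_one, act_one] at key
  set c := act a.1 t1 + α
  clear_value c
  have hc : ∀ v ∈ fundChamber P B, f (v + c) ∈ Set.range h := fun v hv => by
    rw [(key v hv).2]; exact hSh (hmem v hv)
  obtain ⟨b, β, hb⟩ := hA.exists_transition hf hh ⟨_, ⟨_, rfl⟩, hc 0 zero_mem_fundChamber⟩
  refine ⟨b, c, act b⁻¹.1 β, fun v hv => ?_⟩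
  have e : act b.1 (c + act b⁻¹.1 β + v) = act b.1 (v + c) + β := by
    rw [map_add, map_add, act_act_inv, map_add]; abel
  rw [add_comm c v, hb _ (hc v hv), Function.comp_apply, e]

theorem exists_common [Nontrivial Λ] (hA : IsAffineBuilding P B T A) (hB : IsBasis P B)
    {f g : ModelSpace F M Λ → X} (hf : f ∈ A) (hg : g ∈ A) :
    ∃ h ∈ A, ∃ w : weylGroup P, Asym P B f h ∧ Asym P B g (h ∘ act w.1) := by
  have hch : ∀ f ∈ A, IsWeylChamber P B A (f '' fundChamber P B) := fun f hf =>
    ⟨f, hf, id, ⟨1, one_mem _, 0, trivial, by ext v; simp [act_one]⟩, by simp⟩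
  obtain ⟨S1, S2, hS1, hS2, h1, h2, h, hh, hu⟩ := hA.a4 _ _ (hch f hf) (hch g hg)
  obtain ⟨w1, a1⟩ := hA.asym_of_subsector hB hf hh hS1 h1 (Set.subset_union_left.trans hu)
  obtain ⟨w2, a2⟩ := hA.asym_of_subsector hB hg hh hS2 h2 (Set.subset_union_right.trans hu)
  refine ⟨h ∘ act w1.1, hA.comp_act_mem hh w1, w1⁻¹ * w2, a1, ?_⟩
  have : (h ∘ act w1.1) ∘ act (w1⁻¹ * w2).1 = h ∘ act w2.1 := by
    ext v
    simp only [Function.comp_apply]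
    rw [← act_mul, ← Subgroup.coe_mul, mul_inv_cancel_left]
  rwa [this]

/-- This makes the Weyl distance at infinity independent of the apartment used to measure it. -/
theorem asym_unique [Nontrivial Λ] (hA : IsAffineBuilding P B T A) (hB : IsBasis P B)
    {h h' : ModelSpace F M Λ → X} (hh : h ∈ A) (hh' : h' ∈ A)
    {w w' : weylGroup P} (h1 : Asym P B h h')
    (h2 : Asym P B (h ∘ act w.1) (h' ∘ act w'.1)) : w = w' := by
  obtain ⟨κ, hκ⟩ := hA.asym_transition hB hh hh' h1
  obtain ⟨t, τ, ht⟩ := h2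
  refine (hB.eq_of_act_add_eq (c := act w.1 t + κ) (c' := act w'.1 (t + τ)) fun v hv => ?_).1
  have e1 := ht v hv
  simp only [Function.comp_apply] at e1
  rw [hκ _ ⟨_, e1.symm⟩] at e1
  have e2 := hA.injective h' hh' e1
  rw [map_add, map_add] at e2
  rw [add_comm (act w'.1 v), ← e2]
  abel

end IsAffineBuilding

/-- Charts up to asymptoticity. -/
def asymSetoid (hB : IsBasis P B) (A : Set (ModelSpace F M Λ → X)) : Setoid A where
  r f g := Asym P B f.1 g.1
  iseqv := ⟨fun f => Asym.refl f.1, fun h => h.symm, fun h h' => h.trans hB h'⟩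

/-- The chambers at infinity. -/
abbrev ChInf (hB : IsBasis P B) (A : Set (ModelSpace F M Λ → X)) := Quotient (asymSetoid hB A)

/-- The Weyl distance of the chambers at infinity determined by two charts. -/
def wd (P : RootPairing ι F M N) (B : Set ι) (A : Set (ModelSpace F M Λ → X))
    (f g : ModelSpace F M Λ → X) : weylGroup P :=
  if h : ∃ w : weylGroup P, ∃ k ∈ A, Asym P B f k ∧ Asym P B g (k ∘ act w.1) then h.choose else 1

/-- The Weyl distance of two chambers at infinity. -/
def wdist (hB : IsBasis P B) (A : Set (ModelSpace F M Λ → X)) (c d : ChInf hB A) : weylGroup P :=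
  wd P B A c.out.1 d.out.1

namespace IsAffineBuilding

theorem wd_eq [Nontrivial Λ] (hA : IsAffineBuilding P B T A) (hB : IsBasis P B)
    {f g k : ModelSpace F M Λ → X} (hk : k ∈ A) {w : weylGroup P} (h1 : Asym P B f k)
    (h2 : Asym P B g (k ∘ act w.1)) : wd P B A f g = w := by
  have h : ∃ w : weylGroup P, ∃ k ∈ A, Asym P B f k ∧ Asym P B g (k ∘ act w.1) :=
    ⟨w, k, hk, h1, h2⟩
  rw [wd, dif_pos h]
  obtain ⟨k', hk', h1', h2'⟩ := h.choose_spec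
  exact hA.asym_unique hB hk' hk (h1'.symm.trans hB h1) (h2'.symm.trans hB h2)

theorem wdist_mk [Nontrivial Λ] (hA : IsAffineBuilding P B T A) (hB : IsBasis P B)
    (f g : A) {k : ModelSpace F M Λ → X} (hk : k ∈ A) {w : weylGroup P}
    (h1 : Asym P B f.1 k) (h2 : Asym P B g.1 (k ∘ act w.1)) :
    wdist hB A (Quotient.mk _ f) (Quotient.mk _ g) = w :=
  hA.wd_eq hB hk (Asym.trans hB (Quotient.mk_out (s := asymSetoid hB A) f) h1)
    (Asym.trans hB (Quotient.mk_out (s := asymSetoid hB A) g) h2)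

theorem exists_of_wdist [Nontrivial Λ] (hA : IsAffineBuilding P B T A) (hB : IsBasis P B)
    (f g : A) {w : weylGroup P} (h : wdist hB A (Quotient.mk _ f) (Quotient.mk _ g) = w) :
    ∃ k ∈ A, Asym P B f.1 k ∧ Asym P B g.1 (k ∘ act w.1) := by
  obtain ⟨k, hk, w', h1, h2⟩ := hA.exists_common hB f.2 g.2
  rw [hA.wdist_mk hB f g hk h1 h2] at h
  subst h
  exact ⟨k, hk, h1, h2⟩

/-- The isometric copies of the Weyl group come from (A4). The substance is `adj`: charts through
`e` and `d`, and through `e` and `d'`, stay at bounded distance on the sector of `e` and along the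
common panel of `d` and `d'`. Comparing norms in both charts then restricts the two Weyl elements.
-/
theorem isWeylDist [Nontrivial Λ] (hA : IsAffineBuilding P B T A) (hB : IsBasis P B) :
    IsWeylDist (simpleReflection P B) (wdist hB A) where
  words := hB.exists_list
  sq := simpleReflection_mul_self
  eq_one_iff c d := by
    induction c using Quotient.inductionOn with | _ f
    induction d using Quotient.inductionOn with | _ g
    have h1 : ∀ k : ModelSpace F M Λ → X, k ∘ act (1 : weylGroup P).1 = k := fun k => by
      ext v; simp [act_one]
    constructor
    · intro h
      obtain ⟨k, -, a1, a2⟩ := hA.exists_of_wdist hB f g h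
      rw [h1] at a2
      exact Quotient.sound (a1.trans hB a2.symm)
    · intro h
      refine hA.wdist_mk hB f g f.2 (Asym.refl _) ?_
      rw [h1]
      exact (Quotient.exact h).symm
  chart c d := by
    induction c using Quotient.inductionOn with | _ f
    induction d using Quotient.inductionOn with | _ g
    obtain ⟨k, hk, w, a1, a2⟩ := hA.exists_common hB f.2 g.2
    refine ⟨fun w => Quotient.mk _ ⟨k ∘ act w.1, hA.comp_act_mem hk w⟩, ?_, ⟨w, ?_⟩, ?_⟩
    · refine Quotient.sound ?_
      have : k ∘ act (1 : weylGroup P).1 = k := by ext v; simp [act_one]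
      change Asym P B (k ∘ act (1 : weylGroup P).1) f.1
      rw [this]
      exact a1.symm
    · exact Quotient.sound a2.symm
    · intro u v
      refine hA.wdist_mk hB _ _ (hA.comp_act_mem hk u) (Asym.refl _) ?_
      have : (k ∘ act u.1) ∘ act (u⁻¹ * v).1 = k ∘ act v.1 := by
        ext z
        simp only [Function.comp_apply]
        rw [← act_mul, ← Subgroup.coe_mul, mul_inv_cancel_left]
      rw [this]
      exact Asym.refl _
  adj e d d' b hb := by
    induction e using Quotient.inductionOn with | _ e
    induction d using Quotient.inductionOn with | _ d
    induction d' using Quotient.inductionOn with | _ d'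
    obtain ⟨k, hk, k1, k2⟩ := hA.exists_of_wdist hB d d' hb
    obtain ⟨h, hh, h1, h2⟩ := hA.exists_of_wdist hB e d rfl
    obtain ⟨h', hh', h1', h2'⟩ := hA.exists_of_wdist hB e d' rfl
    set w := wdist hB A (Quotient.mk _ e) (Quotient.mk _ d)
    set w' := wdist hB A (Quotient.mk _ e) (Quotient.mk _ d')
    obtain ⟨K1, K1h⟩ := hA.asym_bounded hB d.2 hk k1
    obtain ⟨K2, K2h⟩ := hA.asym_bounded hB d'.2 (hA.comp_act_mem hk _) k2
    obtain ⟨K3, K3h⟩ := hA.asym_bounded hB e.2 hh h1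
    obtain ⟨K4, K4h⟩ := hA.asym_bounded hB d.2 (hA.comp_act_mem hh _) h2
    obtain ⟨K5, K5h⟩ := hA.asym_bounded hB e.2 hh' h1'
    obtain ⟨K6, K6h⟩ := hA.asym_bounded hB d'.2 (hA.comp_act_mem hh' _) h2'
    have tri := hA.chartDist_triangle hB
    have com := hA.chartDist_comm hB
    -- Along the panel one passes from `h` through `d`, `k` and `d'` to `h'`; the reflection in `b`
    -- fixes panel vectors, so the two chambers of `k` match there.
    have E1 : ∀ v ∈ fundChamber P B, coev P b v = 0 →
        chartDist P B A (h (act w.1 v)) (h' (act w'.1 v)) ≤ K4 + (K1 + (K2 + K6)) := by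
      intro v hv hbv
      have e1 := K4h v hv
      have e2 := K1h v hv
      have e3 := K2h v hv
      have e4 := K6h v hv
      simp only [Function.comp_apply] at e1 e3 e4
      rw [show act (simpleReflection P B b).1 v = v from act_reflection_of_eq_zero hbv] at e3
      rw [com] at e1 e3
      exact (tri _ _ _).trans (add_le_add e1 ((tri _ _ _).trans
        (add_le_add e2 ((tri _ _ _).trans (add_le_add e3 e4)))))
    have E2 : ∀ v ∈ fundChamber P B, chartDist P B A (h v) (h' v) ≤ K3 + K5 := by
      intro v hv
      have e1 := K3h v hv
      have e2 := K5h v hv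
      rw [com] at e1
      exact (tri _ _ _).trans (add_le_add e1 e2)
    refine hB.eq_or_eq_mul_of_nrm_le b w w' (K4 + (K1 + (K2 + K6)) + (K3 + K5))
      fun v hv hbv y hy => ?_
    rw [← hA.chartDist_eq hB hh, ← hA.chartDist_eq hB hh']
    have e1 := E1 v hv hbv
    have e2 := E2 y hy
    constructor
    · have e3 : chartDist P B A (h' (act w'.1 v)) (h y) ≤
          chartDist P B A (h' (act w'.1 v)) (h' y) + (K3 + K5) :=
        (tri _ (h' y) _).trans (add_le_add_right (by rw [com]; exact e2) _)
      refine ((tri _ _ _).trans (add_le_add e1 e3)).trans (le_of_eq (by abel))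
    · have e3 : chartDist P B A (h (act w.1 v)) (h' y) ≤
          chartDist P B A (h (act w.1 v)) (h y) + (K3 + K5) :=
        (tri _ (h y) _).trans (add_le_add_right e2 _)
      rw [com] at e1
      refine ((tri _ _ _).trans (add_le_add e1 e3)).trans (le_of_eq (by abel))

end IsAffineBuilding

end Building

/-! ### Exchange of apartments and finite covers -/

section Building

variable {F : Subfield ℝ} {ι M N Λ X : Type*} [Fintype ι] [AddCommGroup M] [Module F M]
  [AddCommGroup N] [Module F N] {P : RootPairing ι F M N} [P.IsRootSystem] {B : Set ι}
  [AddCommGroup Λ] [LinearOrder Λ] [IsOrderedAddMonoid Λ] [Module F Λ] [PosSMulMono F Λ]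
  {T : AddSubgroup (ModelSpace F M Λ)} {A : Set (ModelSpace F M Λ → X)}

theorem comp_act_mul (f : ModelSpace F M Λ → X) (w w' : weylGroup P) :
    (f ∘ act w.1) ∘ act w'.1 = f ∘ act (w * w').1 := by
  ext v
  simp only [Function.comp_apply]
  rw [← act_mul, ← Subgroup.coe_mul]

theorem comp_act_one (f : ModelSpace F M Λ → X) : f ∘ act (1 : weylGroup P).1 = f := by
  ext v
  simp [act_one]

theorem range_comp_act (f : ModelSpace F M Λ → X) (w : weylGroup P) :
    Set.range (f ∘ act w.1) = Set.range f :=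
  (act w.1).surjective.range_comp f

namespace IsAffineBuilding

theorem wdist_comp_act [Nontrivial Λ] (hA : IsAffineBuilding P B T A) (hB : IsBasis P B)
    {f : ModelSpace F M Λ → X} (hf : f ∈ A) (g g' : A) {w w' : weylGroup P}
    (h1 : Asym P B g.1 (f ∘ act w.1)) (h2 : Asym P B g'.1 (f ∘ act w'.1)) :
    wdist hB A (Quotient.mk _ g) (Quotient.mk _ g') = w⁻¹ * w' := by
  refine hA.wdist_mk hB g g' (hA.comp_act_mem hf w) h1 ?_
  rwa [comp_act_mul, mul_inv_cancel_left]

/-- The chamber of `g` in direction `s * w₀` is at distance `w₀⁻¹ * s` from `g`, and crossing the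
`b`-panel lengthens this to `w₀⁻¹`. So it is opposite to `f`, and an apartment through this opposite
pair is the desired one. -/
theorem exists_opposite_extension [Nontrivial Λ] (hA : IsAffineBuilding P B T A)
    (hB : IsBasis P B) {w₀ : weylGroup P} (hw₀ : ∀ i, IsPos P B (wperm w₀ i) ↔ ¬IsPos P B i)
    (b : B) (g f : A)
    (hgf : wdist hB A (Quotient.mk _ g) (Quotient.mk _ f) = simpleReflection P B b) :
    ∃ p ∈ A, Asym P B g.1 p ∧
      Asym P B (g.1 ∘ act (simpleReflection P B b * w₀).1)
        (p ∘ act (simpleReflection P B b * w₀).1) ∧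
      Asym P B f.1 (p ∘ act (simpleReflection P B b).1) := by
  have hδ := hA.isWeylDist hB
  set s := simpleReflection P B b with hs
  have hss : s * s = 1 := simpleReflection_mul_self b
  let g' : A := ⟨g.1 ∘ act (s * w₀).1, hA.comp_act_mem g.2 _⟩
  have d1 : wdist hB A (Quotient.mk _ g') (Quotient.mk _ g) = w₀⁻¹ * s := by
    rw [hA.wdist_comp_act hB (f := g.1) g.2 g' g (w := s * w₀) (w' := 1) (Asym.refl _)
      (by rw [comp_act_one]; exact Asym.refl _), mul_one, mul_inv_rev, hs, simpleReflection_inv]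
  have hlt : wlen (simpleReflection P B) (w₀⁻¹ * s) <
      wlen (simpleReflection P B) (w₀⁻¹ * s * s) := by
    rw [mul_assoc, hss, mul_one]
    exact hB.wlen_mul_lt (by rw [isPos_wperm_inv_iff hw₀, not_not]; exact hB.isPos_simple b)
  have d2 := hδ.mul_of_lt hgf (by rw [d1]; exact hlt)
  rw [d1, mul_assoc, hss, mul_one] at d2
  obtain ⟨k, hk, k1, k2⟩ := hA.exists_of_wdist hB g' f d2
  let p : A := ⟨k ∘ act (w₀⁻¹ * s).1, hA.comp_act_mem hk _⟩
  have ep1 : p.1 ∘ act (s * w₀).1 = k := by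
    have : w₀⁻¹ * s * (s * w₀) = 1 := by
      rw [mul_assoc, ← mul_assoc s, hss, one_mul, inv_mul_cancel]
    rw [comp_act_mul, this, comp_act_one]
  have ep2 : p.1 ∘ act s.1 = k ∘ act w₀⁻¹.1 := by
    rw [comp_act_mul, mul_assoc, hss, mul_one]
  refine ⟨p.1, p.2, ?_, by rw [ep1]; exact k1, by rw [ep2]; exact k2⟩
  have d3 : wdist hB A (Quotient.mk _ f) (Quotient.mk _ p) = s := by
    rw [hA.wdist_comp_act hB (f := p.1) p.2 f p (w := s) (w' := 1) (by rw [ep2]; exact k2)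
      (by rw [comp_act_one]; exact Asym.refl _), mul_one, hs, simpleReflection_inv]
  have d4 : wdist hB A (Quotient.mk _ g') (Quotient.mk _ p) = w₀⁻¹ * s :=
    hA.wdist_mk hB g' p hk k1 (Asym.refl _)
  -- If `p` and `g` differed they would be two chambers of one panel, both nearest to `g'`.
  by_contra hne
  have hne' : (Quotient.mk _ g : ChInf hB A) ≠ Quotient.mk _ p := fun h => hne (Quotient.exact h)
  have d5 := hδ.adj_trans hgf d3 hne'
  exact hδ.eq_of_adj d5 (by rw [d1]; exact hlt) (d1.trans d4.symm)

/-- Two apartments sharing the chambers at infinity of a half-apartment, but not all, meet in a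
half-apartment. -/
theorem exists_preimage_eq_halfApartment [Nontrivial Λ] (hA : IsAffineBuilding P B T A)
    (hB : IsBasis P B) {w₀ : weylGroup P} (hw₀ : ∀ i, IsPos P B (wperm w₀ i) ↔ ¬IsPos P B i)
    (b : B) {g p : ModelSpace F M Λ → X} (hg : g ∈ A) (hp : p ∈ A) (h1 : Asym P B g p)
    (h2 : Asym P B (g ∘ act (simpleReflection P B b * w₀).1)
        (p ∘ act (simpleReflection P B b * w₀).1))
    (h3 : ¬Asym P B (g ∘ act (simpleReflection P B b).1) (p ∘ act (simpleReflection P B b).1)) :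
    ∃ c, g ⁻¹' Set.range p = halfApartment P b c := by
  obtain ⟨t, τ, ht⟩ := h1
  obtain ⟨t', τ', ht'⟩ := h2
  have hconv := hA.convex hg hp (v := t + 0) ⟨_, (ht 0 zero_mem_fundChamber).symm⟩
  obtain ⟨κ, hκ⟩ := hA.asym_transition hB hg hp ⟨t, τ, ht⟩
  obtain ⟨s, -, hs⟩ := hconv
  have hmem1 : ∀ v ∈ fundChamber P B, t + v ∈ g ⁻¹' Set.range p := fun v hv =>
    ⟨_, (ht v hv).symm⟩
  have hmem2 : ∀ v ∈ fundChamber P B,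
      act (simpleReflection P B b * w₀).1 (t' + v) ∈ g ⁻¹' Set.range p := fun v hv =>
    ⟨_, (ht' v hv).symm⟩
  rw [hs] at hmem1 hmem2 ⊢
  simp only [Set.mem_iInter] at hmem1 hmem2
  obtain ⟨e, he⟩ := exists_zero_lt (α := Λ)
  -- A half-apartment containing a sector has a root that is positive in the direction of the
  -- sector; otherwise far points of the sector would leave it.
  have hbd : ∀ (i : ι) (c d : Λ), (∀ v ∈ fundChamber P B, c ≤ d + coev P i v) → IsPos P B i := by
    intro i c d h
    by_contra hi
    obtain ⟨v, hv, hl⟩ := hB.exists_large (d - c + e)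
    have e1 := h v hv
    have e2 := hl _ ((hB.isPos_nidx_iff i).2 hi)
    rw [coev_nidx] at e2
    have e3 := add_le_add e1 e2
    have e4 : d + coev P i v + -coev P i v = c + (d - c) := by abel
    rw [e4, ← add_assoc] at e3
    exact absurd e3 (not_le.2 (lt_add_of_pos_right _ he))
  -- Each defining half-apartment contains the two given sectors. Its root is positive by the first
  -- and becomes negative under the reflection in `b` by the second, so it is a multiple of `b`.
  have hmult : ∀ z ∈ s, IsPos P B z.1 ∧ hB.Mult b z.1 := by
    intro z hz
    have p1 : IsPos P B z.1 := hbd _ z.2 (coev P z.1 t) fun v hv => by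
      rw [← map_add]; exact hmem1 v hv z hz
    refine ⟨p1, ?_⟩
    by_contra hm
    have p2 : IsPos P B (wperm (simpleReflection P B b * w₀)⁻¹ z.1) :=
      hbd _ z.2 (coev P (wperm (simpleReflection P B b * w₀)⁻¹ z.1) t') fun v hv => by
        rw [← map_add, ← coev_act']; exact hmem2 v hv z hz
    rw [mul_inv_rev, wperm_mul, isPos_wperm_inv_iff hw₀, simpleReflection_inv,
      wperm_simpleReflection] at p2
    exact p2 (hB.isPos_reflectionPerm p1 hm)
  have hne : s.Nonempty := by
    by_contra hne
    rw [Finset.not_nonempty_iff_eq_empty] at hne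
    apply h3
    refine ⟨0, act (simpleReflection P B b).1 κ, fun v hv => ?_⟩
    have hu : ∀ u, g u ∈ Set.range p := fun u => by
      have : u ∈ g ⁻¹' Set.range p := by rw [hs, hne]; simp
      exact this
    have e1 := act_act_inv (simpleReflection P B b) κ
    rw [simpleReflection_inv] at e1
    simp only [Function.comp_apply, zero_add]
    rw [hκ _ (hu _), map_add, e1, add_comm]
  -- All constraints are parallel; after normalization the largest bound implies the others.
  obtain ⟨z, hz, hmax⟩ := s.exists_max_image (fun z => (hB.kcoef z.1 b)⁻¹ • z.2) hne
  have hiff : ∀ z ∈ s, ∀ v : ModelSpace F M Λ,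
      z.2 ≤ coev P z.1 v ↔ (hB.kcoef z.1 b)⁻¹ • z.2 ≤ coev P b v := by
    intro z hz v
    obtain ⟨q1, q2⟩ := hmult z hz
    have hk := q2.kcoef_pos q1
    rw [q2.coev_eq]
    constructor
    · intro h
      have := smul_le_smul_of_nonneg_left h (inv_pos.2 hk).le
      rwa [smul_smul, inv_mul_cancel₀ hk.ne', one_smul] at this
    · intro h
      have := smul_le_smul_of_nonneg_left h hk.le
      rwa [smul_smul, mul_inv_cancel₀ hk.ne', one_smul] at this
  refine ⟨(hB.kcoef z.1 b)⁻¹ • z.2, ?_⟩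
  ext v
  simp only [Set.mem_iInter]
  constructor
  · intro h
    exact (hiff z hz v).1 (h z hz)
  · intro h z' hz'
    exact (hiff z' hz' v).2 ((hmax z' hz').trans h)

theorem isHalfApartment_of_preimage {f g : ModelSpace F M Λ → X} (hf : f ∈ A) {i : ι} {c : Λ}
    (h : f ⁻¹' Set.range g = halfApartment P i c) :
    IsHalfApartment P A (Set.range f ∩ Set.range g) :=
  ⟨f, hf, i, c, by rw [← h, Set.image_preimage_eq_range_inter]⟩

/-- Exchange: an apartment is covered by two apartments which contain a given chamber at infinity
adjacent to it. -/
theorem exists_exchange [Nontrivial Λ] (hA : IsAffineBuilding P B T A)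
    (hB : IsBasis P B) (b : B) (g f : A)
    (hgf : wdist hB A (Quotient.mk _ g) (Quotient.mk _ f) = simpleReflection P B b)
    (hnot : ¬Asym P B (g.1 ∘ act (simpleReflection P B b).1) f.1) :
    ∃ p ∈ A, ∃ q ∈ A, Asym P B f.1 p ∧ Asym P B f.1 q ∧
      Set.range g.1 ⊆ Set.range p ∪ Set.range q := by
  have hδ := hA.isWeylDist hB
  obtain ⟨w₀, hw₀⟩ := hB.exists_longest
  set s := simpleReflection P B b with hs
  have hss : s * s = 1 := simpleReflection_mul_self b
  have hs1 : s ≠ 1 := by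
    intro h
    have h1 := hB.lt_wlen_mul (w := 1) (b := b) (by rw [wperm_one]; exact hB.isPos_simple b)
    rw [← hs, h, mul_one] at h1
    exact lt_irrefl _ h1
  obtain ⟨p, hp, p1, p2, p3⟩ := hA.exists_opposite_extension hB hw₀ b g f hgf
  -- The other chamber of `g` on the panel, also adjacent to `f`. The same extension from `g'`
  -- produces the apartment for the complementary half.
  let g' : A := ⟨g.1 ∘ act s.1, hA.comp_act_mem g.2 s⟩
  have hg'g : wdist hB A (Quotient.mk _ g') (Quotient.mk _ g) = s := by
    rw [hA.wdist_comp_act hB (f := g.1) g.2 g' g (w := s) (w' := 1) (Asym.refl _)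
      (by rw [comp_act_one]; exact Asym.refl _), mul_one, hs, simpleReflection_inv]
  have hg'f : wdist hB A (Quotient.mk _ g') (Quotient.mk _ f) = s :=
    hδ.adj_trans hg'g hgf fun h => hnot (Quotient.exact h)
  obtain ⟨q, hq, q1, q2, q3⟩ := hA.exists_opposite_extension hB hw₀ b g' f hg'f
  rw [← hs] at p2 p3 q2 q3
  have e1 : g'.1 ∘ act (s * w₀).1 = g.1 ∘ act w₀.1 := by
    rw [comp_act_mul, ← mul_assoc, hss, one_mul]
  rw [e1] at q2
  have hgg' : ¬Asym P B g.1 g'.1 := fun h => hs1 <| by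
    rw [← hg'g]; exact (hδ.eq_one_iff _ _).2 (Quotient.sound h.symm)
  have hgf' : ¬Asym P B g.1 f.1 := fun h => hs1 <| by
    rw [← hgf]; exact (hδ.eq_one_iff _ _).2 (Quotient.sound h)
  obtain ⟨k, hk⟩ := hA.exists_preimage_eq_halfApartment hB hw₀ b g.2 hp p1 p2
    fun h => hnot (h.trans hB p3.symm)
  obtain ⟨k', hk'⟩ := hA.exists_preimage_eq_halfApartment hB hw₀ b g'.2 hq q1
    (by rw [← hs, e1]; exact q2) fun h => by
      rw [comp_act_mul, ← hs, hss, comp_act_one] at h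
      exact hgf' (h.trans hB q3.symm)
  obtain ⟨b', hb'⟩ := hB.exists_conj_longest hw₀ b
  rw [← hs] at hb'
  -- Both chambers lie in the panel opposite to the given one and are at the same distance `s * w₀`
  -- from `f`; since this is the shorter distance occurring in that panel, they coincide.
  have hpq : Asym P B (p ∘ act w₀.1) (q ∘ act w₀.1) := by
    let pw : A := ⟨p ∘ act w₀.1, hA.comp_act_mem hp _⟩
    let qw : A := ⟨q ∘ act w₀.1, hA.comp_act_mem hq _⟩
    let gs : A := ⟨g.1 ∘ act (s * w₀).1, hA.comp_act_mem g.2 _⟩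
    let gw : A := ⟨g.1 ∘ act w₀.1, hA.comp_act_mem g.2 _⟩
    have i1 : wdist hB A (Quotient.mk _ pw) (Quotient.mk _ gs) = simpleReflection P B b' := by
      rw [hA.wdist_comp_act hB hp pw gs (Asym.refl _) p2, ← hb', mul_assoc]
    have i2 : wdist hB A (Quotient.mk _ gs) (Quotient.mk _ gw) = simpleReflection P B b' := by
      rw [hA.wdist_comp_act hB g.2 gs gw (Asym.refl _) (Asym.refl _), ← hb', mul_inv_rev, hs,
        simpleReflection_inv]
    have i3 : wdist hB A (Quotient.mk _ gw) (Quotient.mk _ qw) = simpleReflection P B b' := by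
      rw [hA.wdist_comp_act hB hq gw qw q2 (Asym.refl _), ← hb', mul_inv_rev, hs,
        simpleReflection_inv]
    have j1 : wdist hB A (Quotient.mk _ f) (Quotient.mk _ pw) = s * w₀ := by
      rw [hA.wdist_comp_act hB hp f pw p3 (Asym.refl _), hs, simpleReflection_inv]
    have j2 : wdist hB A (Quotient.mk _ f) (Quotient.mk _ qw) = s * w₀ := by
      rw [hA.wdist_comp_act hB hq f qw q3 (Asym.refl _), hs, simpleReflection_inv]
    rcases hδ.eq_or_adj_trans (Or.inr i1) (hδ.eq_or_adj_trans (Or.inr i2) (Or.inr i3)) with h | h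
    · exact Quotient.exact h
    · refine (hδ.eq_of_adj h ?_ (j1.trans j2.symm)).elim
      have hl := hB.wlen_mul_lt (w := w₀) (b := b')
        (by rw [hw₀, not_not]; exact hB.isPos_simple b')
      have e2 : w₀ * simpleReflection P B b' = s * w₀ := by
        rw [← hb', mul_assoc, mul_inv_cancel_left]
      have e3 : s * w₀ * simpleReflection P B b' = w₀ := by
        rw [mul_assoc, e2, ← mul_assoc, hss, one_mul]
      rwa [j1, e3, ← e2]
  obtain ⟨k'', hk''⟩ := hA.exists_preimage_eq_halfApartment hB hw₀ b
    (hA.comp_act_mem hp s) (hA.comp_act_mem hq s) (p3.symm.trans hB q3)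
    (by rw [comp_act_mul, comp_act_mul, ← hs, ← mul_assoc, hss, one_mul]; exact hpq)
    fun h => by
      rw [comp_act_mul, comp_act_mul, ← hs, hss, comp_act_one, comp_act_one] at h
      exact hgg' (p1.trans hB (h.trans hB q1.symm))
  have H1 := isHalfApartment_of_preimage g.2 hk
  have H2 := isHalfApartment_of_preimage (hA.comp_act_mem hp s) hk''
  have H3 := isHalfApartment_of_preimage g'.2 hk'
  have r1 : Set.range g'.1 = Set.range g.1 := range_comp_act _ _
  rw [range_comp_act, range_comp_act] at H2
  rw [r1] at H3
  -- The common point lies in both halves of `g`, so the halves overlap and every other point is on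
  -- one side of it.
  obtain ⟨_, ⟨⟨u₀, rfl⟩, hu1⟩, hu2⟩ := hA.a6 g.1 g.2 p hp q hq H1 H2 H3
  have hup : ∀ u, g.1 u ∈ Set.range p ↔ k ≤ coev P b u := fun u => by
    change u ∈ g.1 ⁻¹' Set.range p ↔ _
    rw [hk]; rfl
  have huq : ∀ u, g.1 u ∈ Set.range q ↔ k' ≤ -coev P b u := fun u => by
    have e2 := act_act_inv s u
    rw [hs, simpleReflection_inv, ← hs] at e2
    have : g.1 u = g'.1 (act s.1 u) := by
      change _ = g.1 (act s.1 (act s.1 u))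
      rw [e2]
    rw [this]
    change act s.1 u ∈ g'.1 ⁻¹' Set.range q ↔ _
    rw [hk']
    change k' ≤ coev P b (act (P.reflection b) u) ↔ _
    rw [coev_reflection]
    change k' ≤ coev P (nidx P b) u ↔ _
    rw [coev_nidx]
  refine ⟨p ∘ act s.1, hA.comp_act_mem hp s, q ∘ act s.1, hA.comp_act_mem hq s, p3, q3, ?_⟩
  rw [range_comp_act, range_comp_act]
  rintro _ ⟨u, rfl⟩
  rcases le_total (coev P b u₀) (coev P b u) with h | h
  · exact Or.inl ((hup u).2 (((hup u₀).1 hu1).trans h))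
  · exact Or.inr ((huq u).2 (((huq u₀).1 hu2).trans (neg_le_neg h)))

/-- Every apartment is covered by finitely many apartments containing a given chamber at
infinity. -/
theorem exists_finite_cover [Nontrivial Λ] (hA : IsAffineBuilding P B T A)
    (hB : IsBasis P B) {f g : ModelSpace F M Λ → X} (hf : f ∈ A) (hg : g ∈ A) :
    ∃ H : Set (ModelSpace F M Λ → X), H.Finite ∧ (∀ k ∈ H, k ∈ A ∧ Asym P B f k) ∧
      ∀ u, ∃ k ∈ H, g u ∈ Set.range k := by
  have hδ := hA.isWeylDist hB
  induction hn : wlen (simpleReflection P B) (wdist hB A (Quotient.mk _ ⟨f, hf⟩)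
    (Quotient.mk _ ⟨g, hg⟩)) using Nat.strong_induction_on generalizing g with
  | _ n ih =>
  set w := wdist hB A (Quotient.mk _ ⟨f, hf⟩) (Quotient.mk _ ⟨g, hg⟩) with hw
  by_cases hw1 : w = 1
  · have : Asym P B f g := Quotient.exact ((hδ.eq_one_iff _ _).1 hw1)
    exact ⟨{g}, Set.finite_singleton g, by rintro k rfl; exact ⟨hg, this⟩,
      fun u => ⟨g, rfl, u, rfl⟩⟩
  obtain ⟨b, hb⟩ := exists_wlen_mul_lt hB.exists_list simpleReflection_mul_self hw1
  obtain ⟨k, hk, k1, k2⟩ := hA.exists_of_wdist hB ⟨f, hf⟩ ⟨g, hg⟩ hw.symm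
  set s := simpleReflection P B b with hs
  -- The chamber adjacent to `g` that is closer to `f`. Replacing `g` by apartments containing `f1`
  -- shortens the distance.
  let f1 : A := ⟨k ∘ act (w * s).1, hA.comp_act_mem hk _⟩
  have d1 : ∀ (g' : ModelSpace F M Λ → X) (hg' : g' ∈ A), Asym P B f1.1 g' →
      wdist hB A (Quotient.mk _ ⟨f, hf⟩) (Quotient.mk _ ⟨g', hg'⟩) = w * s := fun g' hg' h =>
    hA.wdist_mk hB ⟨f, hf⟩ ⟨g', hg'⟩ hk k1 h.symm
  have d2 : wdist hB A (Quotient.mk _ ⟨g, hg⟩) (Quotient.mk _ f1) = s := by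
    rw [hA.wdist_comp_act hB hk ⟨g, hg⟩ f1 k2 (Asym.refl _), inv_mul_cancel_left]
  have key : ∀ (g' : ModelSpace F M Λ → X) (hg' : g' ∈ A), Asym P B f1.1 g' →
      ∃ H : Set (ModelSpace F M Λ → X), H.Finite ∧ (∀ k ∈ H, k ∈ A ∧ Asym P B f k) ∧
      ∀ u, ∃ k ∈ H, g' u ∈ Set.range k := fun g' hg' h =>
    ih _ (by rw [← hn]; exact hb) hg' (by rw [d1 g' hg' h])
  by_cases h : Asym P B (g ∘ act s.1) f1.1
  · obtain ⟨H, h1, h2, h3⟩ := key _ (hA.comp_act_mem hg s) h.symm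
    refine ⟨H, h1, h2, fun u => ?_⟩
    obtain ⟨k, hk, hu⟩ := h3 (act s⁻¹.1 u)
    exact ⟨k, hk, by rwa [Function.comp_apply, act_act_inv] at hu⟩
  · obtain ⟨p, hp, q, hq, p1, q1, hsub⟩ := hA.exists_exchange hB b ⟨g, hg⟩ f1 d2 h
    obtain ⟨H, h1, h2, h3⟩ := key p hp p1
    obtain ⟨H', h1', h2', h3'⟩ := key q hq q1
    refine ⟨H ∪ H', h1.union h1', ?_, fun u => ?_⟩
    · rintro k (hk | hk)
      exacts [h2 k hk, h2' k hk]
    · rcases hsub ⟨u, rfl⟩ with ⟨v, hv⟩ | ⟨v, hv⟩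
      · obtain ⟨k, hk, hu⟩ := h3 v
        exact ⟨k, Or.inl hk, by rw [show g u = p v from hv.symm]; exact hu⟩
      · obtain ⟨k, hk, hu⟩ := h3' v
        exact ⟨k, Or.inr hk, by rw [show g u = q v from hv.symm]; exact hu⟩

end IsAffineBuilding

/-! ### Germs in a common apartment -/

theorem IsBasis.exists_regular_lt (hB : IsBasis P B) {e : Λ} (he : 0 < e) :
    ∃ v : ModelSpace F M Λ, (∀ b : B, 0 < coev P b v) ∧ nrm P B v < e := by
  obtain ⟨ρ, hρ⟩ := hB.exists_regular (Λ := F)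
  have h0 : (0 : F) ≤ nrm P B ρ := nrm_nonneg ρ
  have hc : 0 < (nrm P B ρ + 1)⁻¹ := inv_pos.2 (by linarith)
  have hl : 0 < (nrm P B ρ + 1)⁻¹ • e := smul_pos_of_pos hc he
  refine ⟨scale ((nrm P B ρ + 1)⁻¹ • e) ρ, fun b => ?_, ?_⟩
  · rw [coev_scale]; exact smul_pos_of_pos (hρ b) hl
  · rw [nrm_scale hl, smul_smul, ← sub_pos]
    have : e - (nrm P B ρ * (nrm P B ρ + 1)⁻¹) • e =
        (1 - nrm P B ρ * (nrm P B ρ + 1)⁻¹) • e := by rw [sub_smul, one_smul]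
    rw [this]
    refine smul_pos_of_pos (sub_pos.2 ?_) he
    rw [← div_eq_mul_inv, div_lt_one (by linarith)]
    linarith

namespace IsAffineBuilding

theorem exists_ball_disjoint [Nontrivial Λ] (hA : IsAffineBuilding P B T A) (hB : IsBasis P B)
    {g k : ModelSpace F M Λ → X} (hg : g ∈ A) (hk : k ∈ A) {q : ModelSpace F M Λ}
    (h : g q ∉ Set.range k) :
    ∃ e : Λ, 0 < e ∧ ∀ v, nrm P B v < e → g (q + v) ∉ Set.range k := by
  by_cases hne : ∃ v, g v ∈ Set.range k
  · obtain ⟨v, hv⟩ := hne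
    obtain ⟨s, -, hs⟩ := hA.convex hg hk hv
    have hq : q ∉ g ⁻¹' Set.range k := h
    rw [hs] at hq
    simp only [Set.mem_iInter, not_forall] at hq
    obtain ⟨z, hz, hzq⟩ := hq
    have hlt : coev P z.1 q < z.2 := not_le.1 hzq
    refine ⟨z.2 - coev P z.1 q, sub_pos.2 hlt, fun v hv hmem => ?_⟩
    have hmem' : q + v ∈ g ⁻¹' Set.range k := hmem
    rw [hs] at hmem'
    simp only [Set.mem_iInter] at hmem'
    have h1 : z.2 ≤ coev P z.1 (q + v) := hmem' z hz
    rw [map_add] at h1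
    have h2 := (le_abs_self _).trans_lt ((hB.abs_coev_le_nrm z.1 v).trans_lt hv)
    exact absurd h1 (not_le.2 (lt_sub_iff_add_lt'.1 h2))
  · push Not at hne
    obtain ⟨e, he⟩ := exists_zero_lt (α := Λ)
    exact ⟨e, he, fun v _ => hne _⟩

/-- A sector and a germ of a sector, both based at the same point, lie in a common apartment. -/
theorem exists_common_germ [Nontrivial Λ] (hA : IsAffineBuilding P B T A) (hB : IsBasis P B)
    {f g : ModelSpace F M Λ → X} (hf : f ∈ A) (hg : g ∈ A) {p q : ModelSpace F M Λ}
    (hpq : f p = g q) :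
    ∃ k ∈ A, ∃ r, ∃ w : weylGroup P, (∀ v ∈ fundChamber P B, f (p + v) = k (r + v)) ∧
      ∃ e : Λ, 0 < e ∧ ∀ v ∈ fundChamber P B, nrm P B v < e → g (q + v) = k (r + act w.1 v) := by
  -- Finiteness permits one radius within which no member of the cover missing `q` is met; the
  -- member through a regular point that close must contain `q` as well.
  obtain ⟨H, hfin, hH, hcov⟩ := hA.exists_finite_cover hB hf hg
  have hex : ∀ k : ModelSpace F M Λ → X, ∃ e : Λ, 0 < e ∧ (k ∈ H → g q ∉ Set.range k →
      ∀ v, nrm P B v < e → g (q + v) ∉ Set.range k) := by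
    intro k
    by_cases hk : k ∈ H ∧ g q ∉ Set.range k
    · obtain ⟨e, he, h⟩ := hA.exists_ball_disjoint hB hg (hH k hk.1).1 hk.2
      exact ⟨e, he, fun _ _ => h⟩
    · obtain ⟨e, he⟩ := exists_zero_lt (α := Λ)
      exact ⟨e, he, fun h1 h2 => absurd ⟨h1, h2⟩ hk⟩
  choose ε hε hε' using hex
  obtain ⟨e, he, hle⟩ := exists_pos_forall_le hfin.toFinset ε fun k _ => hε k
  obtain ⟨v, hv, hve⟩ := hB.exists_regular_lt (M := M) he
  obtain ⟨k, hk, hkv⟩ := hcov (q + v)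
  obtain ⟨hkA, hfk⟩ := hH k hk
  have hq : g q ∈ Set.range k := by
    by_contra hq
    exact hε' k hk hq v (hve.trans_le (hle k (hfin.mem_toFinset.2 hk))) hkv
  obtain ⟨κ, hκ⟩ := hA.asym_transition hB hf hkA hfk
  obtain ⟨w, t, hw⟩ := hA.exists_transition hg hkA ⟨g q, ⟨q, rfl⟩, hq⟩
  have hp : f p ∈ Set.range k := hpq ▸ hq
  have e1 : act w.1 q + t = p + κ :=
    hA.injective k hkA (((hw q hq).symm.trans hpq.symm).trans (hκ p hp))
  refine ⟨k, hkA, p + κ, w, fun u hu => ?_, ?_⟩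
  · obtain ⟨t', τ, ht⟩ := hfk
    have : p + u ∈ f ⁻¹' Set.range k := (hA.convex hf hkA hp).add_mem hB (t := t') hp
      (fun v hv => ⟨_, (ht v hv).symm⟩) hu
    rw [hκ _ this]; congr 1; abel
  · obtain ⟨e', he', hle'⟩ := exists_pos_forall_le (Finset.univ : Finset B)
      (fun b => coev P b v) fun b _ => hv b
    refine ⟨e', he', fun z hz hze => ?_⟩
    -- Small chamber vectors lie coordinatewise between 0 and `v`, hence between two points of the
    -- convex overlap.
    have hle2 : ∀ b : B, coev P b z ≤ coev P b v := fun b =>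
      (le_abs_self _).trans ((hB.abs_coev_le_nrm b z).trans (hze.le.trans
        (hle' b (Finset.mem_univ _))))
    have : q + z ∈ g ⁻¹' Set.range k := by
      refine (hA.convex hg hkA hq).mem_of_le fun i => ?_
      by_cases hi : IsPos P B i
      · exact ⟨q, hq, by rw [map_add]; exact le_add_of_nonneg_right (hz i hi)⟩
      · refine ⟨q + v, hkv, ?_⟩
        rw [map_add, map_add, add_le_add_iff_left]
        have := hB.coev_le_of_simple hle2 ((hB.isPos_nidx_iff i).2 hi)
        rwa [coev_nidx, coev_nidx, neg_le_neg_iff] at this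
    rw [hw _ this, map_add, ← e1]
    congr 1; abel

end IsAffineBuilding

end Building

/-! ### Chains of intervals -/

section Interval
variable {F : Subfield ℝ} {Λ : Type*} [AddCommGroup Λ] [LinearOrder Λ] [IsOrderedAddMonoid Λ]
  [Module F Λ] [PosSMulMono F Λ]

theorem exists_Icc_of_smul_le (m : F) (d a c : Λ) :
    ∃ a' c', ∀ t, (t ∈ Set.Icc a c ∧ d ≤ m • t) ↔ t ∈ Set.Icc a' c' := by
  have hle : ∀ {m : F}, 0 < m → ∀ {d t : Λ}, d ≤ m • t ↔ m⁻¹ • d ≤ t := by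
    intro m hm d t
    constructor
    · intro h
      have := smul_le_smul_of_nonneg_left h (inv_pos.2 hm).le
      rwa [smul_smul, inv_mul_cancel₀ hm.ne', one_smul] at this
    · intro h
      have := smul_le_smul_of_nonneg_left h hm.le
      rwa [smul_smul, mul_inv_cancel₀ hm.ne', one_smul] at this
  rcases lt_trichotomy m 0 with hm | rfl | hm
  · refine ⟨a, min c (-((-m)⁻¹ • d)), fun t => ?_⟩
    have h1 : d ≤ m • t ↔ t ≤ -((-m)⁻¹ • d) := by
      have := hle (neg_pos.2 hm) (d := d) (t := -t)
      rw [smul_neg, neg_smul, neg_neg] at this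
      rw [this, le_neg]
    rw [h1, Set.mem_Icc, Set.mem_Icc, le_min_iff, and_assoc]
  · by_cases hd : d ≤ 0
    · exact ⟨a, c, fun t => by simp [hd]⟩
    -- Here `d` is positive, so this interval is empty, as required.
    · exact ⟨d, 0, fun t => ⟨fun h => absurd (by simpa using h.2) hd,
        fun h => absurd (h.1.trans h.2) hd⟩⟩
  · refine ⟨max a (m⁻¹ • d), c, fun t => ?_⟩
    rw [hle hm, Set.mem_Icc, Set.mem_Icc, max_le_iff]
    tauto

theorem exists_Icc_of_forall_smul_le {α : Type*} (s : Finset α) (m : α → F) (d : α → Λ)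
    (a c : Λ) :
    ∃ a' c', ∀ t, (t ∈ Set.Icc a c ∧ ∀ i ∈ s, d i ≤ m i • t) ↔ t ∈ Set.Icc a' c' := by
  induction s using Finset.induction_on with
  | empty => exact ⟨a, c, fun t => by simp⟩
  | insert i s _ ih =>
    obtain ⟨a', c', h⟩ := ih
    obtain ⟨a'', c'', h'⟩ := exists_Icc_of_smul_le (m i) (d i) a' c'
    refine ⟨a'', c'', fun t => ?_⟩
    rw [← h', ← h, Finset.forall_mem_insert]
    tauto

/-- A property that propagates to the right inside each interval of a finite cover of `[0, l]` by
closed intervals propagates from `0` to `l`. -/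
theorem of_finite_Icc_cover (F : Subfield ℝ) [Module F Λ] [PosSMulMono F Λ]
    {α : Type*} (s : Finset α) (a c : α → Λ) {l : Λ} (hl : 0 ≤ l)
    (hs : ∀ t ∈ Set.Icc 0 l, ∃ k ∈ s, t ∈ Set.Icc (a k) (c k))
    (hc : ∀ k ∈ s, ∀ t ∈ Set.Icc (a k) (c k), t ≤ l) {Q : Λ → Prop} (h0 : Q 0)
    (hQ : ∀ k ∈ s, ∀ t ∈ Set.Icc (a k) (c k), ∀ t' ∈ Set.Icc (a k) (c k), t ≤ t' → Q t → Q t') :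
    Q l := by
  let s' := s.filter fun k => a k ≤ c k ∧ Q (c k)
  have hne : s'.Nonempty := by
    obtain ⟨k, hk, hk'⟩ := hs 0 ⟨le_rfl, hl⟩
    have hac := hk'.1.trans hk'.2
    exact ⟨k, Finset.mem_filter.2 ⟨hk, hac, hQ k hk 0 hk' _ ⟨hac, le_rfl⟩ hk'.2 h0⟩⟩
  -- No completeness of `Λ` is available. Instead take the furthest right endpoint reached; a point
  -- just beyond it, before any later left endpoint, lies in an interval that would reach further.
  obtain ⟨k, hk, hmax⟩ := s'.exists_max_image c hne
  obtain ⟨hk1, hk2, hk3⟩ := Finset.mem_filter.1 hk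
  rcases (hc k hk1 _ ⟨hk2, le_rfl⟩).eq_or_lt with h | h
  · rwa [← h]
  exfalso
  have h0c : 0 ≤ c k := by
    obtain ⟨k', hk', h'⟩ := hs 0 ⟨le_rfl, hl⟩
    have hac := h'.1.trans h'.2
    exact h'.2.trans (hmax k' (Finset.mem_filter.2
      ⟨hk', hac, hQ k' hk' 0 h' _ ⟨hac, le_rfl⟩ h'.2 h0⟩))
  have : Nontrivial Λ := ⟨⟨_, _, h.ne⟩⟩
  obtain ⟨e, he, hle⟩ := exists_pos_forall_le (s.filter fun j => c k < a j)
    (fun j => a j - c k) fun j hj => sub_pos.2 (Finset.mem_filter.1 hj).2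
  obtain ⟨m, hm0, hm⟩ := exists_pos_lt F (lt_min he (sub_pos.2 h))
  have hml : c k + m ≤ l := by
    have := (hm.trans_le (min_le_right _ _)).le
    rwa [le_sub_iff_add_le'] at this
  obtain ⟨j, hj, hj'⟩ := hs (c k + m) ⟨add_nonneg h0c hm0.le, hml⟩
  have haj : a j ≤ c k := by
    by_contra hlt
    have h1 := hle j (Finset.mem_filter.2 ⟨hj, not_le.1 hlt⟩)
    have h2 := (hm.trans_le (min_le_left _ _)).trans_le h1
    rw [lt_sub_iff_add_lt'] at h2
    exact absurd hj'.1 (not_le.2 h2)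
  have hlt : c k < c j := (lt_add_of_pos_right _ hm0).trans_le hj'.2
  exact absurd (hmax j (Finset.mem_filter.2 ⟨hj, haj.trans hlt.le,
    hQ j hj (c k) ⟨haj, hlt.le⟩ _ ⟨haj.trans hlt.le, le_rfl⟩ hlt.le hk3⟩)) (not_le.2 hlt)

theorem abs_between {a c : Λ} (h : |a + c| = |a| + |c|) : (0 ≤ a ∧ 0 ≤ c) ∨ (a ≤ 0 ∧ c ≤ 0) :=
  abs_add_eq_add_abs_iff a c |>.1 h

end Interval

/-! ### Apartments contain metric segments -/

section Building
variable {F : Subfield ℝ} {ι M N Λ X : Type*} [Fintype ι] [AddCommGroup M] [Module F M]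
  [AddCommGroup N] [Module F N] {P : RootPairing ι F M N} [P.IsRootSystem] {B : Set ι}
  [AddCommGroup Λ] [LinearOrder Λ] [IsOrderedAddMonoid Λ] [Module F Λ] [PosSMulMono F Λ]
  {T : AddSubgroup (ModelSpace F M Λ)} {A : Set (ModelSpace F M Λ → X)}

namespace IsAffineBuilding

/-- If a point lies between two points of an apartment and all three lie in some apartment, then
it lies in the first one. -/
theorem mem_range_of_common (hA : IsAffineBuilding P B T A) (hB : IsBasis P B)
    {f k : ModelSpace F M Λ → X} (hf : f ∈ A) (hk : k ∈ A) {p q r : ModelSpace F M Λ}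
    (hp : k p ∈ Set.range f) (hq : k q ∈ Set.range f)
    (h : nrm P B (r - p) + nrm P B (q - r) = nrm P B (q - p)) : k r ∈ Set.range f := by
  refine (hA.convex hk hf hp).mem_of_le fun i => ?_
  have h' : nrm P B ((q - r) + (r - p)) = nrm P B (q - r) + nrm P B (r - p) := by
    rw [sub_add_sub_cancel, ← h, add_comm]
  have h0 := hB.abs_coev_add_of_nrm h' i
  rw [map_add] at h0
  rcases abs_between h0 with h1 | h1
  · refine ⟨p, hp, ?_⟩
    have := h1.2
    rwa [map_sub, sub_nonneg] at this
  · refine ⟨q, hq, ?_⟩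
    have := h1.1
    rwa [map_sub, sub_nonpos] at this

/-- Charts with the same chamber at infinity agree on sectors up to a translation. -/
theorem asym_add_eq [Nontrivial Λ] (hA : IsAffineBuilding P B T A) (hB : IsBasis P B)
    {f k : ModelSpace F M Λ → X} (hf : f ∈ A) (hk : k ∈ A) (h : Asym P B f k)
    {p r : ModelSpace F M Λ} (hp : f p = k r) {v : ModelSpace F M Λ} (hv : v ∈ fundChamber P B) :
    f (p + v) = k (r + v) := by
  obtain ⟨κ, hκ⟩ := hA.asym_transition hB hf hk h
  have hp' : f p ∈ Set.range k := ⟨r, hp.symm⟩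
  have hr : r = p + κ := hA.injective k hk (hp.symm.trans (hκ p hp'))
  obtain ⟨t', τ, ht⟩ := h
  rw [hκ _ ((hA.convex hf hk hp').add_mem hB (t := t') hp' (fun v hv => ⟨_, (ht v hv).symm⟩) hv),
    hr]
  congr 1; abel

/-- In a chart with the chamber at infinity of `e`, the sector based at `w` contains `z`, and `z + v₀`
has image `x`. -/
def Behind (P : RootPairing ι F M N) (B : Set ι) (A : Set (ModelSpace F M Λ → X))
    (e : ModelSpace F M Λ → X) (v₀ : ModelSpace F M Λ) (x z w : X) : Prop :=
  ∃ k ∈ A, Asym P B k e ∧ ∃ r, ∃ v ∈ fundChamber P B, k r = w ∧ k (r + v) = z ∧ k (r + v + v₀) = x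

theorem behind_iff [Nontrivial Λ] (hA : IsAffineBuilding P B T A) (hB : IsBasis P B)
    {e k : ModelSpace F M Λ → X} {v₀ : ModelSpace F M Λ} (hv₀ : v₀ ∈ fundChamber P B) {x z : X}
    {r : ModelSpace F M Λ} (hk : k ∈ A) (hke : Asym P B k e) :
    Behind P B A e v₀ x z (k r) ↔
      ∃ v ∈ fundChamber P B, k (r + v) = z ∧ k (r + v + v₀) = x := by
  refine ⟨?_, fun ⟨v, hv, h⟩ => ⟨k, hk, hke, r, v, hv, rfl, h⟩⟩
  rintro ⟨k', hk', hke', r', v, hv, h1, h2, h3⟩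
  have hs : Asym P B k' k := hke'.trans hB hke.symm
  refine ⟨v, hv, ?_, ?_⟩
  · rw [← h2, hA.asym_add_eq hB hk' hk hs h1 hv]
  · rw [← h3, add_assoc, add_assoc, hA.asym_add_eq hB hk' hk hs h1 (add_mem_fundChamber hv hv₀)]

/-- Since `v₀` is regular, the leg from `x` to `y₁` is strictly negative on all positive roots.
Tightness of the triangle inequality makes the leg to `y₂` non-positive on them, so the sector at
`y₂` still contains `y₁`. -/
theorem Behind.step [Nontrivial Λ] (hA : IsAffineBuilding P B T A) (hB : IsBasis P B)
    {e k : ModelSpace F M Λ → X} {v₀ : ModelSpace F M Λ}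
    (hv₀ : ∀ b : B, 0 < coev P b v₀) {x z y₁ y₂ : X} (hk : k ∈ A) (hke : Asym P B k e)
    (h1 : y₁ ∈ Set.range k) (h2 : y₂ ∈ Set.range k) (h : Behind P B A e v₀ x z y₁)
    (hd : chartDist P B A x y₁ + chartDist P B A y₁ y₂ = chartDist P B A x y₂) :
    Behind P B A e v₀ x z y₂ := by
  obtain ⟨r₁, rfl⟩ := h1
  obtain ⟨r₂, rfl⟩ := h2
  have hC : v₀ ∈ fundChamber P B := hB.mem_fundChamber_iff.2 fun b => (hv₀ b).le
  obtain ⟨v, hv, hz, hx⟩ := (hA.behind_iff hB hC hk hke).1 h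
  rw [← hx, hA.chartDist_eq hB hk, hA.chartDist_eq hB hk, hA.chartDist_eq hB hk] at hd
  refine (hA.behind_iff hB hC hk hke).2 ⟨v + (r₁ - r₂), add_mem_fundChamber hv ?_, ?_, ?_⟩
  · intro i hi
    have h' : nrm P B ((r₁ - (r₁ + v + v₀)) + (r₂ - r₁)) =
        nrm P B (r₁ - (r₁ + v + v₀)) + nrm P B (r₂ - r₁) := by
      rw [hd]; congr 1; abel
    have hpos : coev P i (r₁ - (r₁ + v + v₀)) < 0 := by
      have h3 := hv i hi
      have h4 := hB.coev_pos_of_simple hv₀ hi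
      have : r₁ - (r₁ + v + v₀) = -(v + v₀) := by abel
      rw [this, map_neg, map_add, neg_lt_zero]
      exact add_pos_of_nonneg_of_pos h3 h4
    have h0 := hB.abs_coev_add_of_nrm h' i
    rw [map_add] at h0
    rcases abs_between h0 with h1 | h1
    · exact absurd h1.1 (not_le.2 hpos)
    · have := h1.2
      rw [← neg_sub, map_neg]
      exact neg_nonneg.2 this
  · rw [← hz]; congr 1; abel
  · rw [← hx]; congr 1; abel

/-- Walk from `e p` to `y` in an apartment containing both, one dual direction at a time. Finitely
many apartments asymptotic to `e` cover the path, and `Behind` propagates inside each of them. -/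
theorem exists_common_of_regular_aux [Nontrivial Λ] (hA : IsAffineBuilding P B T A)
    (hB : IsBasis P B) {e : ModelSpace F M Λ → X} (he : e ∈ A) {p v₀ : ModelSpace F M Λ}
    (hv₀ : ∀ b : B, 0 < coev P b v₀) {y : X}
    (hd : chartDist P B A (e (p + v₀)) (e p) + chartDist P B A (e p) y =
      chartDist P B A (e (p + v₀)) y) :
    Behind P B A e v₀ (e (p + v₀)) (e p) y := by
  obtain ⟨g, hg, ⟨q, hq⟩, ⟨u, hu⟩⟩ := hA.a3 (e p) y
  obtain ⟨w, hw⟩ := hB.exists_act_mem (u - q)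
  obtain ⟨g, hg, q, u, hq, hu, huC⟩ :
      ∃ g ∈ A, ∃ q u, g q = e p ∧ g (q + u) = y ∧ u ∈ fundChamber P B := by
    refine ⟨_, hA.comp_act_mem hg w⁻¹, act w.1 q, act w.1 (u - q), ?_, ?_, hw⟩
    · rw [Function.comp_apply, act_inv_act, hq]
    · rw [Function.comp_apply, ← map_add, act_inv_act, add_sub_cancel, hu]
  obtain ⟨H, hfin, hH, hcov⟩ := hA.exists_finite_cover hB he hg
  set x := e (p + v₀) with hx
  set z := e p with hz
  -- moving along a monotone path from `z` to `y`
  have hdist : ∀ u₁ ∈ fundChamber P B, ∀ u₂, u₂ - u₁ ∈ fundChamber P B →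
      u - u₂ ∈ fundChamber P B →
      chartDist P B A x (g (q + u₁)) + chartDist P B A (g (q + u₁)) (g (q + u₂)) =
        chartDist P B A x (g (q + u₂)) := by
    intro u₁ h1 u₂ h2 h3
    have e1 : chartDist P B A z y = chartDist P B A z (g (q + u₁)) +
        chartDist P B A (g (q + u₁)) (g (q + u₂)) + chartDist P B A (g (q + u₂)) y := by
      rw [← hq, ← hu, hA.chartDist_eq hB hg, hA.chartDist_eq hB hg, hA.chartDist_eq hB hg,
        hA.chartDist_eq hB hg]
      have e2 : q + u - q = u₁ + (u₂ - u₁) + (u - u₂) := by abel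
      rw [e2, nrm_add_of_mem (add_mem_fundChamber h1 h2) h3, nrm_add_of_mem h1 h2]
      rw [add_sub_add_left_eq_sub, add_sub_add_left_eq_sub, add_sub_cancel_left]
    refine le_antisymm ?_ (hA.chartDist_triangle hB _ _ _)
    have t1 := hA.chartDist_triangle hB x (g (q + u₂)) y
    have t2 := hA.chartDist_triangle hB x z (g (q + u₁))
    rw [← hd, e1, ← add_assoc, add_le_add_iff_right] at t1
    refine le_trans ?_ t1
    rw [← add_assoc]
    gcongr
  have hstep : ∀ s : Finset B, Behind P B A e v₀ x z
      (g (q + ∑ b ∈ s, hB.dualVec b ⊗ₜ[F] coev P b u)) := by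
    intro s
    induction s using Finset.induction_on with
    | empty =>
      rw [Finset.sum_empty, add_zero, hq]
      exact ⟨e, he, Asym.refl e, p, 0, zero_mem_fundChamber, rfl, by rw [add_zero], by
        rw [add_zero]⟩
    | insert b s hb ih =>
      rw [Finset.sum_insert hb]
      set u₁ := ∑ b ∈ s, hB.dualVec b ⊗ₜ[F] coev P b u with hu₁
      have hl : 0 ≤ coev P b u := hB.mem_fundChamber_iff.1 huC b
      have hco : ∀ b' : B, coev P b' u₁ = if b' ∈ s then coev P b' u else 0 := by
        intro b'
        simp [hu₁, map_sum, coev_tmul, hB.coroot'_dualVec]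
      have hcd : ∀ (t : Λ) (b' : B), coev P b' (hB.dualVec b ⊗ₜ[F] t) = if b' = b then t else 0 :=
        fun t b' => by simp [coev_tmul, hB.coroot'_dualVec]
      -- The parameters for which the path lies in a given apartment form an interval, by convexity
      -- of the overlap.
      have hIcc : ∀ k ∈ hfin.toFinset, ∃ a c : Λ, ∀ t,
          (t ∈ Set.Icc 0 (coev P b u) ∧ g (q + (hB.dualVec b ⊗ₜ[F] t + u₁)) ∈ Set.range k) ↔
            t ∈ Set.Icc a c := by
        intro k hk
        by_cases hne : ∃ t, g (q + (hB.dualVec b ⊗ₜ[F] t + u₁)) ∈ Set.range k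
        · obtain ⟨t₀, ht₀⟩ := hne
          obtain ⟨S, -, hS⟩ := hA.convex hg (hH k (hfin.mem_toFinset.1 hk)).1 ht₀
          obtain ⟨a, c, h⟩ := exists_Icc_of_forall_smul_le S
            (fun j => P.coroot' j.1 (hB.dualVec b))
            (fun j => j.2 - coev P j.1 (q + u₁)) 0 (coev P b u)
          refine ⟨a, c, fun t => ?_⟩
          rw [← h, and_congr_right_iff]
          intro _
          change (q + (hB.dualVec b ⊗ₜ[F] t + u₁)) ∈ g ⁻¹' Set.range k ↔ _
          rw [hS]
          simp only [Set.mem_iInter]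
          refine forall₂_congr fun j _ => ?_
          change j.2 ≤ coev P j.1 _ ↔ _
          rw [show q + (hB.dualVec b ⊗ₜ[F] t + u₁) = (q + u₁) + hB.dualVec b ⊗ₜ[F] t by abel,
            map_add, coev_tmul, sub_le_iff_le_add']
        · push Not at hne
          obtain ⟨m, hm⟩ := exists_zero_lt (α := Λ)
          exact ⟨m, 0, fun t => ⟨fun h => absurd h.2 (hne t),
            fun h => absurd (h.1.trans h.2) (not_le.2 hm)⟩⟩
      choose! a c hac using hIcc
      have hfinal := of_finite_Icc_cover F hfin.toFinset a c hl ?_ ?_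
        (Q := fun t => Behind P B A e v₀ x z (g (q + (hB.dualVec b ⊗ₜ[F] t + u₁)))) ?_ ?_
      · exact hfinal
      · intro t ht
        obtain ⟨k, hk, hkt⟩ := hcov (q + (hB.dualVec b ⊗ₜ[F] t + u₁))
        exact ⟨k, hfin.mem_toFinset.2 hk, (hac k (hfin.mem_toFinset.2 hk) t).1 ⟨ht, hkt⟩⟩
      · exact fun k hk t ht => ((hac k hk t).2 ht).1.2
      · simpa using ih
      · intro k hk t ht t' ht' hle hQ
        obtain ⟨ht1, ht2⟩ := (hac k hk t).2 ht
        obtain ⟨ht1', ht2'⟩ := (hac k hk t').2 ht'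
        obtain ⟨hkA, hke⟩ := hH k (hfin.mem_toFinset.1 hk)
        refine Behind.step hA hB hv₀ hkA hke.symm ht2 ht2' hQ (hdist _ ?_ _ ?_ ?_) <;>
        · refine hB.mem_fundChamber_iff.2 fun b' => ?_
          simp only [map_add, map_sub, hco, hcd]
          have hb' : 0 ≤ coev P b' u := hB.mem_fundChamber_iff.1 huC b'
          have := ht1.1
          have := ht1'.1
          have := ht1'.2
          by_cases h1 : b' = b
          · subst h1
            simp [*]
          · by_cases h2 : b' ∈ s <;> simp [h1, h2, hb']
  have := hstep Finset.univ
  rwa [hB.sum_dualVec_tmul, hu] at this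

/-- A Weyl element moves the regular leg into the fundamental chamber. -/
theorem exists_common_of_regular [Nontrivial Λ] (hA : IsAffineBuilding P B T A)
    (hB : IsBasis P B) {e : ModelSpace F M Λ → X} (he : e ∈ A) {p q : ModelSpace F M Λ}
    (hpq : ∀ i, coev P i (q - p) ≠ 0) {y : X}
    (hd : chartDist P B A (e q) (e p) + chartDist P B A (e p) y = chartDist P B A (e q) y) :
    ∃ k ∈ A, e q ∈ Set.range k ∧ e p ∈ Set.range k ∧ y ∈ Set.range k := by
  obtain ⟨w, hw⟩ := hB.exists_act_mem (q - p)
  have hv : ∀ b : B, 0 < coev P b (act w.1 (q - p)) := fun b =>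
    lt_of_le_of_ne (hB.mem_fundChamber_iff.1 hw b) (by rw [coev_act']; exact (hpq _).symm)
  have e1 : (e ∘ act w⁻¹.1) (act w.1 p + act w.1 (q - p)) = e q := by
    rw [Function.comp_apply, ← map_add, act_inv_act, add_sub_cancel]
  have e2 : (e ∘ act w⁻¹.1) (act w.1 p) = e p := by rw [Function.comp_apply, act_inv_act]
  obtain ⟨k, hk, -, r, v, -, h1, h2, h3⟩ :=
    hA.exists_common_of_regular_aux hB (hA.comp_act_mem he w⁻¹) hv (by rwa [e1, e2])
  exact ⟨k, hk, ⟨_, h3.trans e1⟩, ⟨_, h2.trans e2⟩, ⟨_, h1⟩⟩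

/-- Apartments contain the metric segments between any two of their points. -/
theorem mem_range_of_dist_add [Nontrivial Λ] (hA : IsAffineBuilding P B T A)
    (hB : IsBasis P B) {f : ModelSpace F M Λ → X} (hf : f ∈ A) {x y z : X}
    (hx : x ∈ Set.range f) (hy : y ∈ Set.range f)
    (hd : chartDist P B A x z + chartDist P B A z y = chartDist P B A x y) :
    z ∈ Set.range f := by
  obtain ⟨p, rfl⟩ := hx
  obtain ⟨q, rfl⟩ := hy
  obtain ⟨w, hw⟩ := hB.exists_act_mem (q - p)
  obtain ⟨κ₀, hκ₀⟩ := hB.exists_regular (Λ := Λ)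
  -- The segment is prolonged backwards by a regular vector from a chamber containing `q - p`, so
  -- that `f p` lies between the new endpoint and `f q` and one leg becomes regular.
  set κ := act w⁻¹.1 κ₀ with hκ
  have hκr : ∀ i, coev P i κ ≠ 0 := by
    intro i
    rw [hκ, coev_act']
    by_cases h : IsPos P B (wperm w⁻¹⁻¹ i)
    · exact (hB.coev_pos_of_simple hκ₀ h).ne'
    · have := (hB.coev_pos_of_simple hκ₀ ((hB.isPos_nidx_iff _).2 h)).ne'
      rwa [coev_nidx, neg_ne_zero] at this
  have e0 : nrm P B (q - (p - κ)) = nrm P B κ + nrm P B (q - p) := by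
    have : q - (p - κ) = act w⁻¹.1 (κ₀ + act w.1 (q - p)) := by
      rw [map_add, act_inv_act]; abel
    rw [this, hB.nrm_act, nrm_add_of_mem (hB.mem_fundChamber_iff.2 fun b => (hκ₀ b).le) hw,
      hB.nrm_act, hκ, hB.nrm_act]
  have e1 : chartDist P B A (f (p - κ)) (f q) =
      chartDist P B A (f (p - κ)) (f p) + chartDist P B A (f p) (f q) := by
    rw [hA.chartDist_eq hB hf, hA.chartDist_eq hB hf, hA.chartDist_eq hB hf, e0, sub_sub_cancel]
  have t1 := hA.chartDist_triangle hB (f (p - κ)) (f p) z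
  have t2 := hA.chartDist_triangle hB (f (p - κ)) z (f q)
  rw [e1, ← hd, ← add_assoc, add_le_add_iff_right] at t2
  have d1 := le_antisymm t2 t1
  have d2 : chartDist P B A (f (p - κ)) z + chartDist P B A z (f q) =
      chartDist P B A (f (p - κ)) (f q) := by rw [e1, ← d1, add_assoc, hd]
  obtain ⟨k, hk, ⟨a, ha⟩, ⟨b, hb⟩, ⟨c, hc⟩⟩ := hA.exists_common_of_regular hB hf
    (p := p) (q := p - κ) (y := z) (fun i => by
      rw [sub_sub_cancel_left, map_neg]; exact neg_ne_zero.2 (hκr i)) d1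
  -- the difference of `f (p - κ)` and `z` is regular in the coordinates of `k`
  obtain ⟨w', t, hwt⟩ := hA.exists_transition hf hk ⟨f p, ⟨p, rfl⟩, b, hb⟩
  have hab : b - a = act w'.1 κ := by
    have h1 := hA.injective k hk (ha.trans (hwt _ ⟨a, ha⟩))
    have h2 := hA.injective k hk (hb.trans (hwt _ ⟨b, hb⟩))
    rw [h1, h2, map_sub]; abel
  have hac : ∀ i, coev P i (a - c) ≠ 0 := by
    intro i
    have d3 := d1
    rw [← ha, ← hb, ← hc, hA.chartDist_eq hB hk, hA.chartDist_eq hB hk,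
      hA.chartDist_eq hB hk] at d3
    have d4 : nrm P B ((b - a) + (c - b)) = nrm P B (b - a) + nrm P B (c - b) := by
      rw [d3]; congr 1; abel
    have d5 := hB.abs_coev_add_of_nrm d4 i
    have : |coev P i (b - a)| ≠ 0 := by
      rw [hab, coev_act']; exact abs_ne_zero.2 (hκr _)
    have h6 : 0 < |coev P i (b - a + (c - b))| := by
      rw [d5]; exact add_pos_of_pos_of_nonneg (lt_of_le_of_ne (abs_nonneg _) this.symm)
        (abs_nonneg _)
    have h7 : a - c = -(b - a + (c - b)) := by abel
    rw [h7, map_neg]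
    exact neg_ne_zero.2 (abs_pos.1 h6)
  rw [← ha, ← hc] at d2
  -- Second use of regularity: the leg from the new endpoint to `z` is now known to be regular, so
  -- the new endpoint, `z` and `f q` lie in one apartment.
  obtain ⟨k', hk', ⟨a', ha'⟩, ⟨c', hc'⟩, ⟨r', hr'⟩⟩ := hA.exists_common_of_regular hB hk hac d2
  rw [← hc, ← hc']
  refine hA.mem_range_of_common hB hf hk' (p := a') (q := r') ⟨p - κ, ?_⟩ ⟨q, hr'.symm⟩ ?_
  · rw [ha', ha]
  · rw [← ha', ← hc', ← hr', hA.chartDist_eq hB hk', hA.chartDist_eq hB hk',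
      hA.chartDist_eq hB hk'] at d2
    exact d2

end IsAffineBuilding
end Building

/-- Two partial orders that are images of the same preorder are isomorphic. -/
theorem exists_orderIso_of_le_iff {Q α β : Type*} [PartialOrder α] [PartialOrder β] (a : Q → α)
    (b : Q → β) (ha : Function.Surjective a) (hb : Function.Surjective b)
    (h : ∀ q q', a q ≤ a q' ↔ b q ≤ b q') : ∃ φ : α ≃o β, ∀ q, φ (a q) = b q := by
  choose s hs using ha
  choose t ht using hb
  have h1 : ∀ q, b (s (a q)) = b q := fun q =>
    le_antisymm ((h _ _).1 (hs _).le) ((h _ _).1 (hs _).ge)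
  have h2 : ∀ q, a (t (b q)) = a q := fun q =>
    le_antisymm ((h _ _).2 (ht _).le) ((h _ _).2 (ht _).ge)
  refine ⟨⟨⟨fun c => b (s c), fun d => a (t d), fun c => ?_, fun d => ?_⟩, ?_⟩, h1⟩
  · beta_reduce; rw [h2, hs]
  · beta_reduce; rw [h1, ht]
  · intro c c'
    change b (s c) ≤ b (s c') ↔ c ≤ c'
    rw [← h, hs, hs]

section Building
variable {F : Subfield ℝ} {ι M N Λ X : Type*} [Fintype ι] [AddCommGroup M] [Module F M]
  [AddCommGroup N] [Module F N] {P : RootPairing ι F M N} [P.IsRootSystem] {B : Set ι}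
  [AddCommGroup Λ] [LinearOrder Λ] [IsOrderedAddMonoid Λ] [Module F Λ] [PosSMulMono F Λ]
  {T : AddSubgroup (ModelSpace F M Λ)} {A : Set (ModelSpace F M Λ → X)}

/-! ### Faces of the fundamental chamber and parabolic subgroups -/

variable (Λ) in
/-- The face of the fundamental chamber given by a set of simple roots. -/
def face (P : RootPairing ι F M N) (B : Set ι) (J : Set B) : Set (ModelSpace F M Λ) :=
  fundFace P B ((↑) '' J)

theorem mem_face {J : Set B} {v : ModelSpace F M Λ} :
    v ∈ face Λ P B J ↔ v ∈ fundChamber P B ∧ ∀ b ∈ J, coev P b v = 0 := by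
  simp [face, fundFace]

theorem face_anti {J J' : Set B} (h : J ⊆ J') : face Λ P B J' ⊆ face Λ P B J := fun v hv => by
  rw [mem_face] at hv ⊢
  exact ⟨hv.1, fun b hb => hv.2 b (h hb)⟩

/-- The standard parabolic subgroup generated by a set of simple reflections. -/
def parab (P : RootPairing ι F M N) (B : Set ι) (J : Set B) : Subgroup (weylGroup P) :=
  Subgroup.closure (simpleReflection P B '' J)

theorem parab_mono {J J' : Set B} (h : J ⊆ J') : parab P B J ≤ parab P B J' :=
  Subgroup.closure_mono (Set.image_mono h)

theorem act_eq_of_mem_parab {J : Set B} {w : weylGroup P} (hw : w ∈ parab P B J)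
    {v : ModelSpace F M Λ} (hv : ∀ b ∈ J, coev P b v = 0) : act w.1 v = v := by
  induction hw using Subgroup.closure_induction with
  | mem w h =>
    obtain ⟨b, hb, rfl⟩ := h
    exact act_reflection_of_eq_zero (hv b hb)
  | one => exact act_one v
  | mul w w' _ _ h h' => rw [Subgroup.coe_mul, act_mul, h', h]
  | inv w _ h => nth_rw 1 [← h]; exact act_inv_act w v

/-- Arbitrarily small vectors in the relative interior of a face; such points detect germs. -/
theorem IsBasis.exists_generic_lt (hB : IsBasis P B) (J : Set B) {e : Λ} (he : 0 < e) :
    ∃ v ∈ fundChamber P B, (∀ b : B, coev P b v = 0 ↔ b ∈ J) ∧ nrm P B v < e := by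
  obtain ⟨v, hv, hve⟩ := hB.exists_regular_lt (M := M) he
  obtain ⟨u, hu⟩ := hB.exists_coev_eq (fun b : B => if b ∈ J then 0 else coev P b v)
  have hu0 : u ∈ fundChamber P B := hB.mem_fundChamber_iff.2 fun b => by
    rw [hu]; split_ifs; exacts [le_rfl, (hv b).le]
  refine ⟨u, hu0, fun b => ?_, lt_of_le_of_lt (Finset.sum_le_sum fun i hi => ?_) hve⟩
  · rw [hu]
    split_ifs with h
    · simp [h]
    · simp [h, (hv b).ne']
  · have hi : IsPos P B i := by simpa using hi
    rw [abs_of_nonneg (hu0 i hi), abs_of_nonneg (hB.coev_pos_of_simple hv hi).le]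
    refine hB.coev_le_of_simple (fun b => ?_) hi
    rw [hu]; split_ifs; exacts [(hv b).le, le_rfl]

theorem IsBasis.mem_parab_of_act_eq (hB : IsBasis P B) {J : Set B} {v : ModelSpace F M Λ}
    (hv : v ∈ fundChamber P B) (hJ : ∀ b : B, coev P b v = 0 ↔ b ∈ J) {w : weylGroup P}
    (h : act w.1 v = v) : w ∈ parab P B J := by
  have := (hB.act_eq_of_mem hv w (h.symm ▸ hv)).2
  rwa [show {b : B | coev P (b : ι) v = 0} = J from Set.ext hJ] at this

/-- The support of a Weyl group element: the smallest set of simple reflections generating a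
subgroup that contains it. -/
def supp (hB : IsBasis P B) (w : weylGroup P) : Set B :=
  {b | act w.1 (hB.dualVec b ⊗ₜ[F] (1 : F)) ≠ hB.dualVec b ⊗ₜ[F] (1 : F)}

/-- Dual vectors outside `J` are fixed by the parabolic of `J`; conversely their sum vanishes on
exactly the simple coroots in `J`, so its stabilizer is that parabolic. This yields greatest lower
bounds in the residue. -/
theorem mem_parab_iff (hB : IsBasis P B) {J : Set B} {w : weylGroup P} :
    w ∈ parab P B J ↔ supp hB w ⊆ J := by
  constructor
  · intro h b hb
    by_contra hbJ
    refine hb (act_eq_of_mem_parab h fun b' hb' => ?_)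
    rw [coev_tmul, hB.coroot'_dualVec, if_neg (fun e : b' = b => hbJ (e ▸ hb')), zero_smul]
  · intro h
    refine hB.mem_parab_of_act_eq (v := ∑ b ∈ Finset.univ.filter (· ∉ J),
      hB.dualVec b ⊗ₜ[F] (1 : F)) ?_ ?_ ?_
    · refine hB.mem_fundChamber_iff.2 fun b => ?_
      rw [map_sum]
      refine Finset.sum_nonneg fun b' _ => ?_
      rw [coev_tmul, hB.coroot'_dualVec]
      split_ifs <;> simp
    · intro b
      simp [map_sum, coev_tmul, hB.coroot'_dualVec]
    · rw [map_sum]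
      refine Finset.sum_congr rfl fun b hb => ?_
      by_contra hne
      exact (Finset.mem_filter.1 hb).2 (h hne)

theorem simpleReflection_mem_parab_iff (hB : IsBasis P B) {J : Set B} {b : B} :
    simpleReflection P B b ∈ parab P B J ↔ b ∈ J := by
  refine ⟨fun h => ?_, fun h => Subgroup.subset_closure ⟨b, h, rfl⟩⟩
  obtain ⟨v, hv, hJ, -⟩ := hB.exists_generic_lt (M := M) J (one_pos (α := F))
  have h1 := act_eq_of_mem_parab h fun b hb => (hJ b).2 hb
  have h2 : coev P b (act (P.reflection b) v) = coev P b v := congrArg _ h1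
  rw [act_reflection, map_sub, coev_tmul, P.root_coroot'_eq_pairing, P.pairing_same] at h2
  rw [← hJ]
  have h3 : (2 : F) • coev P b v = 0 := by
    rw [← sub_sub_cancel (coev P b v) ((2 : F) • coev P b v), h2, sub_self]
  simpa using h3

theorem parab_le_iff (hB : IsBasis P B) {J J' : Set B} :
    parab P B J ≤ parab P B J' ↔ J ⊆ J' :=
  ⟨fun h _ hb => (simpleReflection_mem_parab_iff hB).1
    (h ((simpleReflection_mem_parab_iff hB).2 hb)), parab_mono⟩

/-! ### Weyl simplices at a point -/

/-- The Weyl simplex based at `f p` of type `J` in direction `w`. -/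
def simplexAt (P : RootPairing ι F M N) (B : Set ι) (f : ModelSpace F M Λ → X)
    (p : ModelSpace F M Λ) (w : weylGroup P) (J : Set B) : Set X :=
  (fun v => f (p + act w.1 v)) '' face Λ P B J

theorem simplexAt_anti {f : ModelSpace F M Λ → X} {p : ModelSpace F M Λ} {w : weylGroup P}
    {J J' : Set B} (h : J ⊆ J') : simplexAt P B f p w J' ⊆ simplexAt P B f p w J :=
  Set.image_mono (face_anti h)

theorem simplexAt_subset_range {f : ModelSpace F M Λ → X} {p : ModelSpace F M Λ}
    {w : weylGroup P} {J : Set B} : simplexAt P B f p w J ⊆ Set.range f := by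
  rintro _ ⟨v, -, rfl⟩
  exact ⟨_, rfl⟩

theorem image_image_fundFace (f : ModelSpace F M Λ → X) (p : ModelSpace F M Λ) (w : weylGroup P)
    (J : Set B) :
    f '' ((fun v => act w.1 v + p) '' fundFace P B ((↑) '' J)) = simplexAt P B f p w J := by
  rw [Set.image_image]
  exact Set.image_congr fun v _ => by rw [add_comm]

theorem exists_set_subtype {J : Set ι} (h : J ⊆ B) : ∃ K : Set B, (↑) '' K = J :=
  ⟨(↑) ⁻¹' J, by rw [Subtype.image_preimage_coe, Set.inter_eq_right.2 h]⟩

theorem isWeylSimplexAt_iff {x : X} {S : Set X} : IsWeylSimplexAt P B A x S ↔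
    ∃ f ∈ A, ∃ p, ∃ (w : weylGroup P) (J : Set B), f p = x ∧ S = simplexAt P B f p w J := by
  constructor
  · rintro ⟨f, hf, _, ⟨w, hw, p, -, rfl⟩, J, hJ, hx, rfl⟩
    obtain ⟨J, rfl⟩ := exists_set_subtype hJ
    refine ⟨f, hf, p, ⟨w, hw⟩, J, by simpa using hx, ?_⟩
    rw [← image_image_fundFace]
  · rintro ⟨f, hf, p, w, J, hx, rfl⟩
    refine ⟨f, hf, _, ⟨w.1, w.2, p, trivial, rfl⟩, (↑) '' J, Subtype.coe_image_subset _ _,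
      by simpa using hx, ?_⟩
    rw [← image_image_fundFace]

theorem isFaceAt_iff {x : X} {S₁ S₂ : Set X} : IsFaceAt P B A x S₁ S₂ ↔
    ∃ f ∈ A, ∃ p, ∃ (w : weylGroup P) (J₁ J₂ : Set B), J₂ ⊆ J₁ ∧ f p = x ∧
      S₁ = simplexAt P B f p w J₁ ∧ S₂ = simplexAt P B f p w J₂ := by
  constructor
  · rintro ⟨f, hf, _, ⟨w, hw, p, -, rfl⟩, J, hJ, J', hJ', hx, rfl, rfl⟩
    obtain ⟨J', rfl⟩ := exists_set_subtype (hJ'.trans hJ)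
    obtain ⟨J, rfl⟩ := exists_set_subtype hJ
    refine ⟨f, hf, p, ⟨w, hw⟩, J, J', (Set.image_subset_image_iff Subtype.val_injective).1 hJ',
      by simpa using hx, ?_, ?_⟩
    · rw [← image_image_fundFace]
    · rw [← image_image_fundFace]
  · rintro ⟨f, hf, p, w, J, J', hJ, hx, rfl, rfl⟩
    refine ⟨f, hf, _, ⟨w.1, w.2, p, trivial, rfl⟩, (↑) '' J, Subtype.coe_image_subset _ _,
      (↑) '' J', Set.image_mono hJ, by simpa using hx, ?_, ?_⟩
    · rw [← image_image_fundFace]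
    · rw [← image_image_fundFace]

/-- `S` is contained in `S'` near `x`. -/
def LocLE (P : RootPairing ι F M N) (B : Set ι) (A : Set (ModelSpace F M Λ → X)) (x : X)
    (S S' : Set X) : Prop :=
  ∃ e : Λ, 0 < e ∧ ∀ y ∈ S, chartDist P B A x y < e → y ∈ S'

theorem LocLE.of_subset [Nontrivial Λ] {x : X} {S S' : Set X} (h : S ⊆ S') :
    LocLE P B A x S S' := by
  obtain ⟨e, he⟩ := exists_zero_lt (α := Λ)
  exact ⟨e, he, fun y hy _ => h hy⟩

theorem LocLE.trans {x : X} {S S' S'' : Set X} (h : LocLE P B A x S S')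
    (h' : LocLE P B A x S' S'') : LocLE P B A x S S'' := by
  obtain ⟨e, he, h⟩ := h
  obtain ⟨e', he', h'⟩ := h'
  exact ⟨min e e', lt_min he he', fun y hy hd => h' y (h y hy (hd.trans_le (min_le_left _ _)))
    (hd.trans_le (min_le_right _ _))⟩

theorem germ_eq_iff [Nontrivial Λ] {x : X} {S S' : Set X} :
    germ P B A x S = germ P B A x S' ↔ LocLE P B A x S S' ∧ LocLE P B A x S' S := by
  have heq := sameGerm_equivalence P B A x
  have h1 : germ P B A x S = germ P B A x S' ↔ SameGerm P B A x S S' := by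
    constructor
    · intro h
      have : S' ∈ germ P B A x S := h ▸ heq.refl S'
      exact this
    · intro h
      ext S''
      exact ⟨fun h' => heq.trans (heq.symm h) h', fun h' => heq.trans h h'⟩
  rw [h1]
  constructor
  · rintro ⟨e, he, h, h'⟩
    exact ⟨⟨e, he, fun y hy hd => (h ⟨hy, hd⟩).2⟩, ⟨e, he, fun y hy hd => (h' ⟨hy, hd⟩).1⟩⟩
  · rintro ⟨⟨e, he, h⟩, ⟨e', he', h'⟩⟩
    refine ⟨min e e', lt_min he he', ?_, ?_⟩
    · rintro y ⟨hy, hd⟩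
      exact ⟨hy, h y hy (lt_of_lt_of_le hd (min_le_left _ _))⟩
    · rintro y ⟨hy, hd⟩
      exact ⟨h' y hy (lt_of_lt_of_le hd (min_le_right _ _)), hy⟩

namespace IsAffineBuilding

variable [Nontrivial Λ] {x : X}

theorem chartDist_add (hA : IsAffineBuilding P B T A) (hB : IsBasis P B)
    {f : ModelSpace F M Λ → X} (hf : f ∈ A) {p : ModelSpace F M Λ} (hp : f p = x)
    (v : ModelSpace F M Λ) : chartDist P B A x (f (p + v)) = nrm P B v := by
  rw [← hp, hA.chartDist_eq hB hf, add_sub_cancel_left]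

/-- Test with a small relatively interior point of the first simplex. The fundamental domain
property forces its coordinate in the second simplex to be the same vector, and its stabilizer is
the parabolic of `J`. -/
theorem simplexAt_subset (hA : IsAffineBuilding P B T A) (hB : IsBasis P B)
    {f : ModelSpace F M Λ → X} (hf : f ∈ A) {p : ModelSpace F M Λ} (hp : f p = x)
    {w w' : weylGroup P} {J J' : Set B} :
    LocLE P B A x (simplexAt P B f p w J) (simplexAt P B f p w' J') ↔
      J' ⊆ J ∧ w⁻¹ * w' ∈ parab P B J := by
  constructor
  · rintro ⟨e, he, h⟩
    obtain ⟨v, hv, hJ, hve⟩ := hB.exists_generic_lt (M := M) J he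
    obtain ⟨v', hv', heq⟩ := h (f (p + act w.1 v)) ⟨v, mem_face.2 ⟨hv, fun b hb => (hJ b).2 hb⟩,
      rfl⟩ (by rwa [hA.chartDist_add hB hf hp, hB.nrm_act])
    have h1 : act w'.1 v' = act w.1 v := add_left_cancel (hA.injective f hf heq)
    rw [mem_face] at hv'
    have h2 : act (w⁻¹ * w').1 v' = v := by
      rw [Subgroup.coe_mul, act_mul, h1, act_inv_act]
    have h3 := (hB.act_eq_of_mem hv'.1 (w⁻¹ * w') (h2.symm ▸ hv)).1
    have h4 : v = v' := h2.symm.trans h3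
    subst h4
    exact ⟨fun b hb => (hJ b).1 (hv'.2 b hb), hB.mem_parab_of_act_eq hv hJ h2⟩
  · rintro ⟨h1, h2⟩
    refine LocLE.of_subset ?_
    rintro _ ⟨v, hv, rfl⟩
    refine ⟨v, face_anti h1 hv, ?_⟩
    have := act_eq_of_mem_parab h2 (mem_face.1 hv).2
    rw [Subgroup.coe_mul, act_mul] at this
    beta_reduce
    conv_rhs => rw [← this, act_act_inv]

theorem germ_simplexAt_eq_iff (hA : IsAffineBuilding P B T A) (hB : IsBasis P B)
    {f : ModelSpace F M Λ → X} (hf : f ∈ A) {p : ModelSpace F M Λ} (hp : f p = x)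
    {w w' : weylGroup P} {J J' : Set B} :
    germ P B A x (simplexAt P B f p w J) = germ P B A x (simplexAt P B f p w' J') ↔
      J' = J ∧ w⁻¹ * w' ∈ parab P B J := by
  rw [germ_eq_iff, hA.simplexAt_subset hB hf hp, hA.simplexAt_subset hB hf hp]
  constructor
  · rintro ⟨⟨h1, h2⟩, ⟨h3, -⟩⟩
    exact ⟨h1.antisymm h3, h2⟩
  · rintro ⟨rfl, h⟩
    refine ⟨⟨subset_rfl, h⟩, subset_rfl, ?_⟩
    rw [← inv_mem_iff]; simpa using h

/-- Germs near a point contained in two apartments correspond under the transition. -/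
theorem exists_germ_transition (hA : IsAffineBuilding P B T A) (hB : IsBasis P B)
    {f g : ModelSpace F M Λ → X} (hf : f ∈ A) (hg : g ∈ A) {p q : ModelSpace F M Λ}
    (hp : f p = x) (hq : g q = x) :
    ∃ u : weylGroup P, ∀ (w : weylGroup P) (J : Set B),
      LocLE P B A x (simplexAt P B g q w J) (Set.range f) →
      germ P B A x (simplexAt P B g q w J) = germ P B A x (simplexAt P B f p (u * w) J) := by
  obtain ⟨u, t, hu⟩ := hA.exists_transition hg hf ⟨x, ⟨q, hq⟩, ⟨p, hp⟩⟩
  have e1 : act u.1 q + t = p :=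
    hA.injective f hf (((hu q ⟨p, hp.trans hq.symm⟩).symm.trans hq).trans hp.symm)
  refine ⟨u, fun w J => ?_⟩
  rintro ⟨e, he, h⟩
  have key : ∀ v ∈ face Λ P B J, nrm P B v < e →
      g (q + act w.1 v) = f (p + act (u * w).1 v) := by
    intro v hv hve
    rw [hu _ (h _ ⟨v, hv, rfl⟩ (by rwa [hA.chartDist_add hB hg hq, hB.nrm_act])), ← e1,
      map_add, Subgroup.coe_mul, act_mul]
    congr 1; abel
  rw [germ_eq_iff]
  constructor
  · refine ⟨e, he, ?_⟩
    rintro _ ⟨v, hv, rfl⟩ hd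
    rw [hA.chartDist_add hB hg hq, hB.nrm_act] at hd
    exact ⟨v, hv, (key v hv hd).symm⟩
  · refine ⟨e, he, ?_⟩
    rintro _ ⟨v, hv, rfl⟩ hd
    rw [hA.chartDist_add hB hf hp, hB.nrm_act] at hd
    exact ⟨v, hv, key v hv hd⟩

/-- Any two germs at `x` lie in a common apartment. -/
theorem exists_common_simplexAt (hA : IsAffineBuilding P B T A) (hB : IsBasis P B)
    {f g : ModelSpace F M Λ → X} (hf : f ∈ A) (hg : g ∈ A) {p q : ModelSpace F M Λ}
    (hp : f p = x) (hq : g q = x) (w w' : weylGroup P) :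
    ∃ k ∈ A, ∃ r, ∃ u : weylGroup P, k r = x ∧
      (∀ J, germ P B A x (simplexAt P B f p w J) = germ P B A x (simplexAt P B k r 1 J)) ∧
      ∀ J, germ P B A x (simplexAt P B g q w' J) = germ P B A x (simplexAt P B k r u J) := by
  have hp' : (f ∘ act w.1) (act w⁻¹.1 p) = x := by rw [Function.comp_apply, act_act_inv, hp]
  have hq' : (g ∘ act w'.1) (act w'⁻¹.1 q) = x := by rw [Function.comp_apply, act_act_inv, hq]
  obtain ⟨k, hk, r, u, h1, e, he, h2⟩ := hA.exists_common_germ hB (hA.comp_act_mem hf w)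
    (hA.comp_act_mem hg w') (hp'.trans hq'.symm)
  have hr : k r = x := by
    have := h1 0 zero_mem_fundChamber
    rw [add_zero, add_zero, hp'] at this
    exact this.symm
  simp only [Function.comp_apply, map_add, act_act_inv] at h1 h2
  refine ⟨k, hk, r, u, hr, fun J => ?_, fun J => ?_⟩
  · congr 1
    refine Set.image_congr fun v hv => ?_
    rw [h1 v (mem_face.1 hv).1, Subgroup.coe_one, act_one]
  · rw [germ_eq_iff]
    constructor
    · refine ⟨e, he, ?_⟩
      rintro _ ⟨v, hv, rfl⟩ hd
      rw [hA.chartDist_add hB hg hq, hB.nrm_act] at hd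
      exact ⟨v, hv, (h2 v (mem_face.1 hv).1 hd).symm⟩
    · refine ⟨e, he, ?_⟩
      rintro _ ⟨v, hv, rfl⟩ hd
      rw [hA.chartDist_add hB hk hr, hB.nrm_act] at hd
      exact ⟨v, hv, h2 v (mem_face.1 hv).1 hd⟩

/-- The inclusion of germs is the local inclusion of representatives. -/
theorem germLE_iff (hA : IsAffineBuilding P B T A) (hB : IsBasis P B) {S S' : Set X}
    (hS : IsWeylSimplexAt P B A x S) (hS' : IsWeylSimplexAt P B A x S') :
    germLE P B A x (germ P B A x S) (germ P B A x S') ↔ LocLE P B A x S S' := by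
  constructor
  · rintro ⟨S₁, S₂, h, h1, h2⟩
    obtain ⟨f, hf, p, w, J₁, J₂, hJ, hx, rfl, rfl⟩ := isFaceAt_iff.1 h
    exact (germ_eq_iff.1 h1).2.trans ((LocLE.of_subset (simplexAt_anti hJ)).trans
      (germ_eq_iff.1 h2).1)
  · intro h
    obtain ⟨f, hf, p, w, J, hp, rfl⟩ := isWeylSimplexAt_iff.1 hS
    obtain ⟨g, hg, q, w', J', hq, rfl⟩ := isWeylSimplexAt_iff.1 hS'
    obtain ⟨k, hk, r, u, hr, h1, h2⟩ := hA.exists_common_simplexAt hB hf hg hp hq w w'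
    have h3 := ((germ_eq_iff.1 (h1 J)).2.trans h).trans (germ_eq_iff.1 (h2 J')).1
    rw [hA.simplexAt_subset hB hk hr, inv_one, one_mul] at h3
    refine ⟨_, _, isFaceAt_iff.2 ⟨k, hk, r, u, J, J', h3.1, hr, rfl, rfl⟩, ?_, (h2 J').symm⟩
    rw [h1, eq_comm, hA.germ_simplexAt_eq_iff hB hk hr]
    exact ⟨rfl, by simpa using h3.2⟩

end IsAffineBuilding
end Building

section Building
variable {F : Subfield ℝ} {ι M N Λ X : Type*} [Fintype ι] [AddCommGroup M] [Module F M]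
  [AddCommGroup N] [Module F N] {P : RootPairing ι F M N} [P.IsRootSystem] {B : Set ι}
  [AddCommGroup Λ] [LinearOrder Λ] [IsOrderedAddMonoid Λ] [Module F Λ] [PosSMulMono F Λ]
  {T : AddSubgroup (ModelSpace F M Λ)} {A : Set (ModelSpace F M Λ → X)}

/-! ### The residue as a spherical building -/

/-- The simplices of the Coxeter complex, parametrized by group elements and types. -/
def coset (P : RootPairing ι F M N) (B : Set ι) (q : weylGroup P × Set B) :
    CoxeterComplex (simpleReflection P B) :=
  ⟨OrderDual.toDual ((fun v => q.1 * v) '' (parab P B q.2 : Set (weylGroup P))), q.1, q.2, rfl⟩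

theorem coset_surjective : Function.Surjective (coset P B) := by
  rintro ⟨C, w, J, h⟩
  exact ⟨(w, J), Subtype.ext h.symm⟩

/-- The same condition as for germs in one apartment, which is what identifies the apartments of the
residue with the Coxeter complex. -/
theorem coset_le_iff (hB : IsBasis P B) (q q' : weylGroup P × Set B) :
    coset P B q ≤ coset P B q' ↔ q'.2 ⊆ q.2 ∧ q.1⁻¹ * q'.1 ∈ parab P B q.2 := by
  change (fun v => q'.1 * v) '' (parab P B q'.2 : Set (weylGroup P)) ⊆
    (fun v => q.1 * v) '' (parab P B q.2 : Set (weylGroup P)) ↔ _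
  have hmem : ∀ v, v ∈ (fun v => q.1 * v) '' (parab P B q.2 : Set (weylGroup P)) ↔
      q.1⁻¹ * v ∈ parab P B q.2 := by
    intro v
    constructor
    · rintro ⟨u, hu, rfl⟩; simpa using hu
    · exact fun h => ⟨_, h, by simp⟩
  constructor
  · intro h
    have h1 := (hmem _).1 (h ⟨1, one_mem _, mul_one _⟩)
    refine ⟨(parab_le_iff hB).1 fun v hv => ?_, h1⟩
    have h2 := (hmem _).1 (h ⟨v, hv, rfl⟩)
    have := mul_mem (inv_mem h1) h2
    simpa [mul_assoc] using this
  · rintro ⟨h1, h2⟩ _ ⟨v, hv, rfl⟩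
    rw [hmem, ← mul_assoc]
    exact mul_mem h2 (parab_mono h1 hv)

theorem isWeylSimplexAt_simplexAt {x : X} {f : ModelSpace F M Λ → X} (hf : f ∈ A)
    {p : ModelSpace F M Λ} (hp : f p = x) (w : weylGroup P) (J : Set B) :
    IsWeylSimplexAt P B A x (simplexAt P B f p w J) :=
  isWeylSimplexAt_iff.2 ⟨f, hf, p, w, J, hp, rfl⟩

/-- The residue as a type of its own, without the order of `Set (Set X)`. -/
def Residue (P : RootPairing ι F M N) (B : Set ι) (A : Set (ModelSpace F M Λ → X)) (x : X) :
    Type _ :=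
  residue P B A x

/-- The germ of a Weyl simplex in a given chart, as an element of the residue. -/
def germAt {x : X} {f : ModelSpace F M Λ → X} (hf : f ∈ A) {p : ModelSpace F M Λ} (hp : f p = x)
    (q : weylGroup P × Set B) : Residue P B A x :=
  ⟨germ P B A x (simplexAt P B f p q.1 q.2), _, isWeylSimplexAt_simplexAt hf hp q.1 q.2, rfl⟩

theorem exists_eq_germAt {x : X} (μ : Residue P B A x) :
    ∃ (f : ModelSpace F M Λ → X) (hf : f ∈ A) (p : ModelSpace F M Λ) (hp : f p = x)
      (q : weylGroup P × Set B), μ = germAt hf hp q := by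
  obtain ⟨_, S, hS, rfl⟩ := μ
  obtain ⟨f, hf, p, w, J, hp, rfl⟩ := isWeylSimplexAt_iff.1 hS
  exact ⟨f, hf, p, hp, (w, J), rfl⟩

namespace IsAffineBuilding

variable [Nontrivial Λ] {x : X}

/-- The order on the residue: inclusion of germs. -/
abbrev residueOrder (hA : IsAffineBuilding P B T A) (hB : IsBasis P B) (x : X) :
    PartialOrder (Residue P B A x) where
  le μ ν := germLE P B A x μ.1 ν.1
  le_refl := by
    rintro ⟨_, S, hS, rfl⟩
    exact (hA.germLE_iff hB hS hS).2 (LocLE.of_subset subset_rfl)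
  le_trans := by
    rintro ⟨_, S, hS, rfl⟩ ⟨_, S', hS', rfl⟩ ⟨_, S'', hS'', rfl⟩ h h'
    exact (hA.germLE_iff hB hS hS'').2
      (((hA.germLE_iff hB hS hS').1 h).trans ((hA.germLE_iff hB hS' hS'').1 h'))
  le_antisymm := by
    rintro ⟨_, S, hS, rfl⟩ ⟨_, S', hS', rfl⟩ h h'
    exact Subtype.ext (germ_eq_iff.2
      ⟨(hA.germLE_iff hB hS hS').1 h, (hA.germLE_iff hB hS' hS).1 h'⟩)

theorem germAt_le (hA : IsAffineBuilding P B T A) (hB : IsBasis P B)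
    {f g : ModelSpace F M Λ → X} (hf : f ∈ A) (hg : g ∈ A) {p r : ModelSpace F M Λ}
    (hp : f p = x) (hr : g r = x) {q q' : weylGroup P × Set B} :
    (hA.residueOrder hB x).le (germAt hf hp q) (germAt hg hr q') ↔
      LocLE P B A x (simplexAt P B f p q.1 q.2) (simplexAt P B g r q'.1 q'.2) :=
  hA.germLE_iff hB (isWeylSimplexAt_simplexAt hf hp _ _) (isWeylSimplexAt_simplexAt hg hr _ _)

theorem germAt_le_iff (hA : IsAffineBuilding P B T A) (hB : IsBasis P B)
    {f : ModelSpace F M Λ → X} (hf : f ∈ A) {p : ModelSpace F M Λ} (hp : f p = x)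
    {q q' : weylGroup P × Set B} :
    (hA.residueOrder hB x).le (germAt hf hp q) (germAt hf hp q') ↔
      q'.2 ⊆ q.2 ∧ q.1⁻¹ * q'.1 ∈ parab P B q.2 := by
  rw [hA.germAt_le hB hf hf hp hp, hA.simplexAt_subset hB hf hp]

theorem germAt_eq_iff (hA : IsAffineBuilding P B T A) (hB : IsBasis P B)
    {f : ModelSpace F M Λ → X} (hf : f ∈ A) {p : ModelSpace F M Λ} (hp : f p = x)
    {q q' : weylGroup P × Set B} :
    (germAt hf hp q : Residue P B A x) = germAt hf hp q' ↔
      q'.2 = q.2 ∧ q.1⁻¹ * q'.1 ∈ parab P B q.2 := by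
  exact Subtype.ext_iff.trans (hA.germ_simplexAt_eq_iff hB hf hp)

theorem exists_germAt_transition (hA : IsAffineBuilding P B T A) (hB : IsBasis P B)
    {f g : ModelSpace F M Λ → X} (hf : f ∈ A) (hg : g ∈ A) {p r : ModelSpace F M Λ}
    (hp : f p = x) (hr : g r = x) :
    ∃ u : weylGroup P, ∀ q : weylGroup P × Set B,
      LocLE P B A x (simplexAt P B g r q.1 q.2) (Set.range f) →
      (germAt hg hr q : Residue P B A x) = germAt hf hp (u * q.1, q.2) := by
  obtain ⟨u, hu⟩ := hA.exists_germ_transition hB hf hg hp hr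
  exact ⟨u, fun q h => Subtype.ext (hu q.1 q.2 h)⟩

theorem locLE_range (hA : IsAffineBuilding P B T A) (hB : IsBasis P B)
    {f g : ModelSpace F M Λ → X} {hf : f ∈ A} {hg : g ∈ A} {p r : ModelSpace F M Λ}
    {hp : f p = x} {hr : g r = x} {q q' : weylGroup P × Set B}
    (h : (hA.residueOrder hB x).le (germAt hg hr q) (germAt hf hp q')) :
    LocLE P B A x (simplexAt P B g r q.1 q.2) (Set.range f) :=
  ((hA.germAt_le hB hg hf hr hp).1 h).trans (LocLE.of_subset simplexAt_subset_range)

theorem mem_residueApartments_iff (hA : IsAffineBuilding P B T A) (hB : IsBasis P B)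
    {E : Set (Residue P B A x)} : E ∈ (residueApartments P B A x : Set (Set (Residue P B A x))) ↔
      ∃ (f : ModelSpace F M Λ → X) (hf : f ∈ A) (p : ModelSpace F M Λ) (hp : f p = x),
        E = Set.range (germAt hf hp) := by
  have key : ∀ (f : ModelSpace F M Λ → X) (hf : f ∈ A) (p : ModelSpace F M Λ) (hp : f p = x),
      {μ | ∃ S, IsWeylSimplexAt P B A x S ∧ S ⊆ Set.range f ∧ μ = germ P B A x S} =
        Subtype.val '' (Set.range (germAt hf hp) : Set (Residue P B A x)) := by
    intro f hf p hp
    ext μ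
    constructor
    · rintro ⟨S, hS, hSf, rfl⟩
      obtain ⟨g, hg, r, w, J, hr, rfl⟩ := isWeylSimplexAt_iff.1 hS
      obtain ⟨u, hu⟩ := hA.exists_germAt_transition hB hf hg hp hr
      exact ⟨_, ⟨(u * w, J), (hu (w, J) (LocLE.of_subset hSf)).symm⟩, rfl⟩
    · rintro ⟨_, ⟨q, rfl⟩, rfl⟩
      exact ⟨_, isWeylSimplexAt_simplexAt hf hp _ _, simplexAt_subset_range, rfl⟩
  constructor
  · rintro ⟨f, hf, ⟨p, hp⟩, h⟩
    exact ⟨f, hf, p, hp, Set.image_injective.2 Subtype.val_injective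
      (h.trans (key f hf p hp))⟩
  · rintro ⟨f, hf, p, hp, rfl⟩
    exact ⟨f, hf, ⟨p, hp⟩, (key f hf p hp).symm⟩

theorem exists_of_le_germAt (hA : IsAffineBuilding P B T A) (hB : IsBasis P B)
    {f : ModelSpace F M Λ → X} (hf : f ∈ A) {p : ModelSpace F M Λ} (hp : f p = x)
    {q : weylGroup P × Set B} {μ : Residue P B A x}
    (h : (hA.residueOrder hB x).le μ (germAt hf hp q)) :
    ∃ J, q.2 ⊆ J ∧ μ = germAt hf hp (q.1, J) := by
  obtain ⟨g, hg, r, hr, q', rfl⟩ := exists_eq_germAt μ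
  obtain ⟨u, hu⟩ := hA.exists_germAt_transition hB hf hg hp hr
  have h1 := hu q' (hA.locLE_range hB h)
  rw [h1] at h ⊢
  obtain ⟨h2, h3⟩ := (hA.germAt_le_iff hB hf hp).1 h
  exact ⟨q'.2, h2, (hA.germAt_eq_iff hB hf hp).2 ⟨rfl, h3⟩⟩

theorem exists_common_germAt (hA : IsAffineBuilding P B T A) (hB : IsBasis P B)
    (μ ν : Residue P B A x) :
    ∃ (k : ModelSpace F M Λ → X) (hk : k ∈ A) (r : ModelSpace F M Λ) (hr : k r = x)
      (J J' : Set B) (u : weylGroup P), μ = germAt hk hr (1, J) ∧ ν = germAt hk hr (u, J') := by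
  obtain ⟨f, hf, p, hp, q, rfl⟩ := exists_eq_germAt μ
  obtain ⟨g, hg, r, hr, q', rfl⟩ := exists_eq_germAt ν
  obtain ⟨k, hk, s, u, hs, h1, h2⟩ := hA.exists_common_simplexAt hB hf hg hp hr q.1 q'.1
  exact ⟨k, hk, s, hs, q.2, q'.2, u, Subtype.ext (h1 _), Subtype.ext (h2 _)⟩

theorem isSimplicialPoset_residue (hA : IsAffineBuilding P B T A) (hB : IsBasis P B) (x : X) :
    @IsSimplicialPoset (Residue P B A x) (hA.residueOrder hB x) := by
  let _ := hA.residueOrder hB x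
  refine ⟨?_, fun μ ν => ?_, fun μ => ?_⟩
  · obtain ⟨f, hf, ⟨p, hp⟩, -⟩ := hA.a3 x x
    exact ⟨germAt hf hp (1, ∅)⟩
  · obtain ⟨k, hk, r, hr, J, J', u, rfl, rfl⟩ := hA.exists_common_germAt hB μ ν
    -- In a common apartment every common face is a face (1, K) of the first simplex, and the
    -- admissible `K` are those containing one explicit set. That set is the type of the meet.
    have hle : ∀ K, germAt hk hr (1, K) ≤ (germAt hk hr (1, J) : Residue P B A x) ∧
        germAt hk hr (1, K) ≤ (germAt hk hr (u, J') : Residue P B A x) ↔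
          J ∪ J' ∪ supp hB u ⊆ K := by
      intro K
      refine (and_congr (hA.germAt_le_iff hB hk hr) (hA.germAt_le_iff hB hk hr)).trans ?_
      simp only [inv_one, one_mul, mem_parab_iff hB, Set.union_subset_iff, and_assoc]
      refine and_congr_right fun _ => ⟨fun h => h.2, fun h => ⟨?_, h⟩⟩
      intro b hb
      simp [supp, act_one] at hb
    refine ⟨germAt hk hr (1, J ∪ J' ∪ supp hB u), ?_, ?_⟩
    · have := (hle _).2 subset_rfl
      rintro _ (rfl | rfl)
      exacts [this.1, this.2]
    · intro μ' hμ'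
      have h1 : μ' ≤ germAt hk hr (1, J) := hμ' (Or.inl rfl)
      have h2 : μ' ≤ germAt hk hr (u, J') := hμ' (Or.inr rfl)
      obtain ⟨K, -, rfl⟩ := hA.exists_of_le_germAt hB hk hr h1
      exact (hA.germAt_le_iff hB hk hr).2 ⟨(hle K).1 ⟨h1, h2⟩, by simp [one_mem]⟩
  · obtain ⟨f, hf, p, hp, q, rfl⟩ := exists_eq_germAt μ
    obtain ⟨n, ⟨e⟩⟩ := Finite.exists_equiv_fin {b : B // b ∉ q.2}
    -- Passing to larger faces shrinks the type, so a set `K` of vertices is sent to the type whose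
    -- complement is `K`.
    let S : Set (Fin n) → Set B := fun K => {b | ∀ h : b ∉ q.2, e ⟨b, h⟩ ∉ K}
    have hS : ∀ K, q.2 ⊆ S K := fun K b hb h => absurd hb h
    have hSS : ∀ K K', S K' ⊆ S K ↔ K ⊆ K' := by
      intro K K'
      constructor
      · intro h i hi
        by_contra hi'
        have h1 : ((e.symm i : {b : B // b ∉ q.2}) : B) ∈ S K' := fun h => by simpa using hi'
        exact h h1 (e.symm i).2 (by simpa using hi)
      · exact fun h b hb hq hK => hb hq (h hK)
    have hle : ∀ K, germAt hf hp (q.1, S K) ≤ (germAt hf hp q : Residue P B A x) := fun K =>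
      (hA.germAt_le_iff hB hf hp).2 ⟨hS K, by simp [one_mem]⟩
    let a : Set (Fin n) → Set.Iic (germAt hf hp q : Residue P B A x) := fun K =>
      ⟨germAt hf hp (q.1, S K), hle K⟩
    have ha : Function.Surjective a := by
      rintro ⟨μ, hμ⟩
      obtain ⟨J, hJ, rfl⟩ := hA.exists_of_le_germAt hB hf hp hμ
      refine ⟨{i | ((e.symm i : {b : B // b ∉ q.2}) : B) ∉ J}, Subtype.ext ?_⟩
      change germAt hf hp _ = germAt hf hp _
      congr 2
      ext b
      simp only [S, Set.mem_ofPred_eq, Equiv.symm_apply_apply, not_not]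
      exact ⟨fun h => by_contra fun hb => hb (h fun h' => hb (hJ h')), fun h _ => h⟩
    obtain ⟨φ, -⟩ := exists_orderIso_of_le_iff a id ha Function.surjective_id fun K K' =>
      (hA.germAt_le_iff hB hf hp).trans (by simp [hSS, one_mem])
    exact ⟨n, ⟨φ⟩⟩

theorem isSphericalBuilding_residue (hA : IsAffineBuilding P B T A) (hB : IsBasis P B) (x : X) :
    @IsSphericalBuilding _ _ _ (simpleReflection P B) (Residue P B A x) (hA.residueOrder hB x)
      (residueApartments P B A x : Set (Set (residue P B A x))) := by
  let _ := hA.residueOrder hB x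
  refine ⟨finite_weylGroup, hA.isSimplicialPoset_residue hB x, ?_, ?_, ?_, ?_, ?_⟩
  · refine Set.eq_univ_of_forall fun μ => ?_
    obtain ⟨f, hf, p, hp, q, rfl⟩ := exists_eq_germAt μ
    exact ⟨_, (hA.mem_residueApartments_iff hB).2 ⟨f, hf, p, hp, rfl⟩, q, rfl⟩
  · intro E hE
    obtain ⟨f, hf, p, hp, rfl⟩ := (hA.mem_residueApartments_iff hB).1 hE
    rintro _ μ hμ ⟨q, rfl⟩
    obtain ⟨J, -, rfl⟩ := hA.exists_of_le_germAt hB hf hp hμ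
    exact ⟨_, rfl⟩
  · intro E hE
    obtain ⟨f, hf, p, hp, rfl⟩ := (hA.mem_residueApartments_iff hB).1 hE
    obtain ⟨φ, -⟩ := exists_orderIso_of_le_iff
      (Set.rangeFactorization (germAt hf hp : _ → Residue P B A x)) (coset P B)
      Set.rangeFactorization_surjective coset_surjective fun q q' =>
        (hA.germAt_le_iff hB hf hp).trans (coset_le_iff hB q q').symm
    exact ⟨φ⟩
  · intro μ ν
    obtain ⟨k, hk, r, hr, J, J', u, rfl, rfl⟩ := hA.exists_common_germAt hB μ ν
    exact ⟨_, (hA.mem_residueApartments_iff hB).2 ⟨k, hk, r, hr, rfl⟩, ⟨_, rfl⟩, ⟨_, rfl⟩⟩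
  · intro E hE E' hE' μ ν h1 h1' h2 h2'
    obtain ⟨g, hg, r, hr, rfl⟩ := (hA.mem_residueApartments_iff hB).1 hE
    obtain ⟨f, hf, p, hp, rfl⟩ := (hA.mem_residueApartments_iff hB).1 hE'
    obtain ⟨u, hu⟩ := hA.exists_germAt_transition hB hf hg hp hr
    let a : weylGroup P × Set B → Set.range (germAt hg hr : _ → Residue P B A x) :=
      fun q => ⟨germAt hg hr q, q, rfl⟩
    -- The isomorphism is left translation by the linear part of the change of charts. It fixes
    -- every germ lying locally in both apartments, in particular the faces of common simplices.
    let b : weylGroup P × Set B → Set.range (germAt hf hp : _ → Residue P B A x) :=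
      fun q => ⟨germAt hf hp (u * q.1, q.2), _, rfl⟩
    have ha : Function.Surjective a := by
      rintro ⟨_, q, rfl⟩
      exact ⟨q, rfl⟩
    have hb : Function.Surjective b := by
      rintro ⟨_, q, rfl⟩
      exact ⟨(u⁻¹ * q.1, q.2), Subtype.ext (by simp [b])⟩
    obtain ⟨φ, hφ⟩ := exists_orderIso_of_le_iff a b ha hb fun q q' =>
      (hA.germAt_le_iff hB hg hr).trans
        (Iff.trans (by simp [mul_assoc]) (hA.germAt_le_iff hB hf hp).symm)
    refine ⟨φ, ?_⟩
    rintro ⟨_, q, rfl⟩ hc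
    rw [show φ ⟨germAt hg hr q, q, rfl⟩ = b q from hφ q]
    refine (hu q ?_).symm
    rcases hc with hc | hc
    · obtain ⟨q', rfl⟩ := h1'
      exact hA.locLE_range hB (hf := hf) (hg := hg) (hp := hp) (hr := hr) hc
    · obtain ⟨q', rfl⟩ := h2'
      exact hA.locLE_range hB (hf := hf) (hg := hg) (hp := hp) (hr := hr) hc

end IsAffineBuilding
end Building

section Building
variable {F : Subfield ℝ} {ι M N Λ X : Type*} [Fintype ι] [AddCommGroup M] [Module F M]
  [AddCommGroup N] [Module F N] {P : RootPairing ι F M N} [P.IsRootSystem] {B : Set ι}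
  [AddCommGroup Λ] [LinearOrder Λ] [IsOrderedAddMonoid Λ] [Module F Λ] [PosSMulMono F Λ]
  {T : AddSubgroup (ModelSpace F M Λ)} {A : Set (ModelSpace F M Λ → X)}

/-! ### Thickness of the residue at a special vertex -/

theorem act_reflection_wperm (w : weylGroup P) (i : ι) (v : ModelSpace F M Λ) :
    act (P.reflection (wperm w i)) (act w.1 v) = act w.1 (act (P.reflection i) v) := by
  have h : sref P (wperm w i) * w = w * sref P i := by rw [← conj_sref]; simp
  have h' := congrArg Subtype.val h
  have h2 : (sref P (wperm w i)).1 * w.1 = w.1 * (sref P i).1 := h'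
  change act (sref P (wperm w i)).1 _ = act w.1 (act (sref P i).1 v)
  rw [← act_mul, h2, act_mul]

theorem IsSpecialPoint.act_add (hTW : ∀ w ∈ weylGroup P, ∀ t ∈ T, act w t ∈ T)
    {v : ModelSpace F M Λ} (hv : IsSpecialPoint P T v) (w : weylGroup P) {t : ModelSpace F M Λ}
    (ht : t ∈ T) : IsSpecialPoint P T (act w.1 v + t) := by
  intro j
  obtain ⟨c, ⟨i', t', ht', hneg, hH⟩, hvc⟩ := hv (wperm w⁻¹ j)
  have hco : ∀ u : ModelSpace F M Λ, coev P j (act w.1 u) = coev P (wperm w⁻¹ j) u := fun u => coev_act' w j u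
  -- This is the translation part of the given affine reflection conjugated by `u ↦ act w.1 u + t`;
  -- it stays in `T` because `T` is Weyl-stable.
  refine ⟨_, ⟨wperm w i', act w.1 t' + t - act (P.reflection (wperm w i')) t, ?_, ?_, ?_⟩, rfl⟩
  · exact sub_mem (add_mem (hTW _ w.2 _ ht') ht) (hTW _ (sref P (wperm w i')).2 _ ht)
  · have hinv : act (P.reflection (wperm w i')) (act (P.reflection (wperm w i')) t) = t := by
      have := act_act_inv (sref P (wperm w i')) t
      rwa [sref_inv] at this
    rw [map_sub, map_add, act_reflection_wperm, hneg, hinv, map_neg]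
    abel
  · ext u
    obtain ⟨u, rfl⟩ : ∃ u', act w.1 u' + t = u := ⟨act w⁻¹.1 (u - t), by
      rw [act_act_inv, sub_add_cancel]⟩
    have h1 : u ∈ hyperplane P (wperm w⁻¹ j) c ↔ act (P.reflection i') u + t' = u := by
      rw [hH]; rfl
    have h2 : act w.1 u + t ∈ hyperplane P j (coev P j (act w.1 v + t)) ↔
        u ∈ hyperplane P (wperm w⁻¹ j) c := by
      have hvc' : coev P (wperm w⁻¹ j) v = c := hvc
      change coev P j (act w.1 u + t) = coev P j (act w.1 v + t) ↔ coev P (wperm w⁻¹ j) u = c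
      rw [map_add, map_add, add_left_inj, hco, hco, hvc']
    rw [h2, h1]
    change _ ↔ act (P.reflection (wperm w i')) (act w.1 u + t) +
      (act w.1 t' + t - act (P.reflection (wperm w i')) t) = act w.1 u + t
    rw [map_add, act_reflection_wperm]
    have h3 : act w.1 (act (P.reflection i') u) + act (P.reflection (wperm w i')) t +
        (act w.1 t' + t - act (P.reflection (wperm w i')) t) =
        act w.1 (act (P.reflection i') u + t') + t := by rw [map_add]; abel
    rw [h3, add_left_inj, EmbeddingLike.apply_eq_iff_eq]

/-- No half-space contains two adjacent chambers near a common panel on its boundary. -/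
theorem IsBasis.not_forall_coev_nonneg [Nontrivial Λ] (hB : IsBasis P B) (j : ι) (b : B) {e : Λ}
    (he : 0 < e) (h1 : ∀ v ∈ fundChamber P B, nrm P B v < e → 0 ≤ coev P j v)
    (h2 : ∀ v ∈ fundChamber P B, nrm P B v < e → 0 ≤ coev P j (act (P.reflection b) v))
    (h3 : ∀ v ∈ face Λ P B {b}, nrm P B v < e → coev P j v = 0) : False := by
  -- On an edge of the panel only the coroot of `b'` is non-zero, so it cannot occur in the coroot
  -- of `j`. What remains is a multiple of the coroot of `b`, which the reflection negates.
  have hk : ∀ b', b' ≠ b → hB.kcoef j b' = 0 := by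
    intro b' hb'
    obtain ⟨v, hv, hJ, hve⟩ := hB.exists_generic_lt (M := M) {b'}ᶜ he
    have h0 := h3 v (mem_face.2 ⟨hv, fun c hc => (hJ c).2 fun h => hb'
      ((Set.mem_singleton_iff.1 h).symm.trans (Set.mem_singleton_iff.1 hc))⟩) hve
    rw [hB.coev_eq_sum, Finset.sum_eq_single b' (fun c _ hc => by
      rw [(hJ c).2 (by simpa using hc), smul_zero]) (by simp)] at h0
    rcases smul_eq_zero.1 h0 with h | h
    · exact h
    · exact absurd rfl ((hJ b').1 h)
  have hj : ∀ v : ModelSpace F M Λ, coev P j v = hB.kcoef j b • coev P b v := fun v => by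
    rw [hB.coev_eq_sum]
    exact Finset.sum_eq_single b (fun c _ hc => by rw [hk c hc, zero_smul]) (by simp)
  obtain ⟨v, hv, hve⟩ := hB.exists_regular_lt (M := M) he
  have hC := hB.mem_fundChamber_iff.2 fun b => (hv b).le
  have e1 := h1 v hC hve
  have e2 := h2 v hC hve
  have hs : coev P b (act (P.reflection b) v) = -coev P b v := by
    rw [act_reflection, map_sub, coev_tmul, P.root_coroot'_eq_pairing, P.pairing_same, two_smul]
    abel
  rw [hj, hs, smul_neg, ← hj, neg_nonneg] at e2
  have e3 := le_antisymm e2 e1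
  by_cases hpos : IsPos P B j
  · exact (hB.coev_pos_of_simple hv hpos).ne' e3
  · have := hB.coev_pos_of_simple hv ((hB.isPos_nidx_iff j).2 hpos)
    rw [coev_nidx, e3, neg_zero] at this
    exact lt_irrefl _ this

namespace IsAffineBuilding

variable [Nontrivial Λ] {x : X}

theorem isSpecialPoint_of_eq (hA : IsAffineBuilding P B T A)
    (hTW : ∀ w ∈ weylGroup P, ∀ t ∈ T, act w t ∈ T) (hx : IsSpecialVertex P T A x)
    {f : ModelSpace F M Λ → X} (hf : f ∈ A) {p : ModelSpace F M Λ} (hp : f p = x) :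
    IsSpecialPoint P T p := by
  obtain ⟨g, hg, v, hv, hgv⟩ := hx
  obtain ⟨-, _, ⟨w, hw, t, ht, rfl⟩, h⟩ := hA.a2 g hg f hf ⟨x, ⟨v, hgv⟩, ⟨p, hp⟩⟩
  have h1 : p = act w v + t :=
    hA.injective f hf ((hp.trans hgv.symm).trans (h ⟨p, hp.trans hgv.symm⟩))
  rw [h1]
  exact hv.act_add hTW ⟨w, hw⟩ ht

theorem locLE_range_of_eq {f g : ModelSpace F M Λ → X} {hf : f ∈ A} {hg : g ∈ A}
    {p r : ModelSpace F M Λ} {hp : f p = x} {hr : g r = x} {q q' : weylGroup P × Set B}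
    (h : (germAt hg hr q : Residue P B A x) = germAt hf hp q') :
    LocLE P B A x (simplexAt P B g r q.1 q.2) (Set.range f) :=
  (germ_eq_iff.1 (congrArg Subtype.val h)).1.trans (LocLE.of_subset simplexAt_subset_range)

/-- Changes of charts keep `J`, so the type of a germ is intrinsic; maximality can then be tested in
any chart. -/
theorem germAt_type (hA : IsAffineBuilding P B T A) (hB : IsBasis P B)
    {f g : ModelSpace F M Λ → X} (hf : f ∈ A) (hg : g ∈ A) {p r : ModelSpace F M Λ}
    (hp : f p = x) (hr : g r = x) {q q' : weylGroup P × Set B}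
    (h : (germAt hg hr q : Residue P B A x) = germAt hf hp q') : q.2 = q'.2 := by
  obtain ⟨u, hu⟩ := hA.exists_germAt_transition hB hf hg hp hr
  have h1 := hu q (locLE_range_of_eq h)
  exact (((hA.germAt_eq_iff hB hf hp).1 (h1.symm.trans h)).1).symm

theorem isMax_germAt_iff (hA : IsAffineBuilding P B T A) (hB : IsBasis P B)
    {f : ModelSpace F M Λ → X} (hf : f ∈ A) {p : ModelSpace F M Λ} (hp : f p = x)
    {q : weylGroup P × Set B} :
    (@IsMax (Residue P B A x) (hA.residueOrder hB x).toLE (germAt hf hp q)) ↔ q.2 = ∅ := by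
  let _ := hA.residueOrder hB x
  constructor
  · intro h
    have h1 : germAt hf hp q ≤ (germAt hf hp (q.1, ∅) : Residue P B A x) :=
      (hA.germAt_le_iff hB hf hp).2 ⟨Set.empty_subset _, by simp [one_mem]⟩
    exact Set.subset_empty_iff.1 ((hA.germAt_le_iff hB hf hp).1 (h h1)).1
  · intro h ν hν
    obtain ⟨k, hk, r, hr, J, J', u, h1, h2⟩ := hA.exists_common_germAt hB (germAt hf hp q) ν
    have hJ : J = ∅ := (hA.germAt_type hB hk hf hr hp h1).symm.trans h
    rw [h1, h2] at hν ⊢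
    obtain ⟨h3, h4⟩ := (hA.germAt_le_iff hB hk hr).1 hν
    have hJ' : J' = ∅ := Set.subset_empty_iff.1 (hJ ▸ h3)
    refine (hA.germAt_le_iff hB hk hr).2 ⟨hJ ▸ Set.empty_subset _, ?_⟩
    rw [← inv_mem_iff]
    subst hJ hJ'
    simpa using h4

theorem exists_eq_of_covBy (hA : IsAffineBuilding P B T A) (hB : IsBasis P B)
    {f : ModelSpace F M Λ → X} (hf : f ∈ A) {p : ModelSpace F M Λ} (hp : f p = x)
    {w : weylGroup P} {π : Residue P B A x}
    (h : @CovBy (Residue P B A x) (hA.residueOrder hB x).toLT π (germAt hf hp (w, ∅))) :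
    ∃ b, π = germAt hf hp (w, {b}) := by
  let _ := hA.residueOrder hB x
  obtain ⟨J, -, rfl⟩ := hA.exists_of_le_germAt hB hf hp h.le
  have hJ : J.Nonempty := by
    rw [Set.nonempty_iff_ne_empty]
    rintro rfl
    exact lt_irrefl _ h.lt
  obtain ⟨b, hb⟩ := hJ
  have h1 : germAt hf hp (w, J) ≤ (germAt hf hp (w, {b}) : Residue P B A x) :=
    (hA.germAt_le_iff hB hf hp).2 ⟨by simpa using hb, by simp [one_mem]⟩
  have h2 : germAt hf hp (w, {b}) < (germAt hf hp (w, ∅) : Residue P B A x) := by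
    refine lt_of_le_of_ne ((hA.germAt_le_iff hB hf hp).2 ⟨by simp, by simp [one_mem]⟩) fun h => ?_
    have := ((hA.germAt_eq_iff hB hf hp).1 h).1
    exact Set.singleton_ne_empty b this.symm
  refine ⟨b, ?_⟩
  by_contra hne
  exact h.2 (lt_of_le_of_ne h1 hne) h2

/-- If two apartments meet in a half-apartment bounded by a hyperplane through a panel at `x`, then
one of the chambers of the first apartment on this panel is not in the second apartment. -/
theorem not_mem_of_inter_eq (hA : IsAffineBuilding P B T A) (hB : IsBasis P B)
    {f g : ModelSpace F M Λ → X} (hf : f ∈ A) (hg : g ∈ A) {p r : ModelSpace F M Λ}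
    (hp : f p = x) (hr : g r = x) {w : weylGroup P} {b : B} {i : ι} {c : Λ}
    (hH : LocLE P B A x (simplexAt P B f p w {b}) (f '' hyperplane P i c))
    (hpc : coev P i p = c) (hfg : Set.range f ∩ Set.range g = f '' halfApartment P i c)
    (h1 : (germAt hf hp (w, ∅) : Residue P B A x) ∈ Set.range (germAt hg hr))
    (h2 : (germAt hf hp (w * simpleReflection P B b, ∅) : Residue P B A x) ∈
      Set.range (germAt hg hr)) : False := by
  have key : ∀ u : weylGroup P, (germAt hf hp (u, ∅) : Residue P B A x) ∈ Set.range (germAt hg hr) →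
      ∃ e : Λ, 0 < e ∧ ∀ v ∈ fundChamber P B, nrm P B v < e → 0 ≤ coev P i (act u.1 v) := by
    rintro u ⟨q, hq⟩
    obtain ⟨e, he, h⟩ := locLE_range_of_eq hq.symm
    refine ⟨e, he, fun v hv hve => ?_⟩
    have h3 : f (p + act u.1 v) ∈ f '' halfApartment P i c := by
      rw [← hfg]
      exact ⟨⟨_, rfl⟩, h _ ⟨v, mem_face.2 ⟨hv, by simp⟩, rfl⟩
        (by rwa [hA.chartDist_add hB hf hp, hB.nrm_act])⟩
    rw [(hA.injective f hf).mem_set_image] at h3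
    have h4 : c ≤ coev P i (p + act u.1 v) := h3
    rwa [map_add, hpc, le_add_iff_nonneg_right] at h4
  obtain ⟨e₁, he₁, k1⟩ := key _ h1
  obtain ⟨e₂, he₂, k2⟩ := key _ h2
  obtain ⟨e₃, he₃, k3⟩ := hH
  refine hB.not_forall_coev_nonneg (wperm w⁻¹ i) b (lt_min he₁ (lt_min he₂ he₃)) ?_ ?_ ?_
  · intro v hv hve
    rw [← coev_act']
    exact k1 v hv (hve.trans_le (min_le_left _ _))
  · intro v hv hve
    have := k2 v hv (hve.trans_le ((min_le_right _ _).trans (min_le_left _ _)))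
    rwa [Subgroup.coe_mul, act_mul, coev_act'] at this
  · intro v hv hve
    have h3 := k3 _ ⟨v, hv, rfl⟩ (by
      rw [hA.chartDist_add hB hf hp, hB.nrm_act]
      exact hve.trans_le ((min_le_right _ _).trans (min_le_right _ _)))
    rw [(hA.injective f hf).mem_set_image] at h3
    have h4 : coev P i (p + act w.1 v) = c := h3
    rwa [map_add, hpc, add_eq_left, coev_act'] at h4

/-- The branching apartments `f` and `g` contain the wall of the panel, hence two chambers on the
panel each. If `g` contributed no new chamber, both chambers of `f` would lie in `g`, whereas the
two apartments share only one side of the wall. -/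
theorem isThickComplex_residue (hA : IsAffineBuilding P B T A) (hB : IsBasis P B)
    (hTW : ∀ w ∈ weylGroup P, ∀ t ∈ T, act w t ∈ T) (hx : IsSpecialVertex P T A x)
    (hthick : IsThick P T A) :
    @IsThickComplex (Residue P B A x) (hA.residueOrder hB x) := by
  let _ := hA.residueOrder hB x
  rintro π ⟨γ, hγ, hcov⟩
  obtain ⟨k, hk, s, hs, ⟨w, J⟩, rfl⟩ := exists_eq_germAt γ
  obtain rfl : J = ∅ := (hA.isMax_germAt_iff hB hk hs).1 hγ
  obtain ⟨b, rfl⟩ := hA.exists_eq_of_covBy hB hk hs hcov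
  obtain ⟨c₀, hH, hc₀⟩ := hA.isSpecialPoint_of_eq hTW hx hk hs (wperm w b)
  obtain ⟨f, hf, g, hg, hHf, hHg, i, c, hic, hfg⟩ := hthick.branch k hk _ hH
  have hpanel : simplexAt P B k s w {b} ⊆ k '' hyperplane P (wperm w b) c₀ := by
    rintro _ ⟨v, hv, rfl⟩
    refine ⟨_, ?_, rfl⟩
    have h1 : coev P (wperm w b) s = c₀ := hc₀
    change coev P (wperm w b) (s + act w.1 v) = c₀
    rw [map_add, coev_act, (mem_face.1 hv).2 b rfl, h1, add_zero]
  have hxH : x ∈ k '' hyperplane P (wperm w b) c₀ := ⟨s, hc₀, hs⟩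
  obtain ⟨p, hp⟩ := hHf hxH
  obtain ⟨r, hr⟩ := hHg hxH
  obtain ⟨u, hu⟩ := hA.exists_germAt_transition hB hf hk hp hs
  obtain ⟨u', hu'⟩ := hA.exists_germAt_transition hB hg hk hr hs
  have e1 := hu (w, {b}) (LocLE.of_subset (hpanel.trans hHf))
  have e2 := hu' (w, {b}) (LocLE.of_subset (hpanel.trans hHg))
  -- chambers on the panel in an arbitrary chart
  have hmem : ∀ {h : ModelSpace F M Λ → X} (hh : h ∈ A) {t : ModelSpace F M Λ} (ht : h t = x)
      (a : weylGroup P),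
      (germAt hk hs (w, {b}) : Residue P B A x) = germAt hh ht (a, {b}) →
      germAt hh ht (a, ∅) ∈ {c : Residue P B A x | IsMax c ∧ germAt hk hs (w, {b}) ≤ c} ∧
      germAt hh ht (a * simpleReflection P B b, ∅) ∈
        {c : Residue P B A x | IsMax c ∧ germAt hk hs (w, {b}) ≤ c} ∧
      (germAt hh ht (a, ∅) : Residue P B A x) ≠ germAt hh ht (a * simpleReflection P B b, ∅) := by
    intro h hh t ht a heq
    rw [heq]
    refine ⟨⟨(hA.isMax_germAt_iff hB hh ht).2 rfl, (hA.germAt_le_iff hB hh ht).2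
      ⟨by simp, by simp [one_mem]⟩⟩, ⟨(hA.isMax_germAt_iff hB hh ht).2 rfl,
      (hA.germAt_le_iff hB hh ht).2 ⟨by simp, ?_⟩⟩, fun h0 => ?_⟩
    · simpa using (simpleReflection_mem_parab_iff hB).2 (Set.mem_singleton b)
    · have := ((hA.germAt_eq_iff hB hh ht).1 h0).2
      rw [inv_mul_cancel_left, simpleReflection_mem_parab_iff hB] at this
      exact this
  obtain ⟨m1, m2, m3⟩ := hmem hf hp (u * w) e1
  obtain ⟨n1, n2, n3⟩ := hmem hg hr (u' * w) e2
  set c₁ : Residue P B A x := germAt hf hp (u * w, ∅) with hc₁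
  set c₂ : Residue P B A x := germAt hf hp (u * w * simpleReflection P B b, ∅) with hc₂
  set d₁ : Residue P B A x := germAt hg hr (u' * w, ∅) with hd₁
  set d₂ : Residue P B A x := germAt hg hr (u' * w * simpleReflection P B b, ∅) with hd₂
  have hpc : coev P i p = c := by
    have : f p ∈ f '' hyperplane P i c := by rw [hic, hp]; exact hxH
    rwa [(hA.injective f hf).mem_set_image] at this
  have hnot : ¬(c₁ ∈ Set.range (germAt hg hr) ∧ c₂ ∈ Set.range (germAt hg hr)) := fun h => by
    refine hA.not_mem_of_inter_eq hB hf hg hp hr ?_ hpc hfg h.1 h.2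
    rw [hic]
    exact ((germ_eq_iff.1 (congrArg Subtype.val e1)).2).trans (LocLE.of_subset hpanel)
  have hd : ∃ d : Residue P B A x, d ∈ {c | IsMax c ∧ germAt hk hs (w, {b}) ≤ c} ∧
      d ≠ c₁ ∧ d ≠ c₂ := by
    -- Two distinct chambers of `g` among the two chambers of `f` must exhaust them.
    by_contra! hall
    apply hnot
    have a1 := hall d₁ n1
    have a2 := hall d₂ n2
    by_cases h1 : d₁ = c₁
    · by_cases h2 : d₂ = c₁
      · exact absurd (h1.trans h2.symm) n3
      · exact ⟨⟨_, h1⟩, ⟨_, a2 h2⟩⟩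
    · have h1' := a1 h1
      by_cases h2 : d₂ = c₁
      · exact ⟨⟨_, h2⟩, ⟨_, h1'⟩⟩
      · exact absurd (h1'.trans (a2 h2).symm) n3
  obtain ⟨d, hd1, hd2, hd3⟩ := hd
  have hcard : ({c₁, c₂, d} : Set (Residue P B A x)).encard = 3 := by
    rw [Set.encard_eq_three]
    exact ⟨c₁, c₂, d, m3, hd2.symm, hd3.symm, rfl⟩
  rw [← hcard]
  refine Set.encard_le_encard ?_
  rintro _ (rfl | rfl | rfl)
  exacts [m1, m2, hd1]

end IsAffineBuilding
end Building

section Building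
variable {F : Subfield ℝ} {ι M N Λ X : Type*} [Fintype ι] [AddCommGroup M] [Module F M]
  [AddCommGroup N] [Module F N] {P : RootPairing ι F M N} [P.IsRootSystem] {B : Set ι}
  [AddCommGroup Λ] [LinearOrder Λ] [IsOrderedAddMonoid Λ] [Module F Λ] [PosSMulMono F Λ]
  {T : AddSubgroup (ModelSpace F M Λ)} {A A' : Set (ModelSpace F M Λ → X)}

/-! ### Isometries of boxes -/

/-- The points of the fundamental chamber between the origin and `v`. -/
def box (P : RootPairing ι F M N) (B : Set ι) (v : ModelSpace F M Λ) :
    Set (ModelSpace F M Λ) :=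
  {u | u ∈ fundChamber P B ∧ v - u ∈ fundChamber P B}

theorem IsBasis.mem_box_iff (hB : IsBasis P B) {u v : ModelSpace F M Λ} :
    u ∈ box P B v ↔ ∀ b : B, 0 ≤ coev P b u ∧ coev P b u ≤ coev P b v := by
  change u ∈ fundChamber P B ∧ v - u ∈ fundChamber P B ↔ _
  rw [hB.mem_fundChamber_iff, hB.mem_fundChamber_iff, forall_and]
  simp only [map_sub, sub_nonneg]

theorem IsBasis.mem_box_iff_nrm (hB : IsBasis P B) {u v : ModelSpace F M Λ}
    (hv : v ∈ fundChamber P B) : u ∈ box P B v ↔ nrm P B u + nrm P B (v - u) = nrm P B v := by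
  constructor
  · rintro ⟨h1, h2⟩
    rw [← nrm_add_of_mem h1 h2, add_sub_cancel]
  · intro h
    refine hB.mem_box_iff.2 fun b => ?_
    have h1 : nrm P B (u + (v - u)) = nrm P B u + nrm P B (v - u) := by rw [h, add_sub_cancel]
    have h2 := hB.abs_coev_add_of_nrm h1 b
    rw [map_add] at h2
    have h3 := hB.mem_fundChamber_iff.1 hv b
    rcases abs_between h2 with ⟨h4, h5⟩ | ⟨h4, h5⟩
    · exact ⟨h4, by rwa [map_sub, sub_nonneg] at h5⟩
    · rw [map_sub, sub_nonpos] at h5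
      exact ⟨h3.trans h5, h4.trans h3⟩

/-- A distance-preserving correspondence between two boxes. -/
structure IsBoxIso (P : RootPairing ι F M N) (B : Set ι) (v v' : ModelSpace F M Λ)
    (R : ModelSpace F M Λ → ModelSpace F M Λ → Prop) : Prop where
  left : ∀ u ∈ box P B v, ∃ u' ∈ box P B v', R u u'
  right : ∀ u' ∈ box P B v', ∃ u ∈ box P B v, R u u'
  nrm_eq : ∀ u u', R u u' → nrm P B u = nrm P B u'
  nrm_sub_eq : ∀ u₁ u₁' u₂ u₂', R u₁ u₁' → R u₂ u₂' →
    nrm P B (u₂ - u₁) = nrm P B (u₂' - u₁')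

namespace IsBoxIso

variable {v v' : ModelSpace F M Λ} {R : ModelSpace F M Λ → ModelSpace F M Λ → Prop}

theorem symm (h : IsBoxIso P B v v' R) : IsBoxIso P B v' v fun u' u => R u u' :=
  ⟨h.right, h.left, fun _ _ hu => (h.nrm_eq _ _ hu).symm,
    fun _ _ _ _ h₁ h₂ => (h.nrm_sub_eq _ _ _ _ h₁ h₂).symm⟩

theorem mem_box (h : IsBoxIso P B v v' R) (hB : IsBasis P B) {u₁ u₁' u₂ u₂' : ModelSpace F M Λ}
    (h₁ : R u₁ u₁') (h₂ : R u₂ u₂') (hu₂ : u₂ ∈ fundChamber P B) (hu₂' : u₂' ∈ fundChamber P B)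
    (hu : u₁ ∈ box P B u₂) : u₁' ∈ box P B u₂' := by
  rw [hB.mem_box_iff_nrm hu₂', ← h.nrm_eq _ _ h₁, ← h.nrm_eq _ _ h₂,
    ← h.nrm_sub_eq _ _ _ _ h₁ h₂]
  exact (hB.mem_box_iff_nrm hu₂).1 hu

/-- Disjointness of supports is an order property: only 0 lies below both vectors. A common lower
bound concentrated at `b` would correspond to one for the original pair. -/
theorem perp (h : IsBoxIso P B v v' R) (hB : IsBasis P B) {u₁ u₁' u₂ u₂' : ModelSpace F M Λ}
    (h₁ : R u₁ u₁') (h₂ : R u₂ u₂') (hu₁ : u₁ ∈ box P B v) (hu₂ : u₂ ∈ box P B v)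
    (hu₁' : u₁' ∈ box P B v') (hu₂' : u₂' ∈ box P B v')
    (hperp : ∀ b : B, coev P b u₁ = 0 ∨ coev P b u₂ = 0) (b : B) :
    coev P b u₁' = 0 ∨ coev P b u₂' = 0 := by
  obtain ⟨t', ht'⟩ := hB.exists_coev_eq
    (fun c : B => if c = b then min (coev P b u₁') (coev P b u₂') else 0)
  have k₁ := hB.mem_box_iff.1 hu₁'
  have k₂ := hB.mem_box_iff.1 hu₂'
  have ht₁ : t' ∈ box P B u₁' := hB.mem_box_iff.2 fun c => by
    rw [ht']
    split_ifs with hc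
    · subst hc; exact ⟨le_min (k₁ c).1 (k₂ c).1, min_le_left _ _⟩
    · exact ⟨le_rfl, (k₁ c).1⟩
  have ht₂ : t' ∈ box P B u₂' := hB.mem_box_iff.2 fun c => by
    rw [ht']
    split_ifs with hc
    · subst hc; exact ⟨le_min (k₁ c).1 (k₂ c).1, min_le_right _ _⟩
    · exact ⟨le_rfl, (k₂ c).1⟩
  have htv : t' ∈ box P B v' := hB.mem_box_iff.2 fun c =>
    ⟨(hB.mem_box_iff.1 ht₁ c).1, (hB.mem_box_iff.1 ht₁ c).2.trans (k₁ c).2⟩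
  obtain ⟨t, ht, hR⟩ := h.right t' htv
  have e₁ := hB.mem_box_iff.1 (h.symm.mem_box hB hR h₁ hu₁'.1 hu₁.1 ht₁)
  have e₂ := hB.mem_box_iff.1 (h.symm.mem_box hB hR h₂ hu₂'.1 hu₂.1 ht₂)
  have h0 : t = 0 := hB.ext_coev fun c => by
    rw [map_zero]
    rcases hperp c with hc | hc
    · exact le_antisymm (hc ▸ (e₁ c).2) (e₁ c).1
    · exact le_antisymm (hc ▸ (e₂ c).2) (e₂ c).1
  have h0' : t' = 0 := hB.nrm_eq_zero_iff.1 (by rw [← h.nrm_eq _ _ hR, h0, nrm_zero])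
  have hmin := ht' b
  rw [if_pos rfl, h0', map_zero] at hmin
  rcases min_choice (coev P b u₁') (coev P b u₂') with hm | hm
  · exact Or.inl (hm.symm.trans hmin.symm)
  · exact Or.inr (hm.symm.trans hmin.symm)

/-- Inclusion of supports reduces to disjointness. The part of `u₂'` at `b` is disjoint from `u₁'`,
so its counterpart is disjoint from `u₁`, hence from `u₂`; therefore it is disjoint from `u₂'`
itself and vanishes. -/
theorem zero_subset (h : IsBoxIso P B v v' R) (hB : IsBasis P B)
    {u₁ u₁' u₂ u₂' : ModelSpace F M Λ} (h₁ : R u₁ u₁') (h₂ : R u₂ u₂') (hu₁ : u₁ ∈ box P B v)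
    (hu₂ : u₂ ∈ box P B v) (hu₁' : u₁' ∈ box P B v') (hu₂' : u₂' ∈ box P B v')
    (hz : ∀ b : B, coev P b u₁ = 0 → coev P b u₂ = 0) (b : B) (hb : coev P b u₁' = 0) :
    coev P b u₂' = 0 := by
  obtain ⟨t', ht'⟩ := hB.exists_coev_eq (fun c : B => if c = b then coev P b u₂' else 0)
  have k₂ := hB.mem_box_iff.1 hu₂'
  have htv : t' ∈ box P B v' := hB.mem_box_iff.2 fun c => by
    rw [ht']
    split_ifs with hc
    · subst hc; exact k₂ c
    · exact ⟨le_rfl, (k₂ c).1.trans (k₂ c).2⟩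
  obtain ⟨t, ht, hR⟩ := h.right t' htv
  have h3 := h.symm.perp hB hR h₁ htv hu₁' ht hu₁ fun c => by
    rw [ht']
    split_ifs with hc
    · subst hc; exact Or.inr hb
    · exact Or.inl rfl
  have h4 := h.perp hB hR h₂ ht hu₂ htv hu₂' (fun c => (h3 c).imp_right (hz c)) b
  rwa [ht', if_pos rfl, or_self] at h4

/-- A correspondence of boxes maps faces to faces. -/
theorem exists_face (h : IsBoxIso P B v v' R) (hB : IsBasis P B)
    (hv : ∀ b : B, 0 < coev P b v) :
    (∀ b : B, 0 < coev P b v') ∧ ∃ σ : Set B → Set B, Function.Surjective σ ∧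
      ∀ J, ∀ u ∈ box P B v, ∀ u' ∈ box P B v', R u u' →
        (u ∈ face Λ P B J ↔ u' ∈ face Λ P B (σ J)) := by
  have hu : ∀ J : Set B, ∃ u ∈ box P B v, ∀ b : B, coev P b u = 0 ↔ b ∈ J := by
    intro J
    obtain ⟨u, hu⟩ := hB.exists_coev_eq (fun b : B => if b ∈ J then 0 else coev P b v)
    refine ⟨u, hB.mem_box_iff.2 fun b => ?_, fun b => ?_⟩ <;> rw [hu] <;> split_ifs with hb
    · exact ⟨le_rfl, (hv b).le⟩
    · exact ⟨(hv b).le, le_rfl⟩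
    · simp [hb]
    · simp [hb, (hv b).ne']
  choose u hu hz using hu
  choose u' hu' hR using fun J => h.left (u J) (hu J)
  let σ : Set B → Set B := fun J => {b | coev P b (u' J) = 0}
  have key : ∀ J, ∀ t ∈ box P B v, ∀ t' ∈ box P B v', R t t' →
      (t ∈ face Λ P B J ↔ t' ∈ face Λ P B (σ J)) := by
    intro J t ht t' ht' hRt
    rw [mem_face, mem_face]
    constructor
    · rintro ⟨-, h1⟩
      exact ⟨ht'.1, h.zero_subset hB (hR J) hRt (hu J) ht (hu' J) ht'
        fun b hb => h1 b ((hz J b).1 hb)⟩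
    · rintro ⟨-, h1⟩
      exact ⟨ht.1, fun b hb => h.symm.zero_subset hB (hR J) hRt (hu' J) ht' (hu J) ht h1 b
        ((hz J b).2 hb)⟩
  -- Inclusions of types are reflected by `σ`; finiteness then makes it a bijection.
  have hinj : Function.Injective σ := by
    have hle : ∀ J J', σ J ⊆ σ J' → J ⊆ J' := by
      intro J J' hs b hb
      have h1 := (key J (u J') (hu J') (u' J') (hu' J') (hR J')).2
        (mem_face.2 ⟨(hu' J').1, fun c hc => hs hc⟩)
      exact (hz J' b).1 ((mem_face.1 h1).2 b hb)
    exact fun J J' hJ => (hle _ _ hJ.subset).antisymm (hle _ _ hJ.symm.subset)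
  have hsurj := Finite.surjective_of_injective hinj
  refine ⟨fun b => ?_, σ, hsurj, key⟩
  -- A point of the second box with no vanishing coordinate shows that its corner `v'` is regular
  -- too.
  obtain ⟨J, hJ⟩ := hsurj ∅
  have k := hB.mem_box_iff.1 (hu' J) b
  refine lt_of_lt_of_le (lt_of_le_of_ne k.1 fun h0 => ?_) k.2
  have hb : b ∈ σ J := h0.symm
  rw [hJ] at hb
  exact hb

end IsBoxIso

/-! ### Independence of the atlas -/

theorem germ_congr (hd : chartDist P B A' = chartDist P B A) (x : X) (S : Set X) :
    germ P B A' x S = germ P B A x S := by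
  simp only [germ, SameGerm, ball, hd]

namespace IsAffineBuilding

variable [Nontrivial Λ] {x : X}

/-- A box at `x` in an apartment of one atlas whose far corner lies in an apartment of another
atlas corresponds to a box there. -/
theorem exists_box_face (hA : IsAffineBuilding P B T A) (hA' : IsAffineBuilding P B T A')
    (hB : IsBasis P B) (hd : chartDist P B A' = chartDist P B A)
    {f f' : ModelSpace F M Λ → X} (hf : f ∈ A) (hf' : f' ∈ A') {p p' : ModelSpace F M Λ}
    (hp : f p = x) (hp' : f' p' = x) {w w' : weylGroup P} {v v' : ModelSpace F M Λ}
    (hv : ∀ b : B, 0 < coev P b v) (hv' : v' ∈ fundChamber P B)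
    (h : f' (p' + act w'.1 v) = f (p + act w.1 v')) :
    ∃ σ : Set B → Set B, Function.Surjective σ ∧ ∀ J,
      germ P B A x (simplexAt P B f' p' w' J) = germ P B A x (simplexAt P B f p w (σ J)) := by
  have hvC : v ∈ fundChamber P B := hB.mem_fundChamber_iff.2 fun b => (hv b).le
  have d1 : ∀ u u', chartDist P B A (f (p + act w.1 u)) (f (p + act w.1 u')) =
      nrm P B (u' - u) := fun u u' => by
    rw [hA.chartDist_eq hB hf, add_sub_add_left_eq_sub, ← map_sub, hB.nrm_act]
  have d2 : ∀ u u', chartDist P B A (f' (p' + act w'.1 u)) (f' (p' + act w'.1 u')) =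
      nrm P B (u' - u) := fun u u' => by
    rw [← hd, hA'.chartDist_eq hB hf', add_sub_add_left_eq_sub, ← map_sub, hB.nrm_act]
  have d1' : ∀ u, chartDist P B A x (f (p + act w.1 u)) = nrm P B u := fun u => by
    rw [hA.chartDist_add hB hf hp, hB.nrm_act]
  have d2' : ∀ u, chartDist P B A x (f' (p' + act w'.1 u)) = nrm P B u := fun u => by
    rw [← hd, hA'.chartDist_add hB hf' hp', hB.nrm_act]
  have hiso : IsBoxIso P B v v' fun u u' => f' (p' + act w'.1 u) = f (p + act w.1 u') := by
    refine ⟨fun u hu => ?_, fun u hu => ?_, fun u u' hu => ?_, fun u₁ u₁' u₂ u₂' h₁ h₂ => ?_⟩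
    · have h1 := (hB.mem_box_iff_nrm hvC).1 hu
      rw [← d2', ← d2, ← d2'] at h1
      obtain ⟨z, hz⟩ := hA.mem_range_of_dist_add hB hf ⟨p, hp⟩ ⟨_, h.symm⟩ h1
      have hz' : f' (p' + act w'.1 u) = f (p + act w.1 (act w⁻¹.1 (z - p))) := by
        rw [act_act_inv, add_sub_cancel, hz]
      refine ⟨_, (hB.mem_box_iff_nrm hv').2 ?_, hz'⟩
      rw [h, hz', d1', d1, d1'] at h1
      exact h1
    · have h1 := (hB.mem_box_iff_nrm hv').1 hu
      rw [← d1', ← d1, ← d1', ← hd] at h1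
      obtain ⟨z, hz⟩ := hA'.mem_range_of_dist_add hB hf' ⟨p', hp'⟩ ⟨_, h⟩ h1
      have hz' : f' (p' + act w'.1 (act w'⁻¹.1 (z - p'))) = f (p + act w.1 u) := by
        rw [act_act_inv, add_sub_cancel, hz]
      refine ⟨_, (hB.mem_box_iff_nrm hvC).2 ?_, hz'⟩
      rw [hd, ← h, ← hz', d2', d2, d2'] at h1
      exact h1
    · rw [← d1' u', ← d2' u, hu]
    · rw [← d1 u₁', ← d2 u₁, h₁, h₂]
  obtain ⟨hv0, σ, hσ, hface⟩ := hiso.exists_face hB hv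
  refine ⟨σ, hσ, fun J => germ_eq_iff.2 ⟨?_, ?_⟩⟩
  · obtain ⟨e, he, hle⟩ := exists_pos_forall_le (Finset.univ : Finset B)
      (fun b => coev P b v) fun b _ => hv b
    refine ⟨e, he, ?_⟩
    rintro _ ⟨u, hu, rfl⟩ hlt
    rw [d2'] at hlt
    have hbox : u ∈ box P B v := hB.mem_box_iff.2 fun b =>
      ⟨hB.mem_fundChamber_iff.1 (mem_face.1 hu).1 b, (le_abs_self _).trans
        ((hB.abs_coev_le_nrm b u).trans (hlt.le.trans (hle b (Finset.mem_univ _))))⟩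
    obtain ⟨u', hu', hR⟩ := hiso.left u hbox
    exact ⟨u', (hface J u hbox u' hu' hR).1 hu, hR.symm⟩
  · obtain ⟨e, he, hle⟩ := exists_pos_forall_le (Finset.univ : Finset B)
      (fun b => coev P b v') fun b _ => hv0 b
    refine ⟨e, he, ?_⟩
    rintro _ ⟨u, hu, rfl⟩ hlt
    rw [d1'] at hlt
    have hbox : u ∈ box P B v' := hB.mem_box_iff.2 fun b =>
      ⟨hB.mem_fundChamber_iff.1 (mem_face.1 hu).1 b, (le_abs_self _).trans
        ((hB.abs_coev_le_nrm b u).trans (hlt.le.trans (hle b (Finset.mem_univ _))))⟩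
    obtain ⟨u', hu', hR⟩ := hiso.right u hbox
    exact ⟨u', (hface J u' hu' u hbox hR).2 hu, hR⟩

/-- For each apartment of one atlas there is an apartment of the other one with the same germs of
Weyl simplices at `x`. -/
theorem exists_chart_same_germs (hA : IsAffineBuilding P B T A)
    (hA' : IsAffineBuilding P B T A') (hB : IsBasis P B)
    (hd : chartDist P B A' = chartDist P B A) {f' : ModelSpace F M Λ → X} (hf' : f' ∈ A')
    {p' : ModelSpace F M Λ} (hp' : f' p' = x) :
    ∃ f ∈ A, ∃ p, f p = x ∧
      (∀ w J, ∃ w' J', germ P B A x (simplexAt P B f' p' w J) =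
        germ P B A x (simplexAt P B f p w' J')) ∧
      ∀ w' J', ∃ w J, germ P B A x (simplexAt P B f' p' w J) =
        germ P B A x (simplexAt P B f p w' J') := by
  obtain ⟨v, hv⟩ := hB.exists_regular (Λ := Λ)
  -- All points with simple coordinates bounded by those of `v` lie on metric segments between these
  -- two corners, so one apartment contains a whole neighbourhood of `x` in the other.
  obtain ⟨f, hf, hy', hy⟩ := hA.a3 (f' (p' - v)) (f' (p' + v))
  have hmem : ∀ u, (∀ b : B, |coev P b u| ≤ coev P b v) → f' (p' + u) ∈ Set.range f := by
    intro u hu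
    refine hA.mem_range_of_dist_add hB hf hy' hy ?_
    rw [← hd, hA'.chartDist_eq hB hf', hA'.chartDist_eq hB hf', hA'.chartDist_eq hB hf']
    have e1 : p' + u - (p' - v) = v + u := by abel
    have e2 : p' + v - (p' + u) = v - u := by abel
    have e3 : p' + v - (p' - v) = (v + u) + (v - u) := by abel
    rw [e1, e2, e3]
    refine (nrm_add_of_mem ?_ ?_).symm <;> refine hB.mem_fundChamber_iff.2 fun b => ?_
    · rw [map_add, ← neg_le_iff_add_nonneg']; exact neg_le.1 ((neg_le_abs _).trans (hu b))
    · rw [map_sub, sub_nonneg]; exact (le_abs_self _).trans (hu b)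
  obtain ⟨p, hp⟩ := hmem 0 fun b => by rw [map_zero, abs_zero]; exact (hv b).le
  rw [add_zero, hp'] at hp
  obtain ⟨e, he, hle⟩ := exists_pos_forall_le (Finset.univ : Finset B)
    (fun b => coev P b v) fun b _ => hv b
  obtain ⟨v₀, hv₀, hv₀e⟩ := hB.exists_regular_lt (M := M) he
  have key : ∀ w : weylGroup P, ∃ (w' : weylGroup P) (σ : Set B → Set B),
      Function.Surjective σ ∧ ∀ J, germ P B A x (simplexAt P B f' p' w J) =
        germ P B A x (simplexAt P B f p w' (σ J)) := by
    intro w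
    obtain ⟨z, hz⟩ := hmem (act w.1 v₀) fun b => (hB.abs_coev_le_nrm b _).trans
      ((hB.nrm_act w v₀).trans_le (hv₀e.le.trans (hle b (Finset.mem_univ _))))
    obtain ⟨w', hw'⟩ := hB.exists_act_mem (z - p)
    obtain ⟨σ, h⟩ := hA.exists_box_face hA' hB hd hf hf' hp hp' (w := w'⁻¹) hv₀ hw'
      (by rw [act_inv_act, add_sub_cancel, hz])
    exact ⟨w'⁻¹, σ, h⟩
  choose θ σ hσ hgerm using key
  have hσ0 : ∀ w, σ w ∅ = ∅ := by
    intro w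
    obtain ⟨J, hJ⟩ := hσ w ∅
    have h1 : LocLE P B A x (simplexAt P B f p (θ w) (σ w J)) (simplexAt P B f p (θ w) (σ w ∅)) :=
      (germ_eq_iff.1 (hgerm w J)).2.trans ((LocLE.of_subset (simplexAt_anti
        (Set.empty_subset J))).trans (germ_eq_iff.1 (hgerm w ∅)).1)
    have h2 := ((hA.simplexAt_subset hB hf hp).1 h1).1
    rw [hJ] at h2
    exact Set.subset_empty_iff.1 h2
  -- Chambers go to chambers, and distinct chambers of one apartment have distinct germs. Finiteness
  -- of the Weyl group then shows that every chamber of `f` is reached.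
  have hθ : Function.Injective θ := by
    intro w₁ w₂ h
    have h1 : germ P B A x (simplexAt P B f' p' w₁ ∅) =
        germ P B A x (simplexAt P B f' p' w₂ ∅) := by
      rw [hgerm, hgerm, hσ0, hσ0, h]
    rw [← germ_congr hd, ← germ_congr hd, hA'.germ_simplexAt_eq_iff hB hf' hp'] at h1
    have h2 := h1.2
    rw [parab, Set.image_empty, Subgroup.closure_empty, Subgroup.mem_bot] at h2
    exact inv_mul_eq_one.1 h2
  have := finite_weylGroup (P := P)
  have hθs := Finite.surjective_of_injective hθ
  refine ⟨f, hf, p, hp, fun w J => ⟨_, _, hgerm w J⟩, fun w' J' => ?_⟩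
  obtain ⟨w, rfl⟩ := hθs w'
  obtain ⟨J, rfl⟩ := hσ w J'
  exact ⟨w, J, hgerm w J⟩

theorem residue_subset (hA : IsAffineBuilding P B T A) (hA' : IsAffineBuilding P B T A')
    (hB : IsBasis P B) (hd : chartDist P B A' = chartDist P B A) :
    residue P B A' x ⊆ residue P B A x := by
  rintro _ ⟨S, hS, rfl⟩
  obtain ⟨f', hf', p', w, J, hp', rfl⟩ := isWeylSimplexAt_iff.1 hS
  obtain ⟨f, hf, p, hp, h, -⟩ := hA.exists_chart_same_germs hA' hB hd hf' hp'
  obtain ⟨w', J', h⟩ := h w J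
  exact ⟨_, isWeylSimplexAt_simplexAt hf hp w' J', (germ_congr hd _ _).trans h⟩

theorem germLE_of_germLE (hA : IsAffineBuilding P B T A) (hA' : IsAffineBuilding P B T A')
    (hB : IsBasis P B) (hd : chartDist P B A' = chartDist P B A) {μ ν : Set (Set X)}
    (h : germLE P B A' x μ ν) : germLE P B A x μ ν := by
  obtain ⟨S₁, S₂, hface, rfl, rfl⟩ := h
  obtain ⟨f, hf, p, w, J₁, J₂, hJ, hp, rfl, rfl⟩ := isFaceAt_iff.1 hface
  obtain ⟨S₁, hS₁, h₁⟩ := hA.residue_subset hA' hB hd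
    ⟨_, isWeylSimplexAt_simplexAt hf hp w J₁, rfl⟩
  obtain ⟨S₂, hS₂, h₂⟩ := hA.residue_subset hA' hB hd
    ⟨_, isWeylSimplexAt_simplexAt hf hp w J₂, rfl⟩
  rw [h₁, h₂, hA.germLE_iff hB hS₁ hS₂]
  rw [germ_congr hd] at h₁ h₂
  exact (germ_eq_iff.1 h₁).2.trans ((LocLE.of_subset (simplexAt_anti hJ)).trans
    (germ_eq_iff.1 h₂).1)

theorem residueApartments_subset (hA : IsAffineBuilding P B T A)
    (hA' : IsAffineBuilding P B T A') (hB : IsBasis P B)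
    (hd : chartDist P B A' = chartDist P B A) :
    (fun E => Subtype.val '' E) '' residueApartments P B A' x ⊆
      (fun E => Subtype.val '' E) '' residueApartments P B A x := by
  rintro _ ⟨E', hE', rfl⟩
  obtain ⟨f', hf', p', hp', rfl⟩ := (hA'.mem_residueApartments_iff hB).1 hE'
  obtain ⟨f, hf, p, hp, h1, h2⟩ := hA.exists_chart_same_germs hA' hB hd hf' hp'
  refine ⟨_, (hA.mem_residueApartments_iff hB).2 ⟨f, hf, p, hp, rfl⟩, ?_⟩
  ext μ
  constructor
  · rintro ⟨_, ⟨q, rfl⟩, rfl⟩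
    obtain ⟨w, J, h⟩ := h2 q.1 q.2
    exact ⟨_, ⟨(w, J), rfl⟩, (germ_congr hd _ _).trans h⟩
  · rintro ⟨_, ⟨q, rfl⟩, rfl⟩
    obtain ⟨w, J, h⟩ := h1 q.1 q.2
    exact ⟨_, ⟨(w, J), rfl⟩, h.symm.trans (germ_congr hd _ _).symm⟩

end IsAffineBuilding
end Building

theorem nontrivial_of_ne_bot {F : Subfield ℝ} {M Λ : Type*} [AddCommGroup M] [Module F M]
    [AddCommGroup Λ] [Module F Λ] {T : AddSubgroup (ModelSpace F M Λ)} (hT : T ≠ ⊥) :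
    Nontrivial Λ := by
  by_contra h
  rw [not_nontrivial_iff_subsingleton] at h
  have h0 : ∀ v : ModelSpace F M Λ, v = 0 := fun v => ?_
  · exact hT ((AddSubgroup.eq_bot_iff_forall _).2 fun v _ => h0 v)
  induction v using TensorProduct.induction_on with
  | zero => rfl
  | tmul m l => rw [Subsingleton.elim l 0, TensorProduct.tmul_zero]
  | add a b ha hb => rw [ha, hb, add_zero]

end GenAffine
end

theorem mainTheorem6 {F : Subfield ℝ} {ι M N Λ X : Type*} [Fintype ι]
    [AddCommGroup M] [Module F M] [AddCommGroup N] [Module F N]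
    [AddCommGroup Λ] [LinearOrder Λ] [IsOrderedAddMonoid Λ] [Module F Λ] [PosSMulMono F Λ]
    (P : RootPairing ι F M N) [P.IsRootSystem]
    (B : Set ι) (hB : GenAffine.IsBasis P B)
    (T : AddSubgroup (GenAffine.ModelSpace F M Λ)) (hT : T ≠ ⊥)
    (hTW : ∀ w ∈ GenAffine.weylGroup P, ∀ t ∈ T, GenAffine.act w t ∈ T)
    (A : Set (GenAffine.ModelSpace F M Λ → X)) (hA : GenAffine.IsAffineBuilding P B T A)
    (x : X) :
    (∃ po : PartialOrder (GenAffine.residue P B A x),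
      (∀ μ ν : GenAffine.residue P B A x, po.le μ ν ↔ GenAffine.germLE P B A x μ ν) ∧
      @IsSphericalBuilding _ _ _ (GenAffine.simpleReflection P B) (GenAffine.residue P B A x) po
        (GenAffine.residueApartments P B A x) ∧
      (GenAffine.IsSpecialVertex P T A x → GenAffine.IsThick P T A →
        @IsThickComplex (GenAffine.residue P B A x) po)) ∧
    (∀ A' : Set (GenAffine.ModelSpace F M Λ → X), GenAffine.IsAffineBuilding P B T A' →
      GenAffine.chartDist P B A' = GenAffine.chartDist P B A →
      GenAffine.residue P B A' x = GenAffine.residue P B A x ∧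
      GenAffine.germLE P B A' x = GenAffine.germLE P B A x ∧
      (fun E => Subtype.val '' E) '' GenAffine.residueApartments P B A' x =
        (fun E => Subtype.val '' E) '' GenAffine.residueApartments P B A x) := by
  have := GenAffine.nontrivial_of_ne_bot hT
  refine ⟨⟨hA.residueOrder hB x, fun _ _ => Iff.rfl, hA.isSphericalBuilding_residue hB x,
    fun hx hthick => hA.isThickComplex_residue hB hTW hx hthick⟩, fun A' hA' hd => ⟨?_, ?_, ?_⟩⟩
  · exact (hA.residue_subset hA' hB hd).antisymm (hA'.residue_subset hA hB hd.symm)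
  · funext μ ν
    exact propext ⟨hA.germLE_of_germLE hA' hB hd, hA'.germLE_of_germLE hA hB hd.symm⟩
  · exact (hA.residueApartments_subset hA' hB hd).antisymm
      (hA'.residueApartments_subset hA hB hd.symm)
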